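/- A \emph{database} $\mathcal D=(\Sigma,V,E,\mathrm{src},\mathrm{tgt},\mathrm{lbl})$ consists of finite sets $\Sigma$ of labels, $V$ of vertices, $E$ of edges, and maps $\mathrm{src},\mathrm{tgt}:E\to V$, $\mathrm{lbl}:E\to 2^\Sigma$; its size is $|\mathcal D|=|V|+|E|+\sum_{e\in E}|\mathrm{lbl}(e)|$. A nondeterministic automaton $\mathcal A=(\Sigma,Q,\Delta,I,F)$ has size $|\mathcal A|=|\Sigma|+|Q|+|\Delta|+|I|+|F|$. A walk $w=\langle v_0,e_0,v_1,\dots,e_{k-1},v_k\rangle$ (with $k\ge 0$, $\mathrm{src}(e_i)=v_i$, $\mathrm{tgt}(e_i)=v_{i+1}$) goes from $v_0$ to $v_k$, has length $k$, and \emph{matches} $\mathcal A$ if $\mathcal A$ accepts some word $a_0\cdots a_{k-1}$ with $a_i\in\mathrm{lbl}(e_i)$ for all $i$. For $s,t\in V$ let $\lambda$ be the minimal length of a walk from $s$ to $t$ that matches $\mathcal A$ (if there is one), and let $[\![\mathcal A]\!](\mathcal D,s,t)$ be the set of all walks from $s$ to $t$ of length $\lambda$ that match $\mathcal A$ (empty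 if no walk from $s$ to $t$ matches). The machine model is a unit-cost random access machine (a structured program over registers and a memory of natural numbers, with addition and subtraction of program constants, loads and stores at the address given by the sum of two registers, comparisons, sequencing, conditionals and while loops). Its answers are written one number per step, and a separate step marks the end of each answer. Labels, vertices, edges and states are numbered $0,1,2,\dots$. The memory initially contains the input in a form that provides in time $O(1)$: for each vertex, the arrays of its incoming and of its outgoing edges with their lengths; for each edge, its source, its target, the list of its labels, and its position in the array of incoming edges of its target; for each state $p$ and label $a$, the list without repetition of the states in $\Delta(p,a)$; and the lists of the initial and of the final states. The lists may be in any order, and all cells outside the input are zero. \textbf{Theorem.} There are a program and a constant $c$ such that, for all $\mathcal D$, $\mathcal A$, $s$, $t$ and every such representation of them in memory, the program halts after having output every walk of $[\![\mathcal A]\!](\mathcal D,s,t)$ exactly once, and nothing else (each walk is output as the sequence $v_0,e_0,v_1,\dots,e_{k-1},v_k$), and moreover: (1) (preprocessing) the first output is completed within $c\cdot(|\mathcal D|\cdot|\mathcal A|+1)$ steps; if there is no output, the program halts within that many steps; (2) (delay) the number of steps between the completions of two consecutive outputs is at most $c\cdot\lambda\cdot|\mathcal A|$, and the program halts at most $c\cdot(\lambda\cdot|\mathcal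 A|+1)$ steps after the last output. -/

import Mathlib

/-! ### Databases, walks, and the set of shortest matching walks -/

/-- A multi-labeled multi-edge directed graph with labels in `α`, vertices in `V`, edges in `E`. -/
structure Database (α V E : Type*) where
  src : E → V
  tgt : E → V
  lbl : E → Finset α

namespace Database

variable {α V E : Type*}

/-- The size `|V| + |E| + ∑ₑ |lbl e|` of a database. -/
def size [Fintype V] [Fintype E] (D : Database α V E) : ℕ :=
  Fintype.card V + Fintype.card E + ∑ e : E, (D.lbl e).card

/-- The consecutive edges `es` can be followed from the vertex `v`. -/
def Follows (D : Database α V E) : V → List E → Prop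
  | _, [] => True
  | v, e :: es => D.src e = v ∧ D.Follows (D.tgt e) es

/-- A walk `⟨v₀, e₀, v₁, …, e_{k-1}, v_k⟩`, given by `v₀` and `e₀, …, e_{k-1}`; the vertices
`v₁, …, v_k` are the targets of the edges. -/
structure Walk (D : Database α V E) where
  source : V
  edges : List E
  follows : D.Follows source edges

namespace Walk

variable {D : Database α V E}

/-- The number of edges. -/
def len (w : D.Walk) : ℕ := w.edges.length

/-- The last vertex. -/
def target (w : D.Walk) : V := w.edges.foldl (fun _ e => D.tgt e) w.source

/-- The words `a₀ a₁ ⋯ a_{k-1}` with `aᵢ ∈ lbl eᵢ` for all `i`. -/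
def words (w : D.Walk) : Set (List α) :=
  {x | List.Forall₂ (fun a e => a ∈ D.lbl e) x w.edges}

/-- The automaton accepts at least one of the words carried by the walk. -/
def Matches {Q : Type*} (w : D.Walk) (A : NFA α Q) : Prop :=
  ∃ x ∈ w.words, x ∈ A.accepts

end Walk

/-- The walks from `s` to `t` that match `A`. -/
def matchingWalks {Q : Type*} (D : Database α V E) (A : NFA α Q) (s t : V) : Set D.Walk :=
  {w | w.source = s ∧ w.target = t ∧ w.Matches A}

/-- The minimal length `λ` of a walk from `s` to `t` that matches `A` (meaningful only if there is
such a walk). -/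
noncomputable def minLen {Q : Type*} (D : Database α V E) (A : NFA α Q) (s t : V) : ℕ :=
  sInf (Walk.len '' D.matchingWalks A s t)

/-- The walks from `s` to `t` that match `A` and have minimal length. -/
def shortestWalks {Q : Type*} (D : Database α V E) (A : NFA α Q) (s t : V) : Set D.Walk :=
  {w | w ∈ D.matchingWalks A s t ∧ w.len = D.minLen A s t}

end Database

/-- The sequence of numbers `v₀, e₀, v₁, …, e_{k-1}, v_k` that spells out a walk. -/
def Database.Walk.spell {k n m : ℕ} {D : Database (Fin k) (Fin n) (Fin m)} (w : D.Walk) :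
    List ℕ :=
  (w.source : ℕ) :: w.edges.flatMap (fun e : Fin m => [(e : ℕ), (D.tgt e : ℕ)])

/-- The size `|Σ| + |Q| + |Δ| + |I| + |F|` of a nondeterministic automaton. -/
noncomputable def automatonSize {α Q : Type*} (A : NFA α Q) : ℕ :=
  Nat.card α + Nat.card Q + {x : Q × α × Q | x.2.2 ∈ A.step x.1 x.2.1}.ncard +
    A.start.ncard + A.accept.ncard

/-! ### A random access machine with unit-cost instructions

The arithmetic is limited to adding or subtracting a constant that is fixed in the program, so a
run of `T` steps only handles numbers that exceed those of the input by `O(T)`. -/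

namespace RAM

/-- Registers are numbered by natural numbers; `x`, `y`, `a`, `i` are registers. -/
inductive Instr where
  /-- `x := c` -/
  | set (x c : ℕ)
  /-- `x := y + c` -/
  | addConst (x y c : ℕ)
  /-- `x := y - c`, truncated at `0` -/
  | subConst (x y c : ℕ)
  /-- `x := mem[a + i]` -/
  | load (x a i : ℕ)
  /-- `mem[a + i] := x` -/
  | store (a i x : ℕ)
  /-- append the content of `x` to the answer that is being written -/
  | write (x : ℕ)
  /-- deliver the answer that has been written, and start a new empty one -/
  | emit
  /-- no effect -/
  | nop

/-- Tests that compare the contents of two registers. -/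
inductive Test where
  | eq (x y : ℕ)
  | lt (x y : ℕ)

/-- Programs: single instructions, `p` followed by `q`, `if b then p else q`, and
`while b do p`. -/
inductive Prog where
  | instr (i : Instr)
  | seq (p q : Prog)
  | ite (b : Test) (p q : Prog)
  | loop (b : Test) (p : Prog)

/-- The state of the machine: the registers, the memory, the number `clock` of steps made so far,
the answer that is being written, and the answers delivered so far, in chronological order, each
with the time of its delivery. -/
structure State where
  reg : ℕ → ℕ
  mem : ℕ → ℕ
  clock : ℕ
  buf : List ℕ
  log : List (List ℕ × ℕ)

namespace State

/-- The initial state on the memory content `M`. -/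
def init (M : ℕ → ℕ) : State := ⟨fun _ => 0, M, 0, [], []⟩

/-- Count one step. -/
def tick (σ : State) : State := { σ with clock := σ.clock + 1 }

/-- Assign the value `v` to the register `x`. -/
def assign (σ : State) (x v : ℕ) : State := { σ with reg := Function.update σ.reg x v }

end State

/-- The effect of an instruction. -/
def Instr.run : Instr → State → State
  | set x c, σ => σ.assign x c
  | addConst x y c, σ => σ.assign x (σ.reg y + c)
  | subConst x y c, σ => σ.assign x (σ.reg y - c)
  | load x a i, σ => σ.assign x (σ.mem (σ.reg a + σ.reg i))
  | store a i x, σ => { σ with mem := Function.update σ.mem (σ.reg a + σ.reg i) (σ.reg x) }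
  | write x, σ => { σ with buf := σ.buf ++ [σ.reg x] }
  | emit, σ => { σ with buf := [], log := σ.log ++ [(σ.buf, σ.clock)] }
  | nop, σ => σ

/-- The outcome of a test. -/
def Test.Holds : Test → State → Prop
  | eq x y, σ => σ.reg x = σ.reg y
  | lt x y, σ => σ.reg x < σ.reg y

/-- `Exec p σ σ'`: the program `p`, started in the state `σ`, halts in the state `σ'`. Every
instruction and every evaluation of a test takes one step. -/
inductive Exec : Prog → State → State → Prop
  | instr (i : Instr) (σ : State) : Exec (.instr i) σ (i.run σ.tick)
  | seq {p q : Prog} {σ σ₁ σ₂ : State} :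
      Exec p σ σ₁ → Exec q σ₁ σ₂ → Exec (.seq p q) σ σ₂
  | ite_true {b : Test} {p q : Prog} {σ σ' : State} :
      b.Holds σ → Exec p σ.tick σ' → Exec (.ite b p q) σ σ'
  | ite_false {b : Test} {p q : Prog} {σ σ' : State} :
      ¬ b.Holds σ → Exec q σ.tick σ' → Exec (.ite b p q) σ σ'
  | loop_true {b : Test} {p : Prog} {σ σ₁ σ₂ : State} :
      b.Holds σ → Exec p σ.tick σ₁ → Exec (.loop b p) σ₁ σ₂ → Exec (.loop b p) σ σ₂
  | loop_false {b : Test} {p : Prog} {σ : State} :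
      ¬ b.Holds σ → Exec (.loop b p) σ σ.tick

/-- The machine is deterministic. -/
theorem Exec.unique {p : Prog} {σ σ₁ σ₂ : State} (h₁ : Exec p σ σ₁) (h₂ : Exec p σ σ₂) :
    σ₁ = σ₂ := by
  induction h₁ generalizing σ₂ with
  | instr i σ => cases h₂; rfl
  | seq _ _ ih₁ ih₂ =>
    cases h₂ with
    | seq h h' => exact ih₂ (ih₁ h ▸ h')
  | ite_true hb _ ih =>
    cases h₂ with
    | ite_true _ h => exact ih h
    | ite_false hn _ => exact absurd hb hn
  | ite_false hb _ ih =>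
    cases h₂ with
    | ite_true hn _ => exact absurd hn hb
    | ite_false _ h => exact ih h
  | loop_true hb _ _ ih₁ ih₂ =>
    cases h₂ with
    | loop_true _ h h' => exact ih₂ (ih₁ h ▸ h')
    | loop_false hn => exact absurd hb hn
  | loop_false hb =>
    cases h₂ with
    | loop_true hn _ _ => exact absurd hn hb
    | loop_false _ => rfl

end RAM

/-! ### The representation of the input in memory -/

/-- The memory `M` holds the list `l` at the address `a`, as its length followed by its entries,
in the part of the memory below the address `free`. -/
def StoresList {N : ℕ} (M : ℕ → ℕ) (free a : ℕ) (l : List (Fin N)) : Prop :=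
  a + l.length < free ∧ M a = l.length ∧
    ∀ (i : ℕ) (h : i < l.length), M (a + 1 + i) = (l[i] : ℕ)

/-- The list `l` enumerates the set `S` without repetition. -/
def ListsSet {N : ℕ} (l : List (Fin N)) (S : Set (Fin N)) : Prop :=
  l.Nodup ∧ ∀ x, x ∈ l ↔ x ∈ S

/-- The memory `M` holds the database `D`, the automaton `A` and the vertices `s` and `t`.
Labels, vertices, edges and states are numbered from `0`. The cells `0, …, 6` contain the numbers
of labels, vertices, edges and states, the numbers of `s` and `t`, and the address `free` of the
first unused cell; the cells `7, …, 15` contain the addresses of arrays and lists. Lists may be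
in any order and anywhere in the used part of the memory. -/
structure Represents {k n m q : ℕ} (M : ℕ → ℕ) (D : Database (Fin k) (Fin n) (Fin m))
    (A : NFA (Fin k) (Fin q)) (s t : Fin n) : Prop where
  labels : M 0 = k
  vertices : M 1 = n
  edges : M 2 = m
  states : M 3 = q
  source : M 4 = s
  target : M 5 = t
  header : 16 ≤ M 6
  unused : ∀ a, M 6 ≤ a → M a = 0
  /-- For every vertex `v`, the address of the list of the incoming edges of `v`, and for every
  edge in this list, its position. -/
  incoming : ∀ v : Fin n, M 7 + v < M 6 ∧ ∃ l : List (Fin m),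
    ListsSet l {e | D.tgt e = v} ∧ StoresList M (M 6) (M (M 7 + v)) l ∧
      ∀ (i : ℕ) (h : i < l.length), M 12 + l[i] < M 6 ∧ M (M 12 + l[i]) = i
  /-- For every vertex `v`, the address of the list of the outgoing edges of `v`. -/
  outgoing : ∀ v : Fin n, M 8 + v < M 6 ∧ ∃ l : List (Fin m),
    ListsSet l {e | D.src e = v} ∧ StoresList M (M 6) (M (M 8 + v)) l
  edge_src : ∀ e : Fin m, M 9 + e < M 6 ∧ M (M 9 + e) = D.src e
  edge_tgt : ∀ e : Fin m, M 10 + e < M 6 ∧ M (M 10 + e) = D.tgt e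
  /-- For every edge `e`, the address of the list of the labels of `e`. -/
  edge_lbl : ∀ e : Fin m, M 11 + e < M 6 ∧ ∃ l : List (Fin k),
    ListsSet l {a | a ∈ D.lbl e} ∧ StoresList M (M 6) (M (M 11 + e)) l
  /-- For every state `p`, the address of an array that contains, for every label `a`, the address
  of the list of the states in `Δ(p, a)`. -/
  step : ∀ p : Fin q, M 13 + p < M 6 ∧ ∀ a : Fin k, M (M 13 + p) + a < M 6 ∧
    ∃ l : List (Fin q), ListsSet l (A.step p a) ∧ StoresList M (M 6) (M (M (M 13 + p) + a)) l
  start : ∃ l : List (Fin q), ListsSet l A.start ∧ StoresList M (M 6) (M 14) l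
  accept : ∃ l : List (Fin q), ListsSet l A.accept ∧ StoresList M (M 6) (M 15) l

/-!
The program works on the product of the database and the automaton, whose nodes are the pairs of a
vertex and a state. A walk that matches the automaton may carry several runs, so an enumeration of
paths of the product would repeat walks. The search therefore branches on edges of the database.

*Preprocessing.* A breadth-first search from the initial nodes computes the level (the distance) of
every reachable node (`BfsInv`, `Layout.runs_bfs`). Afterwards, for every edge of the database in
increasing order and every transition along this edge that increases the level by one, the pair of
the edge and the source state is put in front of the list of the last steps of the target node
(`Layout.cells`, `Layout.runs_linkAll`). All lists are thus sorted by decreasing edges without any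
sorting. A walk is a shortest matching walk if and only if it is spelled by last steps from an
initial node to an accepting node at `t` of minimal level (`Layout.CellPath`,
`Layout.shortest_iff`).

*Enumeration.* A depth-first search constructs the walks backwards from `t`. A node of the search
tree is given by the end of a walk, and its frame on the stack holds the lists of the last steps of
all product nodes from which this end leads to an accepting node at `t` (`Layout.IsNode`). A step
of the search takes the maximal edge `e` at the heads of these lists. Because the lists are sorted,
all steps along `e` are at their heads; they are removed, and the nodes that they come from form
the frame of the child for `e`, without repetition thanks to time stamps (`Layout.runs_push`). So
every edge is chosen at most once at a frame, every walk is delivered once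
(`Layout.pathSet_split`, `Layout.Delivers.append`), and there are no dead ends, since a node of
positive level has a last step (`Layout.cells_ne_nil`).

*Time.* A step of the search at a frame costs `O(|A|)`, because, for a single edge, the lists of the
frame contain at most one entry for every transition (`Layout.IsNode.push_time`). Between two
answers the search pops and pushes `O(λ)` frames, which gives the delay `O(λ|A|)` (`Timed`). Before
the first answer, the frames that are pushed have distinct levels, so that the lists in them belong
to distinct nodes and have total length `O(|D||A|)` (`Layout.weight_add_potential_le`). For every
piece of the program, a lemma states its effect on the memory together with a bound on its time;
the loops over lists perform left folds on a ghost state (`RAM.runs_forList`). The induction for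
the search is `Layout.AtNode.explores`.
-/

set_option linter.unusedSimpArgs false

/-! ### Reasoning about programs -/

namespace RAM

/-- Sequencing of programs. -/
local infixr:60 " ;; " => Prog.seq

/-- The program `p`, started in the state `σ`, halts in a state that satisfies `Q`. -/
def Runs (p : Prog) (σ : State) (Q : State → Prop) : Prop := ∃ σ', Exec p σ σ' ∧ Q σ'

theorem Runs.mono {p : Prog} {σ : State} {Q R : State → Prop} (h : Runs p σ Q)
    (hQR : ∀ τ, Q τ → R τ) : Runs p σ R :=
  let ⟨σ', h₁, h₂⟩ := h
  ⟨σ', h₁, hQR _ h₂⟩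

theorem runs_instr {i : Instr} {σ : State} {Q : State → Prop} :
    Runs (.instr i) σ Q ↔ Q (i.run σ.tick) :=
  ⟨fun ⟨_, h, hQ⟩ => by cases h; exact hQ, fun h => ⟨_, .instr i σ, h⟩⟩

theorem runs_seq {p q : Prog} {σ : State} {Q : State → Prop} :
    Runs (p ;; q) σ Q ↔ Runs p σ fun τ => Runs q τ Q :=
  ⟨fun ⟨_, h, hQ⟩ => by cases h with | seq h₁ h₂ => exact ⟨_, h₁, _, h₂, hQ⟩,
    fun ⟨_, h₁, _, h₂, hQ⟩ => ⟨_, .seq h₁ h₂, hQ⟩⟩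

theorem runs_ite {b : Test} {p q : Prog} {σ : State} {Q : State → Prop} :
    Runs (.ite b p q) σ Q ↔
      (b.Holds σ → Runs p σ.tick Q) ∧ (¬ b.Holds σ → Runs q σ.tick Q) := by
  constructor
  · rintro ⟨σ', h, hQ⟩
    cases h with
    | ite_true hb h => exact ⟨fun _ => ⟨_, h, hQ⟩, fun hn => absurd hb hn⟩
    | ite_false hb h => exact ⟨fun hn => absurd hn hb, fun _ => ⟨_, h, hQ⟩⟩
  · rintro ⟨h₁, h₂⟩
    by_cases hb : b.Holds σ
    · obtain ⟨σ', h, hQ⟩ := h₁ hb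
      exact ⟨σ', .ite_true hb h, hQ⟩
    · obtain ⟨σ', h, hQ⟩ := h₂ hb
      exact ⟨σ', .ite_false hb h, hQ⟩

theorem runs_loop_false {b : Test} {p : Prog} {σ : State} {Q : State → Prop}
    (hb : ¬ b.Holds σ) (hQ : Q σ.tick) : Runs (.loop b p) σ Q :=
  ⟨_, .loop_false hb, hQ⟩

theorem runs_loop_true {b : Test} {p : Prog} {σ : State} {Q : State → Prop}
    (hb : b.Holds σ) (h : Runs p σ.tick fun τ => Runs (.loop b p) τ Q) : Runs (.loop b p) σ Q :=
  let ⟨_, h₁, _, h₂, hQ⟩ := h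
  ⟨_, .loop_true hb h₁ h₂, hQ⟩

/-- `σ'` differs from `σ` only in the memory, the clock, the accumulator (register `20`), and the
registers from `r` on. -/
structure Below (r : ℕ) (σ σ' : State) : Prop where
  reg : ∀ x < r, x ≠ 20 → σ'.reg x = σ.reg x
  buf : σ'.buf = σ.buf
  log : σ'.log = σ.log

theorem Below.trans {r r' r'' : ℕ} {σ σ' σ'' : State} (h : Below r' σ σ') (h' : Below r'' σ' σ'')
    (hr : r ≤ r') (hr' : r ≤ r'') : Below r σ σ'' :=
  ⟨fun x hx h20 => (h'.reg x (by omega) h20).trans (h.reg x (by omega) h20), h'.buf.trans h.buf,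
    h'.log.trans h.log⟩

theorem below_update {r y v c : ℕ} {σ : State} {reg mem : ℕ → ℕ} {bu : List ℕ}
    {lo : List (List ℕ × ℕ)} (h : r ≤ y ∨ y = 20) :
    Below r σ ⟨Function.update reg y v, mem, c, bu, lo⟩ ↔ Below r σ ⟨reg, mem, c, bu, lo⟩ := by
  constructor
  · rintro ⟨h₁, h₂, h₃⟩
    refine ⟨fun x hx h20 => ?_, h₂, h₃⟩
    rw [← h₁ x hx h20]
    exact (Function.update_of_ne (by omega) _ _).symm
  · rintro ⟨h₁, h₂, h₃⟩
    refine ⟨fun x hx h20 => ?_, h₂, h₃⟩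
    rw [← h₁ x hx h20]
    exact Function.update_of_ne (by omega) _ _

theorem below_self {r c : ℕ} {σ : State} {mem : ℕ → ℕ} :
    Below r σ ⟨σ.reg, mem, c, σ.buf, σ.log⟩ := ⟨fun _ _ _ => rfl, rfl, rfl⟩

/-- `for i = 0, …, reg[N] - 1 do body`. -/
def forRange (i N : ℕ) (body : Prog) : Prog :=
  .instr (.set i 0) ;; .loop (.lt i N) (body ;; .instr (.addConst i i 1))

/-- Run `body` for every entry of the list at the address `reg[r]`. The registers `r + 1`, `r + 2`
and `r + 3` hold the position in the list, its length, and the current entry. -/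
def forList (r : ℕ) (body : Prog) : Prog :=
  .instr (.load (r + 2) r 0) ;; .instr (.set (r + 1) 0) ;;
    .loop (.lt (r + 1) (r + 2))
      (.instr (.addConst (r + 1) (r + 1) 1) ;; .instr (.load (r + 3) r (r + 1)) ;; body)

variable {γ : Type*}

/-- A loop over a list in the memory performs a left fold on the ghost state `g`, which `Inv` links
to the memory and the accumulator. -/
theorem runs_forList {r N free : ℕ} {M : ℕ → ℕ} {body : Prog} (Inv : γ → (ℕ → ℕ) → ℕ → Prop)
    (G : γ → Fin N → γ) (cost : Fin N → ℕ) (l : List (Fin N)) (g : γ) (σ : State) (hr : 20 < r)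
    (hlow : ∀ g mem b, Inv g mem b → ∀ a < free, mem a = M a)
    (h0 : σ.reg 0 = 0) (hl : StoresList M free (σ.reg r) l) (hinv : Inv g σ.mem (σ.reg 20))
    (hbody : ∀ x ∈ l, ∀ g τ, Inv g τ.mem (τ.reg 20) → Below (r + 1) σ τ → τ.reg (r + 3) = x →
      Runs body τ fun τ' => Inv (G g x) τ'.mem (τ'.reg 20) ∧ Below (r + 4) τ τ' ∧
        τ'.clock ≤ τ.clock + cost x) :
    Runs (forList r body) σ fun τ => Inv (l.foldl G g) τ.mem (τ.reg 20) ∧ Below (r + 1) σ τ ∧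
      τ.clock ≤ σ.clock + (l.map fun x => cost x + 3).sum + 3 := by
  obtain ⟨hfree, hlen, hget⟩ := hl
  have key : ∀ (d i : ℕ) (g : γ) (τ : State), i + d = l.length → Inv g τ.mem (τ.reg 20) →
      Below (r + 1) σ τ → τ.reg (r + 1) = i → τ.reg (r + 2) = l.length →
      Runs (.loop (.lt (r + 1) (r + 2)) (.instr (.addConst (r + 1) (r + 1) 1) ;;
        .instr (.load (r + 3) r (r + 1)) ;; body)) τ fun τ' =>
        Inv ((l.drop i).foldl G g) τ'.mem (τ'.reg 20) ∧ Below (r + 1) σ τ' ∧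
          τ'.clock ≤ τ.clock + ((l.drop i).map fun x => cost x + 3).sum + 1 := by
    intro d
    induction d with
    | zero =>
      intro i g τ hi hI hB h1 h2
      rw [List.drop_eq_nil_of_le (by omega)]
      refine runs_loop_false (by simp [Test.Holds, h1, h2]; omega) ⟨hI, ?_, by simp [State.tick]⟩
      exact ⟨hB.reg, hB.buf, hB.log⟩
    | succ d ih =>
      intro i g τ hi hI hB h1 h2
      have hil : i < l.length := by omega
      rw [List.drop_eq_getElem_cons hil]
      refine runs_loop_true (by simp [Test.Holds, h1, h2]; omega) ?_
      rw [runs_seq, runs_instr, runs_seq, runs_instr]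
      have hrr : τ.reg r = σ.reg r := hB.reg r (by omega) (by omega)
      refine (hbody l[i] (List.getElem_mem hil) g _ ?_ ?_ ?_).mono ?_
      · simpa [Instr.run, State.tick, State.assign, Function.update_apply,
          show ¬ (20 = r + 3) by omega, show ¬ (20 = r + 1) by omega] using hI
      · refine ⟨fun x hx h20 => ?_, hB.buf, hB.log⟩
        simp [Instr.run, State.tick, State.assign, Function.update_apply,
          show ¬ (x = r + 3) by omega, show ¬ (x = r + 1) by omega, hB.reg x hx h20]
      · simp only [Instr.run, State.tick, State.assign, Function.update_self, h1]
        rw [Function.update_of_ne (by omega), hrr, hlow _ _ _ hI _ (by omega), ← hget i hil]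
        congr 1; omega
      · rintro τ' ⟨hI', hB', hc'⟩
        have e1 : τ'.reg (r + 1) = i + 1 := by
          rw [hB'.reg _ (by omega) (by omega)]
          simp [Instr.run, State.tick, State.assign, Function.update_apply, h1]
        have e2 : τ'.reg (r + 2) = l.length := by
          rw [hB'.reg _ (by omega) (by omega)]
          simp [Instr.run, State.tick, State.assign, Function.update_apply, h2]
        refine (ih (i + 1) _ τ' (by omega) hI' ?_ e1 e2).mono ?_
        · refine ⟨fun x hx h20 => ?_, hB'.buf.trans hB.buf, hB'.log.trans hB.log⟩
          rw [hB'.reg _ (by omega) h20]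
          simp [Instr.run, State.tick, State.assign, Function.update_apply,
            show ¬ (x = r + 3) by omega, show ¬ (x = r + 1) by omega, hB.reg x hx h20]
        · rintro τ'' ⟨hI'', hB'', hc''⟩
          refine ⟨hI'', hB'', ?_⟩
          simp only [Instr.run, State.tick, State.assign] at hc'
          simp only [List.map_cons, List.sum_cons]
          omega
  unfold forList
  rw [runs_seq, runs_instr, runs_seq, runs_instr]
  refine (key l.length 0 g _ (by omega) ?_ ?_ ?_ ?_).mono ?_
  · simpa [Instr.run, State.tick, State.assign, Function.update_apply,
          show ¬ (20 = r + 2) by omega, show ¬ (20 = r + 1) by omega] using hinv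
  · refine ⟨fun x hx h20 => ?_, rfl, rfl⟩
    simp [Instr.run, State.tick, State.assign, Function.update_apply,
          show ¬ (x = r + 2) by omega, show ¬ (x = r + 1) by omega]
  · simp [Instr.run, State.tick, State.assign, Function.update_apply]
  · simp [Instr.run, State.tick, State.assign, Function.update_apply, h0,
      hlow _ _ _ hinv _ (show σ.reg r < free by omega), hlen]
  · rintro τ ⟨hI, hB, hc⟩
    simp only [Instr.run, State.tick, State.assign, List.drop_zero] at hI hc
    refine ⟨hI, ?_, by omega⟩
    exact ⟨hB.reg, hB.buf, hB.log⟩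

/-- A loop over a range of numbers performs a left fold on the ghost state. -/
theorem runs_forRange {i N n : ℕ} {body : Prog} (Inv : γ → (ℕ → ℕ) → ℕ → Prop)
    (G : γ → Fin n → γ) (cost : Fin n → ℕ) (g : γ) (σ : State) (hi : 20 < i) (hN : N < 20)
    (hn : σ.reg N = n) (hinv : Inv g σ.mem (σ.reg 20))
    (hbody : ∀ (x : Fin n) (g' : γ) (τ : State), g' = ((List.finRange n).take x).foldl G g →
      Inv g' τ.mem (τ.reg 20) → Below i σ τ → τ.reg i = x →
      Runs body τ fun τ' => Inv (G g' x) τ'.mem (τ'.reg 20) ∧ Below (i + 1) τ τ' ∧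
        τ'.clock ≤ τ.clock + cost x) :
    Runs (forRange i N body) σ fun τ => Inv ((List.finRange n).foldl G g) τ.mem (τ.reg 20) ∧
      Below i σ τ ∧ τ.clock ≤ σ.clock + ((List.finRange n).map fun x => cost x + 2).sum + 2 := by
  have key : ∀ (d j : ℕ) (g' : γ) (τ : State), j + d = n →
      g' = ((List.finRange n).take j).foldl G g → Inv g' τ.mem (τ.reg 20) →
      Below i σ τ → τ.reg i = j →
      Runs (.loop (.lt i N) (body ;; .instr (.addConst i i 1))) τ fun τ' =>
        Inv (((List.finRange n).drop j).foldl G g') τ'.mem (τ'.reg 20) ∧ Below i σ τ' ∧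
          τ'.clock ≤ τ.clock + (((List.finRange n).drop j).map fun x => cost x + 2).sum + 1 := by
    intro d
    induction d with
    | zero =>
      intro j g' τ hj hgj hI hB h1
      rw [List.drop_eq_nil_of_le (by simp; omega)]
      have hNN : τ.reg N = n := by rw [hB.reg N (by omega) (by omega), hn]
      refine runs_loop_false (by simp [Test.Holds, h1, hNN]; omega) ⟨hI, ?_, by simp [State.tick]⟩
      exact ⟨hB.reg, hB.buf, hB.log⟩
    | succ d ih =>
      intro j g' τ hj hgj hI hB h1
      have hjl : j < (List.finRange n).length := by simp; omega
      rw [List.drop_eq_getElem_cons hjl]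
      have hNN : τ.reg N = n := by rw [hB.reg N (by omega) (by omega), hn]
      refine runs_loop_true (by simp [Test.Holds, h1, hNN]; omega) ?_
      rw [runs_seq]
      refine (hbody (List.finRange n)[j] g' τ.tick (by simpa using hgj) hI ⟨hB.reg, hB.buf, hB.log⟩
        (by simpa [State.tick] using h1)).mono ?_
      rintro τ' ⟨hI', hB', hc'⟩
      rw [runs_instr]
      have e1 : τ'.reg i = j := by
        rw [hB'.reg _ (by omega) (by omega)]
        simpa [State.tick] using h1
      refine (ih (j + 1) (G g' (List.finRange n)[j]) _ (by omega)
        (by rw [List.take_succ_eq_append_getElem hjl, List.foldl_append, ← hgj]; rfl)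
        ?_ ?_ ?_).mono ?_
      · simpa [Instr.run, State.tick, State.assign, Function.update_apply,
          show ¬ (20 = i) by omega] using hI'
      · refine ⟨fun x hx h20 => ?_, hB'.buf.trans hB.buf, hB'.log.trans hB.log⟩
        simp only [Instr.run, State.tick, State.assign]
        rw [Function.update_of_ne (by omega), hB'.reg x (by omega) h20]
        exact hB.reg x hx h20
      · simp [Instr.run, State.tick, State.assign, e1]
      · rintro τ'' ⟨hI'', hB'', hc''⟩
        refine ⟨hI'', hB'', ?_⟩
        simp only [Instr.run, State.tick, State.assign] at hc' hc''
        simp only [List.map_cons, List.sum_cons]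
        omega
  unfold forRange
  rw [runs_seq, runs_instr]
  refine (key n 0 g _ (by omega) rfl ?_ ?_ ?_).mono ?_
  · simpa [Instr.run, State.tick, State.assign, Function.update_apply,
          show ¬ (20 = i) by omega] using hinv
  · refine ⟨fun x hx h20 => ?_, rfl, rfl⟩
    simp [Instr.run, State.tick, State.assign, Function.update_apply, show ¬ (x = i) by omega]
  · simp [Instr.run, State.tick, State.assign]
  · rintro τ ⟨hI, hB, hc⟩
    simp only [Instr.run, State.tick, State.assign, List.drop_zero] at hI hc
    refine ⟨hI, ?_, by omega⟩
    exact ⟨hB.reg, hB.buf, hB.log⟩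

end RAM

/-! ### Breadth-first search -/

section BFS

variable {X : Type*} (start : List X) (succ : X → List X)

/-- `y` can be reached from `start` by a path of length `d`. -/
inductive Reach : ℕ → X → Prop
  | zero {y : X} : y ∈ start → Reach 0 y
  | step {d : ℕ} {x y : X} : Reach d x → y ∈ succ x → Reach (d + 1) y

/-- The length of a shortest path from `start` to `y`; it is `0` if there is none. -/
noncomputable def level (y : X) : ℕ := sInf {d | Reach start succ d y}

variable {start succ}

theorem Reach.level_le {d : ℕ} {y : X} (h : Reach start succ d y) : level start succ y ≤ d :=
  Nat.sInf_le h

theorem Reach.reach_level {d : ℕ} {y : X} (h : Reach start succ d y) :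
    Reach start succ (level start succ y) y := Nat.sInf_mem (s := {d | Reach start succ d y}) ⟨d, h⟩

theorem Reach.level_succ_le {d : ℕ} {x y : X} (h : Reach start succ d x) (hy : y ∈ succ x) :
    level start succ y ≤ level start succ x + 1 := (h.reach_level.step hy).level_le

theorem Reach.exists_pred {d : ℕ} {y : X} (h : Reach start succ d y)
    (hpos : 0 < level start succ y) : ∃ x d', Reach start succ d' x ∧ y ∈ succ x ∧
      level start succ y = level start succ x + 1 := by
  have h' := h.reach_level
  generalize hl : level start succ y = l at h' hpos
  cases h' with
  | zero => omega
  | step hx hy =>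
    refine ⟨_, _, hx, hy, ?_⟩
    have := hx.level_succ_le hy
    have := hx.level_le
    omega

theorem Reach.start_of_level_eq_zero {d : ℕ} {y : X} (h : Reach start succ d y)
    (h0 : level start succ y = 0) : y ∈ start := by
  have h' := h.reach_level
  rw [h0] at h'
  cases h' with
  | zero h => exact h

/-- Append `y` with the level `d` to the queue, unless `y` has been discovered before. -/
def visit [DecidableEq X] (d : ℕ) (ns : List (X × ℕ)) (y : X) : List (X × ℕ) :=
  if y ∈ ns.map Prod.fst then ns else ns ++ [(y, d)]

theorem foldl_visit_spec [DecidableEq X] (d : ℕ) (ys : List X) (ns : List (X × ℕ))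
    (hnd : (ns.map Prod.fst).Nodup) (hs : ns.Pairwise (·.2 ≤ ·.2)) (hd : ∀ z ∈ ns, z.2 ≤ d) :
    ns <+: ys.foldl (visit d) ns ∧ ((ys.foldl (visit d) ns).map Prod.fst).Nodup ∧
      (ys.foldl (visit d) ns).Pairwise (·.2 ≤ ·.2) ∧
      (∀ z ∈ ys.foldl (visit d) ns, z ∈ ns ∨ z.1 ∈ ys ∧ z.2 = d) ∧
      ∀ y ∈ ys, ∃ e ≤ d, (y, e) ∈ ys.foldl (visit d) ns := by
  induction ys generalizing ns with
  | nil => simp [hnd, hs]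
  | cons y ys ih =>
    rw [List.foldl_cons]
    by_cases hy : y ∈ ns.map Prod.fst
    · have hv : visit d ns y = ns := if_pos hy
      rw [hv]
      obtain ⟨h1, h2, h3, h4, h5⟩ := ih ns hnd hs hd
      refine ⟨h1, h2, h3, fun z hz => ?_, ?_⟩
      · rcases h4 z hz with h | ⟨h, h'⟩
        · exact .inl h
        · exact .inr ⟨List.mem_cons_of_mem _ h, h'⟩
      · intro w hw
        rcases List.mem_cons.1 hw with rfl | hw
        · obtain ⟨⟨a, e⟩, ha, rfl⟩ := List.mem_map.1 hy
          exact ⟨e, hd _ ha, h1.subset ha⟩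
        · exact h5 w hw
    · have hv : visit d ns y = ns ++ [(y, d)] := if_neg hy
      rw [hv]
      obtain ⟨h1, h2, h3, h4, h5⟩ := ih (ns ++ [(y, d)])
        (by
          rw [List.map_append, List.nodup_append]
          refine ⟨hnd, by simp, ?_⟩
          intro a ha b hb hab
          simp only [List.map_cons, List.map_nil, List.mem_singleton] at hb
          exact hy (hb ▸ hab ▸ ha))
        (by
          rw [List.pairwise_append]
          refine ⟨hs, by simp, ?_⟩
          intro a ha b hb
          simp only [List.mem_singleton] at hb
          rw [hb]; exact hd a ha)
        (by
          intro z hz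
          rcases List.mem_append.1 hz with hz | hz
          · exact hd z hz
          · simp only [List.mem_singleton] at hz
            rw [hz])
      refine ⟨(List.prefix_append _ _).trans h1, h2, h3, fun z hz => ?_, ?_⟩
      · rcases h4 z hz with h | ⟨h, h'⟩
        · rcases List.mem_append.1 h with h | h
          · exact .inl h
          · simp only [List.mem_singleton] at h
            exact .inr (by simp [h])
        · exact .inr ⟨List.mem_cons_of_mem _ h, h'⟩
      · intro w hw
        rcases List.mem_cons.1 hw with rfl | hw
        · exact ⟨d, le_rfl, h1.subset (by simp)⟩
        · exact h5 w hw

variable (start succ)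

/-- The invariant of breadth-first search: the queue `ns` contains the discovered nodes with their
levels, and the first `i` of them have been processed. -/
structure BfsInv (i : ℕ) (ns : List (X × ℕ)) : Prop where
  nodup : (ns.map Prod.fst).Nodup
  sorted : ns.Pairwise (·.2 ≤ ·.2)
  sound : ∀ z ∈ ns, Reach start succ z.2 z.1
  start_mem : ∀ y ∈ start, (y, 0) ∈ ns
  closed : ∀ j (hj : j < ns.length), j < i → ∀ y ∈ succ ns[j].1, ∃ d ≤ ns[j].2 + 1, (y, d) ∈ ns
  le : ∀ (h : i < ns.length), ∀ z ∈ ns, z.2 ≤ ns[i].2 + 1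

theorem bfsInv_start [DecidableEq X] : BfsInv start succ 0 (start.foldl (visit 0) []) := by
  obtain ⟨-, h2, h3, h4, h5⟩ := foldl_visit_spec 0 start [] (by simp) (by simp) (by simp)
  have h4' : ∀ z ∈ start.foldl (visit 0) [], z.1 ∈ start ∧ z.2 = 0 := fun z hz => by
    simpa using h4 z hz
  refine ⟨h2, h3, fun z hz => ?_, fun y hy => ?_, by simp, fun h z hz => by
    rw [(h4' z hz).2]; exact Nat.zero_le _⟩
  · rw [(h4' z hz).2]
    exact .zero (h4' z hz).1
  · obtain ⟨e, he, h⟩ := h5 y hy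
    rwa [Nat.le_zero.1 he] at h

variable {start succ}

theorem BfsInv.process [DecidableEq X] {i : ℕ} {ns : List (X × ℕ)} (h : BfsInv start succ i ns)
    (hi : i < ns.length) :
    BfsInv start succ (i + 1) ((succ ns[i].1).foldl (visit (ns[i].2 + 1)) ns) ∧
      ns <+: (succ ns[i].1).foldl (visit (ns[i].2 + 1)) ns := by
  obtain ⟨h1, h2, h3, h4, h5⟩ := foldl_visit_spec (ns[i].2 + 1) (succ ns[i].1) ns h.nodup h.sorted
    (h.le hi)
  generalize hns' : (succ ns[i].1).foldl (visit (ns[i].2 + 1)) ns = ns' at *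
  have hlen := h1.length_le
  have hget : ∀ j (hj : j < ns.length), ns'[j] = ns[j] := fun j hj => (h1.getElem hj).symm
  refine ⟨⟨h2, h3, fun z hz => ?_, fun y hy => h1.subset (h.start_mem y hy), ?_, ?_⟩, h1⟩
  · rcases h4 z hz with hz | ⟨hz, hz'⟩
    · exact h.sound z hz
    · rw [hz']
      exact (h.sound _ (List.getElem_mem hi)).step hz
  · intro j hj hji y hy
    rcases Nat.lt_succ_iff_lt_or_eq.1 hji with hji | rfl
    · rw [hget j (by omega)] at hy ⊢
      obtain ⟨d, hd, hm⟩ := h.closed j (by omega) hji y hy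
      exact ⟨d, hd, h1.subset hm⟩
    · rw [hget j hi] at hy ⊢
      exact h5 y hy
  · intro hi' z hz
    have hle : ns[i].2 ≤ ns'[i + 1].2 := by
      rw [← hget i hi]
      exact (List.pairwise_iff_getElem.1 h3) i (i + 1) (by omega) hi' (by omega)
    rcases h4 z hz with hz | ⟨-, hz'⟩
    · have := h.le hi z hz
      omega
    · omega

theorem BfsInv.final {ns : List (X × ℕ)} (h : BfsInv start succ ns.length ns) {y : X} {d : ℕ}
    (hr : Reach start succ d y) : (y, level start succ y) ∈ ns := by
  have key : ∀ {d y}, Reach start succ d y → ∃ e ≤ d, (y, e) ∈ ns := by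
    intro d y hr
    induction hr with
    | zero hy => exact ⟨0, le_rfl, h.start_mem _ hy⟩
    | step _ hy ih =>
      obtain ⟨e, he, hm⟩ := ih
      obtain ⟨j, hj, hje⟩ := List.getElem_of_mem hm
      obtain ⟨e', he', hm'⟩ := h.closed j hj hj _ (by rw [hje]; exact hy)
      rw [hje] at he'
      exact ⟨e', by omega, hm'⟩
  obtain ⟨e, he, hm⟩ := key hr.reach_level
  have := (h.sound _ hm).level_le
  rwa [show level start succ y = e by simp only at this; omega]

theorem BfsInv.level_eq {ns : List (X × ℕ)} (h : BfsInv start succ ns.length ns) {z : X × ℕ}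
    (hz : z ∈ ns) : z.2 = level start succ z.1 := by
  have h' := h.final (h.sound z hz)
  obtain ⟨a, d⟩ := z
  exact congrArg Prod.snd (List.inj_on_of_nodup_map h.nodup hz h' rfl)

theorem BfsInv.mem_iff {ns : List (X × ℕ)} (h : BfsInv start succ ns.length ns) {y : X} :
    y ∈ ns.map Prod.fst ↔ ∃ d, Reach start succ d y := by
  constructor
  · rw [List.mem_map]
    rintro ⟨z, hz, rfl⟩
    exact ⟨_, h.sound z hz⟩
  · rintro ⟨d, hd⟩
    exact List.mem_map.2 ⟨_, h.final hd, rfl⟩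

end BFS

/-! ### Runs of the automaton along a walk -/

/-- There is a run of `A` that starts in an initial state at the vertex `s`, reads the edges `es`,
and ends at the vertex `x.1` in the state `x.2`. -/
inductive RunTo {α V E Q : Type*} (D : Database α V E) (A : NFA α Q) (s : V) :
    List E → V × Q → Prop
  | nil {p : Q} : p ∈ A.start → RunTo D A s [] (s, p)
  | snoc {es : List E} {e : E} {p p' : Q} {a : α} : RunTo D A s es (D.src e, p) → a ∈ D.lbl e →
      p' ∈ A.step p a → RunTo D A s (es ++ [e]) (D.tgt e, p')

namespace Database

variable {α V E Q : Type*} (D : Database α V E)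

theorem follows_append_singleton {v : V} {es : List E} {e : E} :
    D.Follows v (es ++ [e]) ↔ D.Follows v es ∧ D.src e = es.foldl (fun _ e => D.tgt e) v := by
  induction es generalizing v with
  | nil => simp [Follows, eq_comm]
  | cons e' es ih => simp [Follows, ih, and_assoc]

theorem runTo_iff {A : NFA α Q} {s v : V} {es : List E} {p : Q} : RunTo D A s es (v, p) ↔
    D.Follows s es ∧ es.foldl (fun _ e => D.tgt e) s = v ∧
      ∃ x, List.Forall₂ (fun a e => a ∈ D.lbl e) x es ∧ p ∈ A.eval x := by
  induction es using List.reverseRecOn generalizing v p with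
  | nil =>
    constructor
    · intro h
      generalize hes : ([] : List E) = es at h
      generalize hx : (v, p) = x at h
      cases h with
      | nil hp => cases hx; exact ⟨trivial, rfl, [], .nil, hp⟩
      | snoc => simp at hes
    · rintro ⟨-, rfl, x, hx, hp⟩
      cases hx
      exact .nil hp
  | append_singleton es e ih =>
    rw [follows_append_singleton]
    constructor
    · intro h
      generalize hes : es ++ [e] = es' at h
      generalize hx : (v, p) = x at h
      cases h with
      | nil => simp at hes
      | snoc h ha hp =>
        obtain ⟨rfl, he⟩ := List.append_inj' hes rfl
        cases he
        cases hx
        obtain ⟨h1, h2, x, hx, hq⟩ := ih.1 h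
        refine ⟨⟨h1, h2.symm⟩, by simp, x ++ [_], List.rel_append hx (.cons ha .nil), ?_⟩
        rw [NFA.eval_append_singleton, NFA.mem_stepSet]
        exact ⟨_, hq, hp⟩
    · rintro ⟨⟨h1, h2⟩, h3, x, hx, hp⟩
      rw [List.foldl_append] at h3
      simp only [List.foldl_cons, List.foldl_nil] at h3
      subst h3
      rw [List.forall₂_iff_get] at hx
      obtain ⟨hlen, hx⟩ := hx
      rcases List.eq_nil_or_concat x with rfl | ⟨x, a, rfl⟩
      · simp at hlen
      · have hl : x.length = es.length := by simpa using hlen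
        rw [List.concat_eq_append, NFA.eval_append_singleton, NFA.mem_stepSet] at hp
        obtain ⟨p', hp', hp⟩ := hp
        refine .snoc (p := p') (ih.2 ⟨h1, h2.symm, x, ?_, hp'⟩) (a := a) ?_ hp
        · rw [List.forall₂_iff_get]
          refine ⟨hl, fun i h₁ h₂ => ?_⟩
          have := hx i (by simp; omega) (by simp; omega)
          simpa [List.getElem_append, h₁, h₂] using this
        · have := hx x.length (by simp) (by simp; omega)
          simpa [List.getElem_append, hl] using this

theorem mem_matchingWalks_iff {A : NFA α Q} {s t : V} {w : D.Walk} :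
    w ∈ D.matchingWalks A s t ↔
      w.source = s ∧ ∃ p ∈ A.accept, RunTo D A s w.edges (t, p) := by
  simp only [matchingWalks, Set.mem_ofPred_eq, Walk.Matches, Walk.words, Walk.target, runTo_iff]
  constructor
  · rintro ⟨rfl, rfl, x, hx, p, hp, hpx⟩
    exact ⟨rfl, p, hp, w.follows, rfl, x, hx, hpx⟩
  · rintro ⟨rfl, p, hp, -, h, x, hx, hpx⟩
    exact ⟨rfl, h, x, hx, p, hp, hpx⟩

end Database

/-- The numbers that follow the number of the source in the spelling of a walk. -/
def spellEdges {k n m : ℕ} (D : Database (Fin k) (Fin n) (Fin m)) (es : List (Fin m)) : List ℕ :=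
  es.flatMap fun e : Fin m => [(e : ℕ), (D.tgt e : ℕ)]

theorem spellEdges_injective {k n m : ℕ} (D : Database (Fin k) (Fin n) (Fin m)) :
    Function.Injective (spellEdges D) := by
  intro es
  induction es with
  | nil => intro es' h; cases es' with
    | nil => rfl
    | cons => simp [spellEdges] at h
  | cons e es ih => intro es' h; cases es' with
    | nil => simp [spellEdges] at h
    | cons e' es' =>
      simp only [spellEdges, List.flatMap_cons, List.cons_append, List.cons.injEq,
        List.nil_append] at h
      rw [Fin.ext h.1, ih h.2.2]

/-! ### The product of the database and the automaton -/

/-- A choice of the lists whose existence `Represents` asserts. -/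
structure Layout {k n m q : ℕ} (M : ℕ → ℕ) (D : Database (Fin k) (Fin n) (Fin m))
    (A : NFA (Fin k) (Fin q)) (s t : Fin n) where
  rep : Represents M D A s t
  startL : List (Fin q)
  start_lists : ListsSet startL A.start
  start_stored : StoresList M (M 6) (M 14) startL
  acceptL : List (Fin q)
  accept_lists : ListsSet acceptL A.accept
  accept_stored : StoresList M (M 6) (M 15) acceptL
  outL : Fin n → List (Fin m)
  out_lists : ∀ v, ListsSet (outL v) {e | D.src e = v}
  out_stored : ∀ v : Fin n, StoresList M (M 6) (M (M 8 + v)) (outL v)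
  lblL : Fin m → List (Fin k)
  lbl_lists : ∀ e, ListsSet (lblL e) {a | a ∈ D.lbl e}
  lbl_stored : ∀ e : Fin m, StoresList M (M 6) (M (M 11 + e)) (lblL e)
  stepL : Fin q → Fin k → List (Fin q)
  step_lists : ∀ p a, ListsSet (stepL p a) (A.step p a)
  step_stored : ∀ (p : Fin q) (a : Fin k),
    StoresList M (M 6) (M (M (M 13 + p) + a)) (stepL p a)

theorem Represents.nonempty_layout {k n m q : ℕ} {M : ℕ → ℕ}
    {D : Database (Fin k) (Fin n) (Fin m)} {A : NFA (Fin k) (Fin q)} {s t : Fin n}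
    (h : Represents M D A s t) : Nonempty (Layout M D A s t) := by
  obtain ⟨l₁, h₁, h₁'⟩ := h.start
  obtain ⟨l₂, h₂, h₂'⟩ := h.accept
  choose l₃ h₃ h₃' using fun v => (h.outgoing v).2
  choose l₄ h₄ h₄' using fun e => (h.edge_lbl e).2
  choose l₅ h₅ h₅' using fun p a => ((h.step p).2 a).2
  exact ⟨⟨h, l₁, h₁, h₁', l₂, h₂, h₂', l₃, h₃, h₃', l₄, h₄, h₄', l₅, h₅, h₅'⟩⟩

namespace Layout

variable {k n m q : ℕ} {M : ℕ → ℕ} {D : Database (Fin k) (Fin n) (Fin m)}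
  {A : NFA (Fin k) (Fin q)} {s t : Fin n} (Y : Layout M D A s t)

/-- The states that can be reached from `p` by a label of the edge `e`, with one occurrence for
every label. -/
def succE (e : Fin m) (p : Fin q) : List (Fin q) := (Y.lblL e).flatMap (Y.stepL p)

/-- The successors of a node of the product graph. -/
def succ (x : Fin n × Fin q) : List (Fin n × Fin q) :=
  (Y.outL x.1).flatMap fun e => (Y.succE e x.2).map fun p => (D.tgt e, p)

/-- The initial nodes of the product graph. -/
def start : List (Fin n × Fin q) := Y.startL.map fun p => (s, p)

/-- Distance in the product graph from the initial nodes. -/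
noncomputable def lev (x : Fin n × Fin q) : ℕ := level Y.start Y.succ x

/-- The node `x` can be reached from the initial nodes. -/
def Disc (x : Fin n × Fin q) : Prop := ∃ d, Reach Y.start Y.succ d x

theorem mem_succE {e : Fin m} {p p' : Fin q} :
    p' ∈ Y.succE e p ↔ ∃ a ∈ D.lbl e, p' ∈ A.step p a := by
  simp only [succE, List.mem_flatMap, (Y.lbl_lists e).2, (Y.step_lists p _).2, Set.mem_ofPred_eq]

theorem mem_succ {x y : Fin n × Fin q} :
    y ∈ Y.succ x ↔ ∃ e, D.src e = x.1 ∧ D.tgt e = y.1 ∧ y.2 ∈ Y.succE e x.2 := by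
  simp only [succ, List.mem_flatMap, (Y.out_lists _).2, Set.mem_ofPred_eq, List.mem_map]
  constructor
  · rintro ⟨e, he, p, hp, rfl⟩
    exact ⟨e, he, rfl, hp⟩
  · rintro ⟨e, he, he', hp⟩
    exact ⟨e, he, _, hp, by rw [he']⟩

theorem mem_succ_of_mem_succE {e : Fin m} {p p' : Fin q} (h : p' ∈ Y.succE e p) :
    (D.tgt e, p') ∈ Y.succ (D.src e, p) := Y.mem_succ.2 ⟨e, rfl, rfl, h⟩

theorem Disc.succ {Y : Layout M D A s t} {x y : Fin n × Fin q} (h : Y.Disc x) (hy : y ∈ Y.succ x) :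
    Y.Disc y := let ⟨_, h⟩ := h; ⟨_, h.step hy⟩

theorem reach_iff {d : ℕ} {x : Fin n × Fin q} :
    Reach Y.start Y.succ d x ↔ ∃ es : List (Fin m), es.length = d ∧ RunTo D A s es x := by
  constructor
  · intro h
    induction h with
    | zero h =>
      obtain ⟨p, hp, rfl⟩ := List.mem_map.1 h
      exact ⟨[], rfl, .nil ((Y.start_lists.2 p).1 hp)⟩
    | @step d x y _ hy ih =>
      obtain ⟨es, rfl, h⟩ := ih
      obtain ⟨e, he, he', hp⟩ := Y.mem_succ.1 hy
      obtain ⟨a, ha, hp⟩ := Y.mem_succE.1 hp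
      obtain ⟨v, p⟩ := x
      obtain ⟨v', p'⟩ := y
      subst he he'
      exact ⟨es ++ [e], by simp, h.snoc ha hp⟩
  · rintro ⟨es, rfl, h⟩
    induction h with
    | nil h => exact .zero (List.mem_map.2 ⟨_, (Y.start_lists.2 _).2 h, rfl⟩)
    | snoc _ ha hp ih =>
      rw [List.length_append]
      exact ih.step (Y.mem_succ_of_mem_succE (Y.mem_succE.2 ⟨_, ha, hp⟩))

/-- The pair `z = (e, p)` is the last step of a shortest path to `x`: the edge `e` ends at `x.1`,
and a shortest path to `(src e, p)` followed by `e` is a shortest path to `x`. -/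
def IsCell (x : Fin n × Fin q) (z : Fin m × Fin q) : Prop :=
  Y.Disc (D.src z.1, z.2) ∧ D.tgt z.1 = x.1 ∧ x.2 ∈ Y.succE z.1 z.2 ∧
    Y.lev x = Y.lev (D.src z.1, z.2) + 1

/-- The edges `es` are followed by a shortest path to the node `x`. -/
inductive CellPath : List (Fin m) → Fin n × Fin q → Prop
  | nil {x : Fin n × Fin q} : Y.Disc x → Y.lev x = 0 → CellPath [] x
  | snoc {es : List (Fin m)} {z : Fin m × Fin q} {x : Fin n × Fin q} :
      CellPath es (D.src z.1, z.2) → Y.IsCell x z → CellPath (es ++ [z.1]) x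

theorem CellPath.length {Y : Layout M D A s t} {es : List (Fin m)} {x : Fin n × Fin q}
    (h : Y.CellPath es x) : es.length = Y.lev x := by
  induction h with
  | nil _ h => exact h.symm
  | snoc _ h ih => rw [List.length_append, ih, h.2.2.2]; rfl

theorem CellPath.runTo {Y : Layout M D A s t} {es : List (Fin m)} {x : Fin n × Fin q}
    (h : Y.CellPath es x) : RunTo D A s es x := by
  induction h with
  | nil h h0 =>
    obtain ⟨d, h⟩ := h
    obtain ⟨p, hp, rfl⟩ := List.mem_map.1 (h.start_of_level_eq_zero h0)
    exact .nil ((Y.start_lists.2 p).1 hp)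
  | @snoc es z x _ h ih =>
    obtain ⟨-, h1, h2, -⟩ := h
    obtain ⟨a, ha, hp⟩ := Y.mem_succE.1 h2
    obtain ⟨v, p⟩ := x
    subst h1
    exact ih.snoc ha hp

theorem cellPath_iff {es : List (Fin m)} {x : Fin n × Fin q} :
    Y.CellPath es x ↔ RunTo D A s es x ∧ es.length = Y.lev x := by
  refine ⟨fun h => ⟨h.runTo, h.length⟩, ?_⟩
  rintro ⟨h, hl⟩
  induction h with
  | nil h =>
    exact .nil ⟨0, .zero (List.mem_map.2 ⟨_, (Y.start_lists.2 _).2 h, rfl⟩)⟩ hl.symm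
  | @snoc es e p p' a h ha hp ih =>
    have hr := Y.reach_iff.2 ⟨es, rfl, h⟩
    have hs : p' ∈ Y.succE e p := Y.mem_succE.2 ⟨_, ha, hp⟩
    have h1 : Y.lev _ ≤ Y.lev _ + 1 := hr.level_succ_le (Y.mem_succ_of_mem_succE hs)
    have h2 : Y.lev _ ≤ _ := hr.level_le
    rw [List.length_append, List.length_singleton] at hl
    have hlev : Y.lev (D.tgt e, p') = Y.lev (D.src e, p) + 1 := by omega
    exact .snoc (z := (e, p)) (ih (by omega) : Y.CellPath es (D.src e, p))
      ⟨⟨_, hr⟩, rfl, hs, hlev⟩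

/-- An accepting node at `t` of minimal level determines the length of the shortest matching
walks. -/
theorem minLen_eq {p : Fin q} (hp : p ∈ A.accept) (hd : Y.Disc (t, p))
    (hmin : ∀ p' ∈ A.accept, Y.Disc (t, p') → Y.lev (t, p) ≤ Y.lev (t, p')) :
    D.minLen A s t = Y.lev (t, p) := by
  obtain ⟨d, hd⟩ := hd
  obtain ⟨es, hes, hrun⟩ := Y.reach_iff.1 hd.reach_level
  refine le_antisymm (Nat.sInf_le ?_) (le_csInf ?_ ?_)
  · exact ⟨⟨s, es, (D.runTo_iff.1 hrun).1⟩, D.mem_matchingWalks_iff.2 ⟨rfl, p, hp, hrun⟩, hes⟩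
  · exact ⟨_, ⟨s, es, (D.runTo_iff.1 hrun).1⟩, D.mem_matchingWalks_iff.2 ⟨rfl, p, hp, hrun⟩, rfl⟩
  · rintro _ ⟨w, hw, rfl⟩
    obtain ⟨-, p', hp', h⟩ := D.mem_matchingWalks_iff.1 hw
    have hr := Y.reach_iff.2 ⟨_, rfl, h⟩
    exact (hmin p' hp' ⟨_, hr⟩).trans hr.level_le

/-- Shortest matching walks correspond to paths of last steps. Different nodes at `t` may have paths
with the same edges, so the states are quantified away. -/
theorem shortest_iff {p₀ : Fin q} (hp₀ : p₀ ∈ A.accept) (hd : Y.Disc (t, p₀))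
    (hmin : ∀ p' ∈ A.accept, Y.Disc (t, p') → Y.lev (t, p₀) ≤ Y.lev (t, p')) (o : List ℕ) :
    (∃ w ∈ D.shortestWalks A s t, w.spell = o) ↔
      ∃ es, (∃ p ∈ A.accept, Y.lev (t, p) = Y.lev (t, p₀) ∧ Y.CellPath es (t, p)) ∧
        (s : ℕ) :: spellEdges D es = o := by
  have hl := Y.minLen_eq hp₀ hd hmin
  constructor
  · rintro ⟨w, ⟨hw, hlen⟩, rfl⟩
    obtain ⟨hs, p, hp, h⟩ := D.mem_matchingWalks_iff.1 hw
    have hr := Y.reach_iff.2 ⟨_, rfl, h⟩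
    have h1 := hmin p hp ⟨_, hr⟩
    have h2 : Y.lev _ ≤ _ := hr.level_le
    have h3 : w.edges.length = Y.lev (t, p₀) := hlen.trans hl
    exact ⟨w.edges, ⟨p, hp, by omega, Y.cellPath_iff.2 ⟨h, by omega⟩⟩, by rw [← hs]; rfl⟩
  · rintro ⟨es, ⟨p, hp, hlev, h⟩, rfl⟩
    refine ⟨⟨s, es, (D.runTo_iff.1 h.runTo).1⟩, ⟨D.mem_matchingWalks_iff.2 ⟨rfl, p, hp, h.runTo⟩,
      ?_⟩, rfl⟩
    rw [hl, ← hlev]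
    exact h.length

theorem shortestWalks_eq_empty (h : ∀ p ∈ A.accept, ¬ Y.Disc (t, p)) :
    D.shortestWalks A s t = ∅ := by
  refine Set.eq_empty_of_forall_notMem fun w hw => ?_
  obtain ⟨-, p, hp, hr⟩ := D.mem_matchingWalks_iff.1 hw.1
  exact h p hp ⟨_, Y.reach_iff.2 ⟨_, rfl, hr⟩⟩

end Layout

/-! ### Lists of last steps, and their sizes -/

theorem sum_countP_eq {ι κ : Type*} [Fintype κ] [DecidableEq κ] (l : List ι) (R : ι → Bool)
    (f : ι → κ) : ∑ x, l.countP (fun z => R z && decide (f z = x)) = l.countP R := by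
  induction l with
  | nil => simp
  | cons z l ih =>
    simp only [List.countP_cons, Finset.sum_add_distrib, ih]
    cases R z <;> simp

theorem ListsSet.length_eq {N : ℕ} {l : List (Fin N)} {S : Set (Fin N)} (h : ListsSet l S) :
    l.length = S.ncard := by
  classical
  rw [← List.toFinset_card_of_nodup h.1, ← Set.ncard_coe_finset]
  congr 1
  ext x
  simp [h.2]

theorem List.Nodup.sum_map_le {ι : Type*} [Fintype ι] {l : List ι} (h : l.Nodup) (f : ι → ℕ) :
    (l.map f).sum ≤ ∑ x, f x := by
  classical
  rw [← List.sum_toFinset _ h]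
  exact Finset.sum_le_sum_of_subset (Finset.subset_univ _)

namespace Layout

variable {k n m q : ℕ} {M : ℕ → ℕ} {D : Database (Fin k) (Fin n) (Fin m)}
  {A : NFA (Fin k) (Fin q)} {s t : Fin n} (Y : Layout M D A s t)

/-- The steps `(e, p, p')` from `p` to `p'` along the edge `e` among the links `tr` that end at the
node `x`, as pairs `(e, p)`, the latest link first. -/
def cellsOf (D : Database (Fin k) (Fin n) (Fin m)) (tr : List (Fin m × Fin q × Fin q))
    (x : Fin n × Fin q) : List (Fin m × Fin q) :=
  (tr.filter fun z => (D.tgt z.1, z.2.2) = x).reverse.map fun z => (z.1, z.2.1)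

theorem cellsOf_append (tr : List (Fin m × Fin q × Fin q)) (z : Fin m × Fin q × Fin q)
    (x : Fin n × Fin q) : cellsOf D (tr ++ [z]) x =
      if (D.tgt z.1, z.2.2) = x then (z.1, z.2.1) :: cellsOf D tr x else cellsOf D tr x := by
  unfold cellsOf
  split_ifs with h <;> simp [List.filter_append, h]

open Classical in
/-- Extend the links by the step from `p` to `p'` along `e` if it increases the level by one. -/
noncomputable def linkStep (e : Fin m) (p : Fin q) (tr : List (Fin m × Fin q × Fin q))
    (p' : Fin q) : List (Fin m × Fin q × Fin q) :=
  if Y.lev (D.tgt e, p') = Y.lev (D.src e, p) + 1 then tr ++ [(e, p, p')] else tr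

open Classical in
/-- The links that leave the node `(src e, p)` along the edge `e`. -/
noncomputable def links (e : Fin m) (p : Fin q) : List (Fin m × Fin q × Fin q) :=
  if Y.Disc (D.src e, p) then
    ((Y.succE e p).filter fun p' => Y.lev (D.tgt e, p') = Y.lev (D.src e, p) + 1).map
      fun p' => (e, p, p')
  else []

theorem foldl_linkStep (e : Fin m) (p : Fin q) (hd : Y.Disc (D.src e, p))
    (tr : List (Fin m × Fin q × Fin q)) :
    (Y.succE e p).foldl (Y.linkStep e p) tr = tr ++ Y.links e p := by
  rw [links, if_pos hd]
  generalize Y.succE e p = l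
  induction l generalizing tr with
  | nil => simp
  | cons p' l ih =>
    rw [List.foldl_cons, ih]
    unfold linkStep
    split_ifs with h <;> simp [h]

/-- All links, in increasing order of the edges. -/
noncomputable def allLinks : List (Fin m × Fin q × Fin q) :=
  (List.finRange m).flatMap fun e => (List.finRange q).flatMap (Y.links e)

theorem mem_links {e : Fin m} {p : Fin q} {z : Fin m × Fin q × Fin q} :
    z ∈ Y.links e p ↔ z.1 = e ∧ z.2.1 = p ∧ Y.IsCell (D.tgt z.1, z.2.2) (z.1, z.2.1) := by
  classical
  obtain ⟨e', p', p''⟩ := z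
  unfold links IsCell
  split_ifs with h
  · simp only [List.mem_map, List.mem_filter, decide_eq_true_eq, Prod.mk.injEq]
    constructor
    · rintro ⟨r, ⟨h1, h2⟩, rfl, rfl, rfl⟩
      exact ⟨rfl, rfl, h, trivial, h1, h2⟩
    · rintro ⟨rfl, rfl, -, -, h1, h2⟩
      exact ⟨_, ⟨h1, h2⟩, rfl, rfl, rfl⟩
  · simp only [List.not_mem_nil, false_iff]
    rintro ⟨rfl, rfl, h', -⟩
    exact h h'

/-- The last steps of shortest paths to the node `x`. -/
noncomputable def cells (x : Fin n × Fin q) : List (Fin m × Fin q) := cellsOf D Y.allLinks x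

theorem mem_cells {x : Fin n × Fin q} {z : Fin m × Fin q} : z ∈ Y.cells x ↔ Y.IsCell x z := by
  obtain ⟨v, p⟩ := x
  obtain ⟨e, p'⟩ := z
  simp only [cells, cellsOf, allLinks, List.mem_map, List.mem_reverse, List.mem_filter,
    List.mem_flatMap, mem_links, decide_eq_true_eq, Prod.mk.injEq]
  constructor
  · rintro ⟨⟨e, p, p'⟩, ⟨⟨_, _, _, _, rfl, rfl, h⟩, rfl, rfl⟩, rfl, rfl⟩
    exact h
  · intro h
    have h1 : D.tgt e = v := h.2.1
    subst h1
    exact ⟨(e, p', p), ⟨⟨e, List.mem_finRange _, p', List.mem_finRange _, rfl, rfl, h⟩, rfl, rfl⟩,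
      rfl, rfl⟩

/-- The links are created in increasing order of the edges, and each is put in front of its list. -/
theorem cells_sorted (x : Fin n × Fin q) : (Y.cells x).Pairwise fun a b => b.1 ≤ a.1 := by
  have h : Y.allLinks.Pairwise fun a b => a.1 ≤ b.1 := by
    unfold allLinks
    rw [List.pairwise_flatMap]
    have he : ∀ (e : Fin m), ∀ z ∈ (List.finRange q).flatMap (Y.links e), z.1 = e := by
      intro e z hz
      obtain ⟨p, -, hz⟩ := List.mem_flatMap.1 hz
      exact (Y.mem_links.1 hz).1
    refine ⟨fun e _ => ?_, ?_⟩
    · rw [List.pairwise_iff_getElem]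
      intro i j hi hj _
      rw [he e _ (List.getElem_mem hi), he e _ (List.getElem_mem hj)]
    · refine (List.pairwise_lt_finRange m).imp ?_
      intro e e' hlt a ha b hb
      rw [he e a ha, he e' b hb]
      exact hlt.le
  unfold cells cellsOf
  rw [List.pairwise_map, List.pairwise_reverse]
  exact h.filter _

/-- The number of transitions of the automaton. -/
noncomputable def numTrans (A : NFA (Fin k) (Fin q)) : ℕ :=
  {x : Fin q × Fin k × Fin q | x.2.2 ∈ A.step x.1 x.2.1}.ncard

theorem sum_stepL_le : ∑ p, ∑ a, (Y.stepL p a).length ≤ numTrans A := by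
  have h : Fintype.card (Σ (p : Fin q) (a : Fin k), Fin (Y.stepL p a).length) =
      ∑ p, ∑ a, (Y.stepL p a).length := by simp
  rw [← h, numTrans, ← Nat.card_eq_fintype_card, ← Nat.card_coe_set_eq]
  refine Nat.card_le_card_of_injective
    (fun z => ⟨(z.1, z.2.1, (Y.stepL z.1 z.2.1)[z.2.2]),
      ((Y.step_lists _ _).2 _).1 (List.getElem_mem _)⟩) ?_
  rintro ⟨p, a, i⟩ ⟨p', a', i'⟩ h
  simp only [Subtype.mk.injEq, Prod.mk.injEq] at h
  obtain ⟨rfl, rfl, h⟩ := h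
  have := (Y.step_lists p a).1.getElem_inj_iff.1 h
  rw [Fin.ext this]

theorem length_succE (e : Fin m) (p : Fin q) :
    (Y.succE e p).length = ((Y.lblL e).map fun a => (Y.stepL p a).length).sum := by
  rw [succE, List.length_flatMap]

theorem sum_length_succE_le (e : Fin m) : ∑ p, (Y.succE e p).length ≤ numTrans A := by
  refine le_trans (Finset.sum_le_sum fun p _ => ?_) Y.sum_stepL_le
  rw [length_succE]
  exact (Y.lbl_lists e).1.sum_map_le _

theorem length_links_le (e : Fin m) (p : Fin q) :
    (Y.links e p).length ≤ (Y.succE e p).length := by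
  unfold links
  split_ifs
  · rw [List.length_map]
    exact List.length_filter_le _ _
  · simp

theorem length_allLinks_le : Y.allLinks.length ≤ m * numTrans A := by
  unfold allLinks
  rw [List.length_flatMap, ← Fin.sum_univ_def]
  refine (Finset.sum_le_card_nsmul _ _ (numTrans A) fun e _ => ?_).trans (by simp)
  rw [List.length_flatMap, ← Fin.sum_univ_def]
  exact (Finset.sum_le_sum fun p _ => Y.length_links_le e p).trans (Y.sum_length_succE_le e)

theorem countP_cells (x : Fin n × Fin q) (R : Fin m → Bool) :
    (Y.cells x).countP (fun z => R z.1) =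
      Y.allLinks.countP fun z => R z.1 && decide ((D.tgt z.1, z.2.2) = x) := by
  unfold cells cellsOf
  rw [List.countP_map, List.countP_reverse, List.countP_filter]
  rfl

theorem sum_length_cells_le : ∑ x, (Y.cells x).length ≤ m * numTrans A := by
  refine le_trans (le_of_eq ?_) Y.length_allLinks_le
  have h := sum_countP_eq Y.allLinks (fun _ => true) fun z => (D.tgt z.1, z.2.2)
  have h' : ∀ x, (Y.cells x).length = _ := fun x =>
    (by simp : (Y.cells x).length = (Y.cells x).countP fun _ => true).trans
      (Y.countP_cells x fun _ => true)
  simp only [h', h]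
  simp

/-- The last steps along a single edge number at most as many as the transitions. -/
theorem sum_countP_cells_le (v : Fin n) (e : Fin m) :
    ∑ p, (Y.cells (v, p)).countP (fun z => decide (z.1 = e)) ≤ numTrans A := by
  have h1 : ∑ p, (Y.cells (v, p)).countP (fun z => decide (z.1 = e)) ≤
      ∑ x, (Y.cells x).countP (fun z => decide (z.1 = e)) := by
    rw [Fintype.sum_prod_type]
    exact Finset.single_le_sum
      (f := fun v => ∑ p, (Y.cells (v, p)).countP (fun z => decide (z.1 = e)))
      (fun _ _ => Nat.zero_le _) (Finset.mem_univ v)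
  refine h1.trans ?_
  have h' : ∀ x, (Y.cells x).countP (fun z => decide (z.1 = e)) = _ := fun x =>
    Y.countP_cells x fun e' => decide (e' = e)
  have h := sum_countP_eq Y.allLinks (fun z => decide (z.1 = e)) fun z => (D.tgt z.1, z.2.2)
  simp only [h', h]
  unfold allLinks
  rw [List.countP_flatMap, ← Fin.sum_univ_def]
  simp only [Function.comp_apply]
  have h0 : ∀ e' : Fin m, e' ≠ e →
      ((List.finRange q).flatMap (Y.links e')).countP (fun z => decide (z.1 = e)) = 0 := by
    intro e' he'
    rw [List.countP_eq_zero]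
    intro z hz
    obtain ⟨p, -, hz⟩ := List.mem_flatMap.1 hz
    simp [(Y.mem_links.1 hz).1, he']
  rw [Finset.sum_eq_single e (fun e' _ he' => h0 e' he') (by simp)]
  refine List.countP_le_length.trans ?_
  rw [List.length_flatMap, ← Fin.sum_univ_def]
  exact (Finset.sum_le_sum fun p _ => Y.length_links_le e p).trans (Y.sum_length_succE_le e)

/-- The time for the enumeration of the steps from `p` along the edge `e`, up to a constant. -/
def work (e : Fin m) (p : Fin q) : ℕ := 1 + (Y.lblL e).length + (Y.succE e p).length

theorem automatonSize_eq : automatonSize A =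
    k + q + numTrans A + Y.startL.length + Y.acceptL.length := by
  simp [automatonSize, numTrans, Y.start_lists.length_eq, Y.accept_lists.length_eq]

theorem length_lblL (e : Fin m) : (Y.lblL e).length = (D.lbl e).card := by
  rw [(Y.lbl_lists e).length_eq]
  exact Set.ncard_coe_finset _

theorem sum_work_le : ∑ e, ∑ p, Y.work e p ≤ (m + ∑ e, (D.lbl e).card) * automatonSize A := by
  have h : ∀ e, ∑ p, Y.work e p ≤ (1 + (D.lbl e).card) * automatonSize A := by
    intro e
    unfold work
    rw [Finset.sum_add_distrib, Finset.sum_const, Finset.card_univ, Fintype.card_fin, length_lblL,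
      smul_eq_mul, Y.automatonSize_eq]
    have := Y.sum_length_succE_le e
    nlinarith
  refine (Finset.sum_le_sum fun e _ => h e).trans (le_of_eq ?_)
  rw [← Finset.sum_mul, Finset.sum_add_distrib]
  simp

end Layout

namespace RAM

/-- Sequencing of programs. -/
local infixr:60 " ;; " => Prog.seq

/-! ### The program: preprocessing -/

/-! Instructions as programs. -/

namespace Prog

def set (x c : ℕ) : Prog := .instr (.set x c)
def add (x y c : ℕ) : Prog := .instr (.addConst x y c)
def sub (x y c : ℕ) : Prog := .instr (.subConst x y c)
def load (x a i : ℕ) : Prog := .instr (.load x a i)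
def store (a i x : ℕ) : Prog := .instr (.store a i x)
def write (x : ℕ) : Prog := .instr (.write x)
def emit : Prog := .instr .emit
def nop : Prog := .instr .nop

end Prog

section

variable {σ : State} {Q : State → Prop} {x y a i c : ℕ}

theorem runs_set : Runs (.set x c) σ Q ↔
    Q ⟨Function.update σ.reg x c, σ.mem, σ.clock + 1, σ.buf, σ.log⟩ := runs_instr

theorem runs_add : Runs (.add x y c) σ Q ↔
    Q ⟨Function.update σ.reg x (σ.reg y + c), σ.mem, σ.clock + 1, σ.buf, σ.log⟩ := runs_instr

theorem runs_sub : Runs (.sub x y c) σ Q ↔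
    Q ⟨Function.update σ.reg x (σ.reg y - c), σ.mem, σ.clock + 1, σ.buf, σ.log⟩ := runs_instr

theorem runs_load : Runs (.load x a i) σ Q ↔
    Q ⟨Function.update σ.reg x (σ.mem (σ.reg a + σ.reg i)), σ.mem, σ.clock + 1, σ.buf, σ.log⟩ :=
  runs_instr

theorem runs_store : Runs (.store a i x) σ Q ↔
    Q ⟨σ.reg, Function.update σ.mem (σ.reg a + σ.reg i) (σ.reg x), σ.clock + 1, σ.buf, σ.log⟩ :=
  runs_instr

theorem runs_write : Runs (.write x) σ Q ↔
    Q ⟨σ.reg, σ.mem, σ.clock + 1, σ.buf ++ [σ.reg x], σ.log⟩ := runs_instr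

theorem runs_emit : Runs .emit σ Q ↔
    Q ⟨σ.reg, σ.mem, σ.clock + 1, [], σ.log ++ [(σ.buf, σ.clock + 1)]⟩ := runs_instr

theorem runs_nop : Runs .nop σ Q ↔
    Q ⟨σ.reg, σ.mem, σ.clock + 1, σ.buf, σ.log⟩ := runs_instr

end

/-- Load the constants and the header of the input into the registers below `20`. -/
def setup : Prog :=
  .set 1 1 ;; .set 2 2 ;; .set 3 3 ;; .set 4 4 ;; .set 21 6 ;; .load 5 21 0 ;; .add 6 5 1 ;;
    .set 21 14 ;; .load 7 21 0 ;; .set 21 15 ;; .load 8 21 0 ;; .load 10 1 0 ;; .load 11 2 0 ;;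
    .load 12 3 0 ;; .load 13 4 0 ;; .set 21 5 ;; .load 14 21 0 ;; .set 21 8 ;; .load 15 21 0 ;;
    .set 21 9 ;; .load 16 21 0 ;; .set 21 10 ;; .load 17 21 0 ;; .set 21 11 ;; .load 18 21 0 ;;
    .set 21 13 ;; .load 19 21 0

/-- Store, for every vertex, the address of its row in the table of the nodes. Register `20` ends
up with the address that follows the table. -/
def rows : Prog :=
  .add 20 6 0 ;; forRange 21 10 (.add 20 20 1) ;;
    forRange 21 10 (.store 6 21 20 ;; forRange 22 12 (.add 20 20 1))

/-- Run `body` for the states, in register `40`, that can be reached along the edge in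
register `30` from the state whose row of the transition table is in register `25`. -/
def forSucc (body : Prog) : Prog :=
  .load 31 17 30 ;; .load 32 6 31 ;; .load 33 18 30 ;;
    forList 33 (.load 37 25 36 ;; forList 37 body)

/-- Create a record for the vertex in register `31` and the state in register `40`, with the level
in register `24`, unless there is one. A record consists of the vertex, the state, the level, the
address of the list of the last steps of shortest paths, and a time stamp. -/
def discover : Prog :=
  .load 41 32 40 ;; .ite (.eq 41 0)
    (.store 32 40 20 ;; .store 20 0 31 ;; .store 20 1 40 ;; .store 20 2 24 ;; .store 20 3 5 ;;
      .store 20 4 0 ;; .add 20 20 5) .nop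

/-- Breadth-first search; the records, in the order of their creation, form the queue. -/
def bfs : Prog :=
  .add 21 20 0 ;; .set 24 0 ;; .add 31 13 0 ;; .load 32 6 31 ;; .add 37 7 0 ;;
    forList 37 discover ;;
    .loop (.lt 21 20)
      (.load 22 21 0 ;; .load 23 21 1 ;; .load 24 21 2 ;; .add 24 24 1 ;; .load 25 19 23 ;;
        .load 27 15 22 ;; forList 27 (forSucc discover) ;; .add 21 21 5)

/-- Put a cell in front of the list of the node `(31, 40)` if the edge in register `30` leads from
the record in register `26` to this node and increases the level by one. A cell consists of the
successor of the number of the edge, the address of the record, and the next cell. -/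
def link : Prog :=
  .load 41 32 40 ;; .load 42 41 2 ;; .ite (.eq 42 24)
    (.add 43 30 1 ;; .store 20 0 43 ;; .store 20 1 26 ;; .load 44 41 3 ;; .store 20 2 44 ;;
      .store 41 3 20 ;; .add 20 20 3) .nop

/-- Build the lists of the last steps of shortest paths, each in decreasing order of the edges. -/
def linkAll : Prog :=
  forRange 21 11 (.load 22 16 21 ;; .load 22 6 22 ;;
    forRange 23 12 (.load 26 22 23 ;; .ite (.eq 26 0) .nop
      (.load 24 26 2 ;; .add 24 24 1 ;; .load 25 19 23 ;; .add 30 21 0 ;; forSucc link)))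

end RAM

open RAM

namespace Layout

variable {k n m q : ℕ} {M : ℕ → ℕ} {D : Database (Fin k) (Fin n) (Fin m)}
  {A : NFA (Fin k) (Fin q)} {s t : Fin n} (Y : Layout M D A s t)

/-! ### The layout of the working memory -/

/-- The registers below `20` hold the constants and the header of the input. -/
structure Glob (_ : Layout M D A s t) (σ : State) : Prop where
  r0 : σ.reg 0 = 0
  r1 : σ.reg 1 = 1
  r2 : σ.reg 2 = 2
  r3 : σ.reg 3 = 3
  r4 : σ.reg 4 = 4
  r5 : σ.reg 5 = M 6
  r6 : σ.reg 6 = M 6 + 1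
  r7 : σ.reg 7 = M 14
  r8 : σ.reg 8 = M 15
  r10 : σ.reg 10 = n
  r11 : σ.reg 11 = m
  r12 : σ.reg 12 = q
  r13 : σ.reg 13 = s
  r14 : σ.reg 14 = t
  r15 : σ.reg 15 = M 8
  r16 : σ.reg 16 = M 9
  r17 : σ.reg 17 = M 10
  r18 : σ.reg 18 = M 11
  r19 : σ.reg 19 = M 13

variable {Y} in
theorem Glob.of_reg {σ τ : State} (h : Y.Glob σ) (hr : ∀ x < 20, τ.reg x = σ.reg x) :
    Y.Glob τ := by
  obtain ⟨⟩ := h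
  constructor <;> rw [hr _ (by norm_num)] <;> assumption

variable {Y} in
theorem Glob.of_below {σ τ : State} (h : Y.Glob σ) {r : ℕ} (hr : Below r σ τ) (h20 : 20 ≤ r) :
    Y.Glob τ := h.of_reg fun x hx => hr.reg x (by omega) (by omega)

/-- The address of the entry for the node `x` in the table of the nodes. -/
def tab (_ : Layout M D A s t) (x : Fin n × Fin q) : ℕ := M 6 + 1 + n + x.1 * q + x.2

/-- The address of the first record. -/
def recs (_ : Layout M D A s t) : ℕ := M 6 + 1 + n + n * q

theorem tab_lt (x : Fin n × Fin q) : M 6 + n < Y.tab x ∧ Y.tab x < Y.recs := by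
  unfold tab recs
  have h1 := x.1.2
  have h2 := x.2.2
  have : (x.1 + 1) * q ≤ n * q := Nat.mul_le_mul_right _ h1
  rw [Nat.add_mul, Nat.one_mul] at this
  omega

theorem tab_inj {x y : Fin n × Fin q} : Y.tab x = Y.tab y ↔ x = y := by
  refine ⟨fun h => ?_, fun h => h ▸ rfl⟩
  unfold tab at h
  have h' : q * x.1 + x.2 = q * y.1 + y.2 := by
    rw [Nat.mul_comm q, Nat.mul_comm q]; omega
  have hq : 0 < q := x.2.pos
  have e1 := congrArg (· / q) h'
  have e2 := congrArg (· % q) h'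
  simp only [Nat.mul_add_div hq, Nat.mul_add_mod, Nat.div_eq_of_lt x.2.2, Nat.div_eq_of_lt y.2.2,
    Nat.mod_eq_of_lt x.2.2, Nat.mod_eq_of_lt y.2.2, Nat.add_zero] at e1 e2
  exact Prod.ext (Fin.ext e1) (Fin.ext e2)

/-- The address of the record of the node `x`, if the records belong to the nodes `ns`. -/
def adr (ns : List ((Fin n × Fin q) × ℕ)) (x : Fin n × Fin q) : ℕ :=
  Y.recs + 5 * (ns.map Prod.fst).idxOf x

/-- The input, the addresses of the rows, the table of the nodes, and the first three entries of
the records of the nodes `ns` with their levels. The cell `M 6` contains `0`; it serves as the end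
of the lists of last steps. -/
structure Tables (ns : List ((Fin n × Fin q) × ℕ)) (mem : ℕ → ℕ) : Prop where
  low : ∀ a < M 6, mem a = M a
  nul : mem (M 6) = 0
  row : ∀ v : Fin n, mem (M 6 + 1 + v) = M 6 + 1 + n + v * q
  tab : ∀ x, mem (Y.tab x) = if x ∈ ns.map Prod.fst then Y.adr ns x else 0
  vertex : ∀ i (h : i < ns.length), mem (Y.recs + 5 * i) = ns[i].1.1
  state : ∀ i (h : i < ns.length), mem (Y.recs + 5 * i + 1) = ns[i].1.2
  level : ∀ i (h : i < ns.length), mem (Y.recs + 5 * i + 2) = ns[i].2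

/-- The memory during the breadth-first search: no record has a last step. -/
structure BfsMem (ns : List ((Fin n × Fin q) × ℕ)) (mem : ℕ → ℕ) : Prop extends
    Y.Tables ns mem where
  head : ∀ i < ns.length, mem (Y.recs + 5 * i + 3) = M 6
  mark : ∀ i < ns.length, mem (Y.recs + 5 * i + 4) = 0

/-! ### Iteration over successors -/

theorem runs_forSucc {γ : Type*} {body : Prog} (Inv : γ → (ℕ → ℕ) → ℕ → Prop)
    (G : γ → Fin q → γ) (c : ℕ) (e : Fin m) (p : Fin q) (g : γ) (σ : State)
    (hT : ∀ g mem b, Inv g mem b → ∃ ns, Y.Tables ns mem) (hg : Y.Glob σ) (h30 : σ.reg 30 = e)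
    (h25 : σ.reg 25 = M (M 13 + p)) (hinv : Inv g σ.mem (σ.reg 20))
    (hbody : ∀ p' ∈ Y.succE e p, ∀ g τ, Inv g τ.mem (τ.reg 20) → Y.Glob τ → Below 31 σ τ →
      τ.reg 31 = D.tgt e → τ.reg 32 = M 6 + 1 + n + D.tgt e * q → τ.reg 40 = p' →
      Runs body τ fun τ' => Inv (G g p') τ'.mem (τ'.reg 20) ∧ Below 41 τ τ' ∧
        τ'.clock ≤ τ.clock + c) :
    Runs (forSucc body) σ fun τ => Inv ((Y.succE e p).foldl G g) τ.mem (τ.reg 20) ∧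
      Below 31 σ τ ∧ τ.clock ≤ σ.clock + (c + 10) * Y.work e p := by
  have hlow : ∀ g mem b, Inv g mem b → ∀ a < M 6, mem a = M a := fun g mem b h =>
    let ⟨_, h⟩ := hT g mem b h; h.low
  obtain ⟨ns, hT0⟩ := hT _ _ _ hinv
  have e1 : σ.mem (M 10 + e) = D.tgt e := by
    rw [hT0.low _ (Y.rep.edge_tgt e).1, (Y.rep.edge_tgt e).2]
  have e2 := hT0.row (D.tgt e)
  have e3 : σ.mem (M 11 + e) = M (M 11 + e) := hT0.low _ (Y.rep.edge_lbl e).1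
  unfold forSucc
  simp only [runs_seq, runs_load]
  simp only [ne_eq, Nat.reduceEqDiff, not_false_eq_true,
    Function.update_of_ne, Function.update_self, hg.r17, hg.r6, hg.r18, h30, e1, e2, e3]
  have hG : Y.succE e p = (Y.lblL e).flatMap (Y.stepL p) := rfl
  refine (runs_forList (free := M 6) (M := M) Inv (fun g a => (Y.stepL p a).foldl G g)
    (fun a => 1 + ((Y.stepL p a).map fun _ => c + 3).sum + 3) (Y.lblL e) g _ (by norm_num) hlow
    (by simp [hg.r0]) (by simpa using Y.lbl_stored e) (by simpa using hinv) ?_).mono ?_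
  · intro a ha g τ hI hB h36
    have hg' : Y.Glob τ := by
      refine Glob.of_below (hg.of_reg ?_) hB (by norm_num)
      intro x hx
      simp [show x ≠ 33 by omega, show x ≠ 32 by omega, show x ≠ 31 by omega]
    have k25 : τ.reg 25 = M (M 13 + p) := by
      rw [hB.reg 25 (by norm_num) (by norm_num)]; simpa using h25
    have k31 : τ.reg 31 = D.tgt e := by
      rw [hB.reg 31 (by norm_num) (by norm_num)]; simp
    have k32 : τ.reg 32 = M 6 + 1 + n + D.tgt e * q := by
      rw [hB.reg 32 (by norm_num) (by norm_num)]; simp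
    have kB : Below 31 σ τ := by
      refine Below.trans (r' := 31) ?_ hB le_rfl (by norm_num)
      simp only [below_update, Nat.reduceLeDiff, true_or, le_refl, below_self]
    simp only [runs_seq, runs_load]
    have e4 : τ.mem (M (M 13 + p) + a) = M (M (M 13 + p) + a) :=
      hlow _ _ _ hI _ ((Y.rep.step p).2 a).1
    rw [k25, show τ.reg 36 = a from h36, e4]
    refine (runs_forList (free := M 6) (M := M) Inv G (fun _ => c) (Y.stepL p a) g _ (by norm_num)
      hlow (by simp [hg'.r0]) (by simpa using Y.step_stored p a) (by simpa using hI) ?_).mono ?_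
    · intro p' hp' g' τ' hI' hB' h40
      have hB'' : Below 37 τ τ' := by
        refine Below.trans (r' := 37) ?_ hB' le_rfl (by norm_num)
        simp only [below_update, Nat.reduceLeDiff, true_or, le_refl, below_self]
      exact hbody p' (List.mem_flatMap.2 ⟨a, ha, hp'⟩) g' τ' hI' (hg'.of_below hB'' (by norm_num))
        (kB.trans hB'' (by norm_num) (by norm_num))
        ((hB''.reg 31 (by norm_num) (by norm_num)).trans k31)
        ((hB''.reg 32 (by norm_num) (by norm_num)).trans k32) h40
    · rintro τ' ⟨hI', hB', hc'⟩
      refine ⟨hI', ?_, ?_⟩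
      · refine Below.trans (r' := 37) ?_ hB' (by norm_num) (by norm_num)
        simp only [below_update, Nat.reduceLeDiff, true_or, le_refl, below_self]
      · dsimp only at hc'
        omega
  · rintro τ ⟨hI, hB, hc⟩
    refine ⟨?_, ?_, ?_⟩
    · rw [hG, List.foldl_flatMap]
      exact hI
    · refine Below.trans (r' := 31) ?_ hB le_rfl (by norm_num)
      simp only [below_update, Nat.reduceLeDiff, true_or, le_refl, below_self]
    · refine hc.trans ?_
      dsimp only
      have : ((Y.lblL e).map fun a => 1 + ((Y.stepL p a).map fun _ => c + 3).sum + 3 + 3).sum =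
          7 * (Y.lblL e).length + (c + 3) * (Y.succE e p).length := by
        rw [Y.length_succE]
        simp only [List.map_const', List.sum_replicate, smul_eq_mul]
        induction Y.lblL e with
        | nil => simp
        | cons a l ih =>
          simp only [List.map_cons, List.sum_cons, ih, List.length_cons]
          ring
      rw [this]
      unfold work
      nlinarith

end Layout

namespace Layout

variable {k n m q : ℕ} {M : ℕ → ℕ} {D : Database (Fin k) (Fin n) (Fin m)}
  {A : NFA (Fin k) (Fin q)} {s t : Fin n} (Y : Layout M D A s t)

/-! ### Correctness of the breadth-first search of the program -/

theorem adr_pos (ns : List ((Fin n × Fin q) × ℕ)) (x : Fin n × Fin q) : 0 < Y.adr ns x := by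
  unfold adr recs
  omega

theorem adr_append_of_mem {ns : List ((Fin n × Fin q) × ℕ)} {x : Fin n × Fin q}
    (h : x ∈ ns.map Prod.fst) (z : (Fin n × Fin q) × ℕ) : Y.adr (ns ++ [z]) x = Y.adr ns x := by
  unfold adr
  rw [List.map_append, List.idxOf_append_of_mem h]

theorem adr_append_self {ns : List ((Fin n × Fin q) × ℕ)} {x : Fin n × Fin q}
    (h : x ∉ ns.map Prod.fst) (d : ℕ) :
    Y.adr (ns ++ [(x, d)]) x = Y.recs + 5 * ns.length := by
  unfold adr
  rw [List.map_append, List.idxOf_append_of_notMem h]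
  simp

variable {Y}

theorem Tables.tab_eq_zero_iff {ns : List ((Fin n × Fin q) × ℕ)} {mem : ℕ → ℕ}
    (h : Y.Tables ns mem) (x : Fin n × Fin q) : mem (Y.tab x) = 0 ↔ x ∉ ns.map Prod.fst := by
  rw [h.tab]
  have := Y.adr_pos ns x
  split_ifs with hx
  · exact ⟨fun h => by omega, fun h => absurd hx h⟩
  · exact ⟨fun _ => hx, fun _ => rfl⟩

theorem BfsMem.append {ns : List ((Fin n × Fin q) × ℕ)} {mem mem' : ℕ → ℕ}
    (h : Y.BfsMem ns mem) {x : Fin n × Fin q} (hx : x ∉ ns.map Prod.fst) {d b : ℕ}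
    (hb : b = Y.recs + 5 * ns.length) (htab : mem' (Y.tab x) = b) (h0 : mem' b = x.1)
    (h1 : mem' (b + 1) = x.2) (h2 : mem' (b + 2) = d) (h3 : mem' (b + 3) = M 6)
    (h4 : mem' (b + 4) = 0) (hother : ∀ a < b, a ≠ Y.tab x → mem' a = mem a) :
    Y.BfsMem (ns ++ [(x, d)]) mem' := by
  have hrecs : M 6 + 1 + n ≤ Y.recs := by unfold recs; omega
  have htx := Y.tab_lt x
  have hsplit : ∀ i, i < (ns ++ [(x, d)]).length → i < ns.length ∨ i = ns.length := by
    intro i hi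
    rw [List.length_append, List.length_singleton] at hi
    omega
  refine ⟨⟨fun a ha => ?_, ?_, fun v => ?_, fun y => ?_, fun i hi => ?_, fun i hi => ?_,
    fun i hi => ?_⟩, fun i hi => ?_, fun i hi => ?_⟩
  · rw [hother a (by omega) (by omega), h.low a ha]
  · rw [hother _ (by omega) (by omega), h.nul]
  · rw [hother _ (by omega) (by omega), h.row]
  · by_cases hy : y = x
    · subst hy
      rw [htab, if_pos (by simp), Y.adr_append_self hx, hb]
    · have hty := Y.tab_lt y
      rw [hother _ (by omega) (fun e => hy (Y.tab_inj.1 e)), h.tab]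
      by_cases hm : y ∈ ns.map Prod.fst
      · rw [if_pos hm, if_pos (by simp only [List.map_append, List.mem_append]; exact .inl hm),
          Y.adr_append_of_mem hm]
      · rw [if_neg hm, if_neg]
        simp only [List.map_append, List.mem_append, List.map_cons, List.map_nil,
          List.mem_singleton]
        exact fun h => h.elim hm hy
  · rcases hsplit i hi with hi' | rfl
    · rw [hother _ (by omega) (by omega), h.vertex i hi', List.getElem_append_left hi']
    · rw [← hb, h0]; simp
  · rcases hsplit i hi with hi' | rfl
    · rw [hother _ (by omega) (by omega), h.state i hi', List.getElem_append_left hi']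
    · rw [← hb, h1]; simp
  · rcases hsplit i hi with hi' | rfl
    · rw [hother _ (by omega) (by omega), h.level i hi', List.getElem_append_left hi']
    · rw [← hb, h2]; simp
  · rcases hsplit i hi with hi' | rfl
    · rw [hother _ (by omega) (by omega), h.head i hi']
    · rw [← hb, h3]
  · rcases hsplit i hi with hi' | rfl
    · rw [hother _ (by omega) (by omega), h.mark i hi']
    · rw [← hb, h4]

variable (Y)

/-- The invariant of the breadth-first search on the memory and register `20`. -/
def BfsState (ns : List ((Fin n × Fin q) × ℕ)) (mem : ℕ → ℕ) (b : ℕ) : Prop :=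
  Y.BfsMem ns mem ∧ b = Y.recs + 5 * ns.length

variable {Y}

theorem runs_discover {ns : List ((Fin n × Fin q) × ℕ)} {d : ℕ} {x : Fin n × Fin q} {τ : State}
    (hI : Y.BfsState ns τ.mem (τ.reg 20)) (hg : Y.Glob τ) (h24 : τ.reg 24 = d)
    (h31 : τ.reg 31 = x.1) (h32 : τ.reg 32 = M 6 + 1 + n + x.1 * q) (h40 : τ.reg 40 = x.2) :
    Runs discover τ fun τ' => Y.BfsState (visit d ns x) τ'.mem (τ'.reg 20) ∧ Below 41 τ τ' ∧
      τ'.clock ≤ τ.clock + 9 := by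
  obtain ⟨hM, hb⟩ := hI
  have htab : M 6 + 1 + n + x.1 * q + x.2 = Y.tab x := rfl
  have htx := Y.tab_lt x
  unfold discover
  simp only [runs_seq, runs_load, runs_ite, runs_store, runs_add, runs_nop, Test.Holds, State.tick]
  simp only [ne_eq, Nat.reduceEqDiff, not_false_eq_true, OfNat.ofNat_ne_zero,
    OfNat.zero_ne_ofNat, OfNat.one_ne_ofNat, Function.update_of_ne, Function.update_self, h32, h40,
    htab, hg.r0, hg.r1, hg.r2, hg.r3, hg.r4, hg.r5, h31, h24, hM.tab_eq_zero_iff, Nat.add_zero,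
    below_update, Nat.reduceLeDiff, true_or, or_true, le_refl, below_self, true_and]
  refine ⟨fun hx => ⟨?_, trivial⟩, fun hx => ⟨?_, by omega⟩⟩
  · have hv : visit d ns x = ns ++ [(x, d)] := if_neg hx
    rw [hv]
    refine ⟨?_, by simp; omega⟩
    refine hM.append hx hb ?_ ?_ ?_ ?_ ?_ ?_ ?_ <;>
      simp only [Function.update_apply]
    · rw [if_neg (by omega), if_neg (by omega), if_neg (by omega), if_neg (by omega),
        if_neg (by omega), if_pos trivial]
    · rw [if_neg (by omega), if_neg (by omega), if_neg (by omega), if_neg (by omega),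
        if_pos trivial]
    · rw [if_neg (by omega), if_neg (by omega), if_neg (by omega), if_pos trivial]
    · rw [if_neg (by omega), if_neg (by omega), if_pos trivial]
    · rw [if_neg (by omega), if_pos trivial]
    · rw [if_pos trivial]
    · intro a ha hax
      rw [if_neg (by omega), if_neg (by omega), if_neg (by omega), if_neg (by omega),
        if_neg (by omega), if_neg hax]
  · have hv : visit d ns x = ns := if_pos (not_not.1 hx)
    rw [hv]
    exact ⟨hM, hb⟩

theorem bfsState_tables (g : List ((Fin n × Fin q) × ℕ)) (mem : ℕ → ℕ) (b : ℕ)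
    (h : Y.BfsState g mem b) : ∃ ns, Y.Tables ns mem := ⟨g, h.1.toTables⟩

theorem runs_forSucc_discover {ns : List ((Fin n × Fin q) × ℕ)} {d : ℕ} {e : Fin m} {p : Fin q}
    {σ : State} (hI : Y.BfsState ns σ.mem (σ.reg 20)) (hg : Y.Glob σ) (h24 : σ.reg 24 = d)
    (h30 : σ.reg 30 = e) (h25 : σ.reg 25 = M (M 13 + p)) :
    Runs (forSucc discover) σ fun τ =>
      Y.BfsState (((Y.succE e p).map fun p' => (D.tgt e, p')).foldl (visit d) ns) τ.mem
        (τ.reg 20) ∧ Below 31 σ τ ∧ τ.clock ≤ σ.clock + 19 * Y.work e p := by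
  simp only [List.foldl_map]
  refine Y.runs_forSucc Y.BfsState (fun ns p' => visit d ns (D.tgt e, p')) 9 e p ns σ
    bfsState_tables hg h30 h25 hI ?_
  intro p' _ g τ hI hg' hB h31 h32 h40
  exact runs_discover hI hg' ((hB.reg 24 (by norm_num) (by norm_num)).trans h24) h31 h32 h40

/-- The time to process a node in the breadth-first search, up to a constant. -/
def nodeWork (Y : Layout M D A s t) (x : Fin n × Fin q) : ℕ :=
  1 + ((Y.outL x.1).map fun e => Y.work e x.2).sum

theorem sum_nodeWork_le : ∑ x, Y.nodeWork x ≤ D.size * automatonSize A := by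
  have h1 : ∑ x : Fin n × Fin q, ((Y.outL x.1).map fun e => Y.work e x.2).sum =
      ∑ e, ∑ p, Y.work e p := by
    rw [Fintype.sum_prod_type_right, Finset.sum_comm (s := (Finset.univ : Finset (Fin m)))]
    refine Finset.sum_congr rfl fun p _ => ?_
    have : ∀ v, ((Y.outL v).map fun e => Y.work e p).sum =
        ∑ e, if D.src e = v then Y.work e p else 0 := by
      intro v
      rw [← Finset.sum_filter, ← List.sum_toFinset _ (Y.out_lists v).1]
      refine Finset.sum_congr ?_ fun _ _ => rfl
      ext e
      simp [(Y.out_lists v).2]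
    simp only [this]
    rw [Finset.sum_comm]
    simp
  have h2 := Y.sum_work_le
  have h3 : q ≤ automatonSize A := by rw [Y.automatonSize_eq]; omega
  unfold nodeWork
  rw [Finset.sum_add_distrib, h1]
  have h4 : n * q ≤ n * automatonSize A := Nat.mul_le_mul_left _ h3
  simp only [Database.size, Finset.sum_const, Finset.card_univ, Fintype.card_prod, Fintype.card_fin,
    smul_eq_mul, Nat.mul_one, Nat.add_mul] at h2 ⊢
  omega

theorem runs_processNode {ns : List ((Fin n × Fin q) × ℕ)} {i : ℕ} (hi : i < ns.length) {σ : State}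
    (hI : Y.BfsState ns σ.mem (σ.reg 20)) (hg : Y.Glob σ) (h21 : σ.reg 21 = Y.recs + 5 * i) :
    Runs (.seq (.load 22 21 0) <| .seq (.load 23 21 1) <| .seq (.load 24 21 2) <|
      .seq (.add 24 24 1) <| .seq (.load 25 19 23) <| .seq (.load 27 15 22) <|
      .seq (forList 27 (forSucc discover)) (.add 21 21 5)) σ fun τ =>
      Y.BfsState ((Y.succ ns[i].1).foldl (visit (ns[i].2 + 1)) ns) τ.mem (τ.reg 20) ∧
        Below 21 σ τ ∧ τ.reg 21 = Y.recs + 5 * (i + 1) ∧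
        τ.clock ≤ σ.clock + 22 * Y.nodeWork ns[i].1 := by
  set v := ns[i].1.1 with hv
  set p := ns[i].1.2 with hp
  set d := ns[i].2 with hd
  have hM := hI.1
  have e1 : σ.mem (M 13 + p) = M (M 13 + p) := hM.low _ (Y.rep.step p).1
  have e2 : σ.mem (M 8 + v) = M (M 8 + v) := hM.low _ (Y.rep.outgoing v).1
  simp only [runs_seq, runs_load, runs_add]
  simp only [ne_eq, Nat.reduceEqDiff, not_false_eq_true, OfNat.ofNat_ne_zero,
    OfNat.zero_ne_ofNat, OfNat.one_ne_ofNat, Function.update_of_ne, Function.update_self,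
    hg.r0, hg.r1, hg.r2, hg.r19, hg.r15, h21, Nat.add_zero, hM.vertex i hi, hM.state i hi,
    hM.level i hi, ← hv, ← hp, ← hd, e1, e2]
  have hsucc : Y.succ ns[i].1 = (Y.outL v).flatMap fun e => (Y.succE e p).map fun p' =>
      (D.tgt e, p') := rfl
  refine (runs_forList (free := M 6) (M := M) Y.BfsState
    (fun ns e => ((Y.succE e p).map fun p' => (D.tgt e, p')).foldl (visit (d + 1)) ns)
    (fun e => 19 * Y.work e p) (Y.outL v) ns _ (by norm_num) (fun _ _ _ h => h.1.low)
    (by simp [hg.r0]) (by simpa using Y.out_stored v) (by simpa using hI) ?_).mono ?_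
  · intro e _ g τ hI' hB h30
    have hg' : Y.Glob τ := by
      refine Glob.of_below (hg.of_reg ?_) hB (by norm_num)
      intro x hx
      simp [show x ≠ 22 by omega, show x ≠ 23 by omega, show x ≠ 24 by omega,
        show x ≠ 25 by omega, show x ≠ 27 by omega]
    exact runs_forSucc_discover hI' hg'
      ((hB.reg 24 (by norm_num) (by norm_num)).trans (by simp)) h30
      ((hB.reg 25 (by norm_num) (by norm_num)).trans (by simp))
  · rintro τ ⟨hI', hB, hc⟩
    have k21 : τ.reg 21 = Y.recs + 5 * i := by
      rw [hB.reg 21 (by norm_num) (by norm_num)]; simpa using h21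
    refine ⟨?_, ?_, ?_, ?_⟩
    · rw [hsucc, List.foldl_flatMap]
      simpa using hI'
    · rw [below_update (.inl le_rfl)]
      refine Below.trans (r' := 21) ?_ (r'' := 28) ⟨hB.reg, hB.buf, hB.log⟩ le_rfl (by norm_num)
      simp only [below_update, Nat.reduceLeDiff, true_or, le_refl, below_self]
    · simp [k21]; ring
    · dsimp only at hc ⊢
      have : ((Y.outL v).map fun e => 19 * Y.work e p + 3).sum ≤
          22 * ((Y.outL v).map fun e => Y.work e p).sum := by
        rw [← List.sum_map_mul_left]
        refine List.sum_le_sum fun e _ => ?_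
        unfold work
        omega
      unfold nodeWork
      change _ ≤ _ + 22 * (1 + ((Y.outL v).map fun e => Y.work e p).sum)
      omega

theorem runs_bfsLoop {ns : List ((Fin n × Fin q) × ℕ)} {i : ℕ} {σ : State}
    (hB : BfsInv Y.start Y.succ i ns) (hle : i ≤ ns.length)
    (hI : Y.BfsState ns σ.mem (σ.reg 20)) (hg : Y.Glob σ) (h21 : σ.reg 21 = Y.recs + 5 * i) :
    Runs (.loop (.lt 21 20) <| .seq (.load 22 21 0) <| .seq (.load 23 21 1) <|
      .seq (.load 24 21 2) <| .seq (.add 24 24 1) <| .seq (.load 25 19 23) <|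
      .seq (.load 27 15 22) <| .seq (forList 27 (forSucc discover)) (.add 21 21 5)) σ fun τ =>
      ∃ ns', ns <+: ns' ∧ BfsInv Y.start Y.succ ns'.length ns' ∧
        Y.BfsState ns' τ.mem (τ.reg 20) ∧ Below 21 σ τ ∧
        τ.clock ≤ σ.clock +
          ((ns'.map Prod.fst).drop i |>.map fun x => 22 * Y.nodeWork x + 1).sum + 1 := by
  have hcard : ns.length ≤ n * q := by
    have := hB.nodup.length_le_card
    simpa using this
  induction hw : n * q - i generalizing i ns σ with
  | zero =>
    have : i = ns.length := by omega
    subst this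
    refine runs_loop_false ?_ ⟨ns, List.prefix_rfl, hB, hI, ⟨fun _ _ _ => rfl, rfl, rfl⟩, ?_⟩
    · simp only [Test.Holds, h21, hI.2]; omega
    · simp [State.tick]
  | succ w ih =>
    rcases hle.lt_or_eq with hi | rfl
    · refine runs_loop_true ?_ ((runs_processNode hi (σ := σ.tick) hI ?_ h21).mono ?_)
      · simp only [Test.Holds, h21, hI.2]; omega
      · exact hg.of_reg fun _ _ => rfl
      · rintro τ ⟨hI', hB', h21', hc⟩
        obtain ⟨hinv, hpre⟩ := hB.process hi
        have hlen := hpre.length_le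
        refine (ih hinv (by omega) hI'
          ((hg.of_reg (τ := σ.tick) fun _ _ => rfl).of_below hB' (by norm_num)) h21'
          (by simpa using hinv.nodup.length_le_card) (by omega)).mono ?_
        rintro τ' ⟨ns', hpre', hinv', hI'', hB'', hc'⟩
        refine ⟨ns', hpre.trans hpre', hinv', hI'', ?_, ?_⟩
        · have hB3 := hB'.trans hB'' le_rfl le_rfl
          exact ⟨hB3.reg, hB3.buf, hB3.log⟩
        · have hi' : i < ns'.length := hi.trans_le (hpre.trans hpre').length_le
          have hdrop : (ns'.map Prod.fst).drop i =
              ns[i].1 :: (ns'.map Prod.fst).drop (i + 1) := by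
            rw [List.drop_eq_getElem_cons (by simpa using hi'), List.getElem_map]
            congr 2
            exact ((hpre.trans hpre').getElem hi).symm
          rw [hdrop, List.map_cons, List.sum_cons]
          simp only [State.tick] at hc
          omega
    · refine runs_loop_false ?_ ⟨ns, List.prefix_rfl, hB, hI, ⟨fun _ _ _ => rfl, rfl, rfl⟩, ?_⟩
      · simp only [Test.Holds, h21, hI.2]; omega
      · simp [State.tick]

/-- The time for a node is proportional to the number of its out-edges, their labels and the
transitions for these labels; added over all nodes, this is at most `|D| * |A|`. -/
theorem runs_bfs {σ : State} (hI : Y.BfsState [] σ.mem (σ.reg 20)) (hg : Y.Glob σ) :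
    Runs bfs σ fun τ => ∃ ns, BfsInv Y.start Y.succ ns.length ns ∧
        Y.BfsState ns τ.mem (τ.reg 20) ∧ Below 21 σ τ ∧
        τ.clock ≤ σ.clock + 12 * Y.startL.length + 23 * (D.size * automatonSize A) + 10 := by
  have hM := hI.1
  unfold bfs
  simp only [runs_seq, runs_load, runs_add, runs_set]
  simp only [ne_eq, Nat.reduceEqDiff, not_false_eq_true, OfNat.ofNat_ne_zero,
    OfNat.zero_ne_ofNat, OfNat.one_ne_ofNat, Function.update_of_ne, Function.update_self,
    hg.r6, hg.r7, hg.r13, Nat.add_zero, hM.row s]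
  refine (runs_forList (free := M 6) (M := M) Y.BfsState (fun ns p => visit 0 ns (s, p))
    (fun _ => 9) Y.startL [] _ (by norm_num) (fun _ _ _ h => h.1.low)
    (by simp [hg.r0]) (by simpa using Y.start_stored) (by simpa using hI) ?_).mono ?_
  · intro p _ g τ hI' hB h40
    have hg' : Y.Glob τ := by
      refine Glob.of_below (hg.of_reg ?_) hB (by norm_num)
      intro x hx
      simp [show x ≠ 21 by omega, show x ≠ 24 by omega, show x ≠ 31 by omega,
        show x ≠ 32 by omega, show x ≠ 37 by omega]
    exact runs_discover (x := (s, p)) hI' hg'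
      ((hB.reg 24 (by norm_num) (by norm_num)).trans (by simp))
      ((hB.reg 31 (by norm_num) (by norm_num)).trans (by simp))
      ((hB.reg 32 (by norm_num) (by norm_num)).trans (by simp)) h40
  · rintro τ ⟨hI', hB, hc⟩
    have hg' : Y.Glob τ := by
      refine Glob.of_below (hg.of_reg ?_) hB (by norm_num)
      intro x hx
      simp [show x ≠ 21 by omega, show x ≠ 24 by omega, show x ≠ 31 by omega,
        show x ≠ 32 by omega, show x ≠ 37 by omega]
    have hst := bfsInv_start Y.start Y.succ
    have e : Y.start.foldl (visit 0) [] = Y.startL.foldl (fun ns p => visit 0 ns (s, p)) [] := by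
      unfold start
      rw [List.foldl_map]
    rw [e] at hst
    refine (runs_bfsLoop hst (Nat.zero_le _) hI' hg' ?_).mono ?_
    · rw [hB.reg 21 (by norm_num) (by norm_num)]
      simpa using hI.2
    · rintro τ' ⟨ns, -, hinv, hI'', hB', hc'⟩
      refine ⟨ns, hinv, hI'', ?_, ?_⟩
      · have hB3 := hB.trans hB' (r := 21) (by norm_num) le_rfl
        refine Below.trans (r' := 21) ?_ hB3 le_rfl le_rfl
        simp only [below_update, Nat.reduceLeDiff, true_or, le_refl, below_self]
      · have h1 := (hinv.nodup.sum_map_le fun x => 22 * Y.nodeWork x + 1)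
        have h2 : ∑ x, (22 * Y.nodeWork x + 1) ≤ ∑ x, 23 * Y.nodeWork x := by
          refine Finset.sum_le_sum fun x _ => ?_
          unfold nodeWork
          omega
        rw [← Finset.mul_sum] at h2
        have h3 := Y.sum_nodeWork_le
        simp only [List.map_const', List.sum_replicate, smul_eq_mul, List.drop_zero] at hc hc'
        omega

end Layout

namespace Layout

variable {k n m q : ℕ} {M : ℕ → ℕ} {D : Database (Fin k) (Fin n) (Fin m)}
  {A : NFA (Fin k) (Fin q)} {s t : Fin n} (Y : Layout M D A s t)

/-! ### Setting up the registers and the table of the nodes -/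

theorem runs_setup : Runs setup (State.init M) fun τ =>
    Y.Glob τ ∧ τ.mem = M ∧ τ.buf = [] ∧ τ.log = [] ∧ τ.clock ≤ 27 := by
  unfold setup
  repeat first
    | refine runs_seq.2 ?_
    | refine runs_set.2 ?_
    | refine runs_load.2 ?_
    | refine runs_add.2 ?_
  refine ⟨?_, rfl, rfl, rfl, le_rfl⟩
  exact ⟨rfl, rfl, rfl, rfl, rfl, rfl, rfl, rfl, rfl, Y.rep.vertices, Y.rep.edges, Y.rep.states,
    Y.rep.source, Y.rep.target, rfl, rfl, rfl, rfl, rfl⟩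

theorem runs_rows {σ : State} (hg : Y.Glob σ) (hM : σ.mem = M) :
    Runs rows σ fun τ => Y.BfsState [] τ.mem (τ.reg 20) ∧ Below 21 σ τ ∧
      τ.clock ≤ σ.clock + 8 * n + 3 * (n * q) + 5 := by
  have hcount : ∀ (N : ℕ) (l : List (Fin N)) (g : ℕ), l.foldl (fun g _ => g + 1) g =
      g + l.length := by
    intro N l
    induction l with
    | nil => simp
    | cons a l ih => intro g; rw [List.foldl_cons, ih, List.length_cons]; omega
  unfold rows
  simp only [runs_seq, runs_add]
  refine (runs_forRange (n := n) (fun g mem b => mem = M ∧ b = M 6 + 1 + g) (fun g _ => g + 1)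
    (fun _ => 1) 0 _ (by norm_num) (by norm_num) (by simp [hg.r10]) (by simp [hM, hg.r6]) ?_).mono
    ?_
  · rintro x g τ - ⟨h1, h2⟩ - -
    rw [runs_add]
    refine ⟨⟨h1, by simp [h2]; omega⟩, ?_, le_rfl⟩
    simp only [below_update, or_true, below_self]
  rintro τ ⟨⟨h1, h2⟩, hB, hc⟩
  rw [hcount, List.length_finRange, Nat.zero_add] at h2
  have hg' : Y.Glob τ := by
    refine Glob.of_below (hg.of_reg ?_) hB (by norm_num)
    intro x hx
    simp [show x ≠ 20 by omega]
  have hBτ : Below 21 σ τ := by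
    refine Below.trans (r' := 21) ?_ hB le_rfl le_rfl
    simp only [below_update, or_true, below_self]
  refine (runs_forRange (n := n) (fun g mem b => (∀ a < M 6 + 1, mem a = M a) ∧
    (∀ a, M 6 + 1 + n ≤ a → mem a = 0) ∧ (∀ v < g, mem (M 6 + 1 + v) = M 6 + 1 + n + v * q) ∧
    b = M 6 + 1 + n + g * q) (fun g _ => g + 1) (fun _ => 3 * q + 3) 0 _ (by norm_num)
    (by norm_num) hg'.r10 ?_ ?_).mono ?_
  · refine ⟨fun a _ => by rw [h1], fun a ha => ?_, by simp, by simp [h2]⟩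
    rw [h1]
    exact Y.rep.unused a (by omega)
  · rintro x g τ' hgx ⟨k1, k2, k3, k4⟩ hB' h21
    have hgx' : g = x := by
      rw [hgx, hcount, List.length_take, List.length_finRange]
      omega
    have hg'' := hg'.of_below hB' (by norm_num)
    rw [runs_seq, runs_store]
    have hx := x.2
    refine (runs_forRange (i := 22) (N := 12) (n := q) (fun j mem b =>
      mem = Function.update τ'.mem (M 6 + 1 + x) (τ'.reg 20) ∧ b = τ'.reg 20 + j)
      (fun j _ => j + 1) (fun _ => 1) 0 _ (by norm_num) (by norm_num)
      (by simpa using hg''.r12) ⟨by rw [hg''.r6, h21], by simp⟩ ?_).mono ?_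
    · rintro y j τ'' - ⟨l1, l2⟩ - -
      rw [runs_add]
      refine ⟨⟨l1, by simp [l2]; omega⟩, ?_, le_rfl⟩
      simp only [below_update, or_true, below_self]
    · rintro τ'' ⟨⟨l1, l2⟩, hB'', hc''⟩
      rw [hcount, List.length_finRange, Nat.zero_add] at l2
      refine ⟨⟨fun a ha => ?_, fun a ha => ?_, fun v hv => ?_, ?_⟩, ?_, ?_⟩
      · rw [l1, Function.update_of_ne (by omega), k1 a ha]
      · rw [l1, Function.update_of_ne (by omega), k2 a ha]
      · rcases Nat.lt_succ_iff_lt_or_eq.1 hv with hv | rfl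
        · rw [l1, Function.update_of_ne (by omega), k3 v hv]
        · rw [l1, hgx', Function.update_self, k4, hgx']
      · rw [l2, k4]; ring
      · exact ⟨hB''.reg, hB''.buf, hB''.log⟩
      · simp only [List.map_const', List.sum_replicate, smul_eq_mul, List.length_finRange] at hc''
        omega
  · rintro τ' ⟨⟨k1, k2, k3, k4⟩, hB', hc'⟩
    rw [hcount, List.length_finRange, Nat.zero_add] at k3 k4
    refine ⟨⟨⟨⟨fun a ha => k1 a (by omega), ?_, fun v => k3 v v.2, fun x => ?_, ?_, ?_, ?_⟩, ?_,
      ?_⟩,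
      ?_⟩, hBτ.trans hB' le_rfl le_rfl, ?_⟩
    · rw [k1 _ (by omega), Y.rep.unused _ le_rfl]
    · rw [if_neg (by simp), k2 _ (by have := (Y.tab_lt x).1; omega)]
    · simp
    · simp
    · simp
    · simp
    · simp
    · rw [k4]; simp [recs]
    · simp only [List.map_const', List.sum_replicate, smul_eq_mul, List.length_finRange] at hc hc'
      nlinarith

/-! ### Building the lists of the last steps -/

/-- The memory `mem` holds, at the address `c`, the linked list of the last steps `l`. Its cells lie
at the addresses from `lo` to `hi - 1`. -/
def CellList (ns : List ((Fin n × Fin q) × ℕ)) (mem : ℕ → ℕ) (lo hi : ℕ) :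
    ℕ → List (Fin m × Fin q) → Prop
  | c, [] => c = M 6
  | c, z :: l => lo ≤ c ∧ c + 3 ≤ hi ∧ mem c = z.1 + 1 ∧ mem (c + 1) = Y.adr ns (D.src z.1, z.2) ∧
      CellList ns mem lo hi (mem (c + 2)) l

variable {Y}

theorem CellList.congr {ns : List ((Fin n × Fin q) × ℕ)} {mem mem' : ℕ → ℕ} {lo hi hi' c : ℕ}
    {l : List (Fin m × Fin q)} (h : Y.CellList ns mem lo hi c l) (hle : hi ≤ hi')
    (hm : ∀ a, lo ≤ a → a < hi → mem' a = mem a) : Y.CellList ns mem' lo hi' c l := by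
  induction l generalizing c with
  | nil => exact h
  | cons z l ih =>
    obtain ⟨h1, h2, h3, h4, h5⟩ := h
    refine ⟨h1, h2.trans hle, ?_, ?_, ?_⟩
    · rw [hm _ h1 (by omega), h3]
    · rw [hm _ (by omega) (by omega), h4]
    · rw [hm _ (by omega) (by omega)]
      exact ih h5

theorem adr_bounds {ns : List ((Fin n × Fin q) × ℕ)} {x : Fin n × Fin q}
    (h : x ∈ ns.map Prod.fst) : ∃ i, ∃ hi : i < ns.length, ns[i].1 = x ∧
      Y.adr ns x = Y.recs + 5 * i := by
  have h' := List.idxOf_lt_length_of_mem h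
  refine ⟨(ns.map Prod.fst).idxOf x, by simpa using h', ?_, rfl⟩
  have := List.getElem_idxOf h'
  rwa [List.getElem_map] at this

theorem Tables.level_adr {ns : List ((Fin n × Fin q) × ℕ)} {mem : ℕ → ℕ} (h : Y.Tables ns mem)
    (hB : BfsInv Y.start Y.succ ns.length ns) {x : Fin n × Fin q} (hx : x ∈ ns.map Prod.fst) :
    mem (Y.adr ns x + 2) = Y.lev x := by
  obtain ⟨i, hi, rfl, hadr⟩ := Y.adr_bounds hx
  rw [hadr, h.level i hi]
  exact hB.level_eq (List.getElem_mem hi)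

theorem adr_inj {ns : List ((Fin n × Fin q) × ℕ)} {x y : Fin n × Fin q}
    (hx : x ∈ ns.map Prod.fst) (h : Y.adr ns x = Y.adr ns y) : x = y := by
  unfold adr at h
  exact (List.idxOf_inj hx).1 (by omega)

variable (Y)

/-- The memory while the lists of the last steps are built from the links `tr`. -/
structure LinkMem (ns : List ((Fin n × Fin q) × ℕ)) (tr : List (Fin m × Fin q × Fin q))
    (mem : ℕ → ℕ) : Prop extends Y.Tables ns mem where
  mark : ∀ i < ns.length, mem (Y.recs + 5 * i + 4) = 0
  head : ∀ x ∈ ns.map Prod.fst, Y.CellList ns mem (Y.recs + 5 * ns.length)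
    (Y.recs + 5 * ns.length + 3 * tr.length) (mem (Y.adr ns x + 3)) (cellsOf D tr x)

/-- The invariant of the construction of the lists on the memory and register `20`. -/
def LinkState (ns : List ((Fin n × Fin q) × ℕ)) (tr : List (Fin m × Fin q × Fin q))
    (mem : ℕ → ℕ) (b : ℕ) : Prop :=
  Y.LinkMem ns tr mem ∧ b = Y.recs + 5 * ns.length + 3 * tr.length

variable {Y}

theorem BfsState.linkState {ns : List ((Fin n × Fin q) × ℕ)} {mem : ℕ → ℕ} {b : ℕ}
    (h : Y.BfsState ns mem b) : Y.LinkState ns [] mem b := by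
  refine ⟨⟨h.1.toTables, h.1.mark, fun x hx => ?_⟩, h.2⟩
  obtain ⟨i, hi, -, hadr⟩ := Y.adr_bounds hx
  rw [hadr]
  exact h.1.head i hi

theorem Tables.congr {ns : List ((Fin n × Fin q) × ℕ)} {mem mem' : ℕ → ℕ} (h : Y.Tables ns mem)
    (hlow : ∀ a < Y.recs, mem' a = mem a)
    (hrec : ∀ i < ns.length, ∀ j < 3, mem' (Y.recs + 5 * i + j) = mem (Y.recs + 5 * i + j)) :
    Y.Tables ns mem' := by
  have hrecs : M 6 + 1 + n ≤ Y.recs := by unfold recs; omega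
  refine ⟨fun a ha => ?_, ?_, fun v => ?_, fun x => ?_, fun i hi => ?_, fun i hi => ?_,
    fun i hi => ?_⟩
  · rw [hlow _ (by omega), h.low a ha]
  · rw [hlow _ (by omega), h.nul]
  · rw [hlow _ (by omega), h.row]
  · rw [hlow _ (Y.tab_lt x).2, h.tab]
  · exact (hrec i hi 0 (by norm_num)).trans (h.vertex i hi)
  · exact (hrec i hi 1 (by norm_num)).trans (h.state i hi)
  · exact (hrec i hi 2 (by norm_num)).trans (h.level i hi)

theorem LinkMem.append {ns : List ((Fin n × Fin q) × ℕ)} {tr : List (Fin m × Fin q × Fin q)}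
    {mem mem' : ℕ → ℕ} (h : Y.LinkMem ns tr mem) {e : Fin m} {p p' : Fin q}
    (hy : (D.tgt e, p') ∈ ns.map Prod.fst) {b : ℕ}
    (hb : b = Y.recs + 5 * ns.length + 3 * tr.length)
    (hhead : mem' (Y.adr ns (D.tgt e, p') + 3) = b) (h0 : mem' b = e + 1)
    (h1 : mem' (b + 1) = Y.adr ns (D.src e, p))
    (h2 : mem' (b + 2) = mem (Y.adr ns (D.tgt e, p') + 3))
    (hother : ∀ a < b, a ≠ Y.adr ns (D.tgt e, p') + 3 → mem' a = mem a) :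
    Y.LinkMem ns (tr ++ [(e, p, p')]) mem' := by
  obtain ⟨i, hi, hiy, hadr⟩ := Y.adr_bounds hy
  have hcell : ∀ {c l}, Y.CellList ns mem (Y.recs + 5 * ns.length)
      (Y.recs + 5 * ns.length + 3 * tr.length) c l → Y.CellList ns mem' (Y.recs + 5 * ns.length)
      (Y.recs + 5 * ns.length + 3 * (tr ++ [(e, p, p')]).length) c l := fun hc =>
    hc.congr (by simp) fun a ha ha' => hother a (by omega) (by omega)
  refine ⟨h.toTables.congr (fun a ha => hother a (by omega) (by omega))
    (fun j hj j' hj' => hother _ (by omega) (by omega)), fun j hj => ?_, fun x hx => ?_⟩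
  · rw [hother _ (by omega) (by omega), h.mark j hj]
  · rw [cellsOf_append]
    split_ifs with hxe
    · subst hxe
      rw [hhead]
      refine ⟨by omega, by simp; omega, h0, h1, ?_⟩
      rw [h2]
      exact hcell (h.head _ hy)
    · obtain ⟨j, hj, hjx, hadr'⟩ := Y.adr_bounds hx
      have hne : Y.adr ns x ≠ Y.adr ns (D.tgt e, p') := fun h' => hxe (Y.adr_inj hx h').symm
      rw [hother _ (by omega) (by omega)]
      exact hcell (h.head x hx)

theorem runs_link {ns : List ((Fin n × Fin q) × ℕ)} {tr : List (Fin m × Fin q × Fin q)}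
    {e : Fin m} {p p' : Fin q} {τ : State} (hB : BfsInv Y.start Y.succ ns.length ns)
    (hy : (D.tgt e, p') ∈ ns.map Prod.fst)
    (hI : Y.LinkState ns tr τ.mem (τ.reg 20)) (hg : Y.Glob τ)
    (h24 : τ.reg 24 = Y.lev (D.src e, p) + 1) (h26 : τ.reg 26 = Y.adr ns (D.src e, p))
    (h30 : τ.reg 30 = e) (h32 : τ.reg 32 = M 6 + 1 + n + D.tgt e * q) (h40 : τ.reg 40 = p') :
    Runs link τ fun τ' => Y.LinkState ns (Y.linkStep e p tr p') τ'.mem (τ'.reg 20) ∧ Below 41 τ τ' ∧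
      τ'.clock ≤ τ.clock + 10 := by
  obtain ⟨hM, hb⟩ := hI
  have htab : τ.mem (M 6 + 1 + n + D.tgt e * q + p') = Y.adr ns (D.tgt e, p') := by
    have := hM.tab (D.tgt e, p')
    rwa [if_pos hy] at this
  have hlev := hM.toTables.level_adr hB hy
  obtain ⟨i, hi, hiy, hadr⟩ := Y.adr_bounds hy
  have n0 : Y.adr ns (D.tgt e, p') + 3 ≠ τ.reg 20 := by omega
  have n1 : Y.adr ns (D.tgt e, p') + 3 ≠ τ.reg 20 + 1 := by omega
  have n2 : Y.adr ns (D.tgt e, p') + 3 ≠ τ.reg 20 + 2 := by omega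
  unfold link
  simp only [runs_seq, runs_load, runs_ite, runs_store, runs_add, runs_nop, Test.Holds, State.tick]
  simp only [ne_eq, Nat.reduceEqDiff, not_false_eq_true, OfNat.ofNat_ne_zero,
    OfNat.zero_ne_ofNat, OfNat.one_ne_ofNat, Function.update_of_ne, Function.update_self, h32, h40,
    hg.r0, hg.r1, hg.r2, hg.r3, htab, hlev, h24, h26, h30, Nat.add_zero, n0, n1, n2,
    below_update, Nat.reduceLeDiff, true_or, or_true, le_refl, below_self, true_and]
  unfold linkStep
  refine ⟨fun hx => ⟨?_, trivial⟩, fun hx => ⟨?_, by omega⟩⟩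
  · rw [if_pos hx]
    refine ⟨?_, by simp; omega⟩
    refine hM.append hy hb ?_ ?_ ?_ ?_ ?_ <;> simp only [Function.update_apply]
    · rw [if_pos trivial]
    · rw [if_neg (by omega), if_neg (by omega), if_neg (by omega), if_pos trivial]
    · rw [if_neg (by omega), if_neg (by omega), if_pos trivial]
    · rw [if_neg (by omega), if_pos trivial]
    · intro a ha hax
      rw [if_neg hax, if_neg (by omega), if_neg (by omega), if_neg (by omega)]
  · rw [if_neg hx]
    exact ⟨hM, hb⟩

theorem runs_linkAll {ns : List ((Fin n × Fin q) × ℕ)} {σ : State} (hq : 0 < q)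
    (hB : BfsInv Y.start Y.succ ns.length ns)
    (hI : Y.LinkState ns [] σ.mem (σ.reg 20)) (hg : Y.Glob σ) :
    Runs linkAll σ fun τ => Y.LinkState ns Y.allLinks τ.mem (τ.reg 20) ∧ Below 21 σ τ ∧
      τ.clock ≤ σ.clock + 40 * (D.size * automatonSize A) + 2 := by
  have hfold : ∀ {ι : Type} (l : List ι) (f : ι → List (Fin m × Fin q × Fin q)) tr,
      l.foldl (fun tr x => tr ++ f x) tr = tr ++ l.flatMap f := by
    intro ι l f
    induction l with
    | nil => simp
    | cons a l ih => intro tr; rw [List.foldl_cons, ih, List.flatMap_cons, List.append_assoc]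
  unfold linkAll
  refine (runs_forRange (n := m) (Y.LinkState ns)
    (fun tr e => tr ++ (List.finRange q).flatMap (Y.links e))
    (fun e => ((List.finRange q).map fun p => 26 * Y.work e p + 2).sum + 4) [] _ (by norm_num)
    (by norm_num) hg.r11 hI ?_).mono ?_
  · rintro e tr τ - hI' hBe h21
    have hM := hI'.1
    have hg' := hg.of_below hBe (by norm_num)
    have e1 : τ.mem (M 9 + e) = D.src e := by
      rw [hM.low _ (Y.rep.edge_src e).1, (Y.rep.edge_src e).2]
    simp only [runs_seq, runs_load]
    simp only [ne_eq, Nat.reduceEqDiff, not_false_eq_true, OfNat.ofNat_ne_zero,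
      OfNat.zero_ne_ofNat, OfNat.one_ne_ofNat, Function.update_of_ne, Function.update_self,
      hg'.r6, hg'.r16, h21, e1, hM.row]
    rw [← hfold]
    refine (runs_forRange (n := q) (Y.LinkState ns) (fun tr p => tr ++ Y.links e p)
      (fun p => 26 * Y.work e p) tr _ (by norm_num) (by norm_num) (by simp [hg'.r12])
      (by simpa using hI') ?_).mono ?_
    · rintro p tr' τ' - hI'' hBp h23
      have hM' := hI''.1
      have hg'' : Y.Glob τ' := by
        refine Glob.of_below (hg'.of_reg ?_) hBp (by norm_num)
        intro x hx
        simp [show x ≠ 22 by omega]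
      have k21 : τ'.reg 21 = e := by
        rw [hBp.reg 21 (by norm_num) (by norm_num)]; simpa using h21
      have k22 : τ'.reg 22 = M 6 + 1 + n + D.src e * q := by
        rw [hBp.reg 22 (by norm_num) (by norm_num)]; simp
      have htab : τ'.mem (M 6 + 1 + n + D.src e * q + p) = _ := hM'.tab (D.src e, p)
      have hpos := Y.adr_pos ns (D.src e, p)
      simp only [runs_seq, runs_load, runs_ite, runs_add, runs_nop, Test.Holds, State.tick]
      simp only [ne_eq, Nat.reduceEqDiff, not_false_eq_true, OfNat.ofNat_ne_zero,
        OfNat.zero_ne_ofNat, OfNat.one_ne_ofNat, Function.update_of_ne, Function.update_self,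
        hg''.r0, hg''.r2, hg''.r19, k21, k22, h23, htab, Nat.add_zero]
      by_cases hx : (D.src e, p) ∈ ns.map Prod.fst
      · have hd : Y.Disc (D.src e, p) := hB.mem_iff.1 hx
        have e2 : τ'.mem (M 13 + p) = M (M 13 + p) := hM'.low _ (Y.rep.step p).1
        simp only [if_pos hx, hM'.toTables.level_adr hB hx, e2]
        refine ⟨fun h => absurd h hpos.ne', fun _ => ?_⟩
        rw [← Y.foldl_linkStep e p hd]
        refine (Y.runs_forSucc (Y.LinkState ns) (Y.linkStep e p) 10 e p tr' _
          (fun g mem b h => ⟨ns, h.1.toTables⟩) ?_ (by simp) (by simp) (by simpa using hI'')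
          ?_).mono ?_
        · refine hg''.of_reg fun x hx => ?_
          simp [show x ≠ 24 by omega, show x ≠ 25 by omega, show x ≠ 26 by omega,
            show x ≠ 30 by omega]
        · intro p' hp' g τ₃ hI₃ hg₃ hB₃ h31 h32 h40
          refine runs_link hB (hB.mem_iff.2 (hd.succ (Y.mem_succ_of_mem_succE hp'))) hI₃ hg₃
            ?_ ?_ ?_
            h32 h40
          · rw [hB₃.reg 24 (by norm_num) (by norm_num)]; simp
          · rw [hB₃.reg 26 (by norm_num) (by norm_num)]; simp
          · rw [hB₃.reg 30 (by norm_num) (by norm_num)]; simp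
        · rintro τ₃ ⟨hI₃, hB₃, hc₃⟩
          refine ⟨hI₃, ?_, ?_⟩
          · refine Below.trans (r' := 24) ?_ hB₃ (by norm_num) (by norm_num)
            simp only [below_update, Nat.reduceLeDiff, true_or, le_refl, below_self]
          · dsimp only at hc₃
            have : 1 ≤ Y.work e p := by unfold work; omega
            omega
      · have hd : ¬ Y.Disc (D.src e, p) := fun h => hx (hB.mem_iff.2 h)
        simp only [if_neg hx]
        refine ⟨fun _ => ⟨?_, ?_, ?_⟩, fun h => absurd trivial h⟩
        · rw [links, if_neg hd, List.append_nil]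
          exact hI''
        · simp only [below_update, Nat.reduceLeDiff, Nat.reduceAdd, true_or, le_refl, below_self]
        · have : 1 ≤ Y.work e p := by unfold work; omega
          omega
    · rintro τ' ⟨hI'', hBp, hc⟩
      refine ⟨hI'', ?_, ?_⟩
      · refine Below.trans (r' := 22) ?_ hBp (by norm_num) (by norm_num)
        simp only [below_update, Nat.reduceLeDiff, true_or, le_refl, below_self]
      · dsimp only at hc ⊢
        omega
  · rintro τ ⟨hI', hBτ, hc⟩
    refine ⟨?_, hBτ, ?_⟩
    · rw [hfold, List.nil_append] at hI'
      exact hI'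
    · have h1 : ((List.finRange m).map fun e =>
          ((List.finRange q).map fun p => 26 * Y.work e p + 2).sum + 4 + 2).sum ≤
          ∑ e, ∑ p, 34 * Y.work e p := by
        rw [← Fin.sum_univ_def]
        refine Finset.sum_le_sum fun e _ => ?_
        rw [← Fin.sum_univ_def]
        have : ∑ p, 34 * Y.work e p = ∑ p, (26 * Y.work e p + 2) + ∑ p, (8 * Y.work e p - 2) := by
          rw [← Finset.sum_add_distrib]
          refine Finset.sum_congr rfl fun p _ => ?_
          unfold work
          omega
        rw [this]
        have h6 : ∑ _p : Fin q, 6 ≤ ∑ p, (8 * Y.work e p - 2) :=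
          Finset.sum_le_sum fun p _ => by unfold work; omega
        simp only [Finset.sum_const, Finset.card_univ, Fintype.card_fin, smul_eq_mul] at h6
        omega
      simp only [← Finset.mul_sum] at h1
      have h2 := Y.sum_work_le
      have h3 : (m + ∑ e, (D.lbl e).card) * automatonSize A ≤ D.size * automatonSize A := by
        refine Nat.mul_le_mul_right _ ?_
        simp [Database.size]
      omega

end Layout

namespace RAM

/-- Sequencing of programs. -/
local infixr:60 " ;; " => Prog.seq

/-! ### The program: enumeration -/

/-- Replace the content of register `20` by `l + 1` if the level `l` of the node at `t` with the
state in register `40` is smaller; the content `0` stands for infinity. -/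
def minStep : Prog :=
  .load 41 32 40 ;; .ite (.eq 41 0) .nop
    (.load 42 41 2 ;; .add 42 42 1 ;; .ite (.eq 20 0) (.add 20 42 0)
      (.ite (.lt 42 20) (.add 20 42 0) .nop))

/-- Compute in register `22` the successor of the minimal level of an accepting node at `t`, or `0`
if there is no such node. -/
def findLevel : Prog :=
  .add 21 20 0 ;; .set 20 0 ;; .load 32 6 14 ;; .add 37 8 0 ;; forList 37 minStep ;;
    .add 22 20 0 ;; .add 20 21 0

/-- Append the list of the last steps of the node at `t` with the state in register `40` to the
frame if the node has the level in register `22`. -/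
def rootStep : Prog :=
  .load 41 32 40 ;; .ite (.eq 41 0) .nop
    (.load 42 41 2 ;; .ite (.eq 42 22) (.load 43 41 3 ;; .store 20 0 43 ;; .add 20 20 1) .nop)

/-- Create the lowest frame of the stack. A frame consists of the address of the frame below (`0`
for the lowest frame), an edge (unused in the lowest frame), and addresses of cells. Register `20`
contains the end of the topmost frame, register `23` its address, register `22` the number of edges
that are missing in the walk given by the stack, and register `24` the latest time stamp. -/
def rootFrame : Prog :=
  .sub 22 22 1 ;; .add 23 20 0 ;; .store 23 0 0 ;; .add 20 20 2 ;; .set 24 0 ;; .load 32 6 14 ;;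
    .add 37 8 0 ;; forList 37 rootStep

/-- Remove the topmost frame. -/
def pop : Prog := .add 20 23 0 ;; .load 23 23 0 ;; .add 22 22 1

/-- Deliver the walk that is given by the stack. -/
def output : Prog :=
  .write 13 ;; .add 42 23 0 ;; .load 43 42 0 ;;
    .loop (.lt 0 43)
      (.load 44 42 1 ;; .write 44 ;; .load 45 17 44 ;; .write 45 ;; .add 42 43 0 ;;
        .load 43 42 0) ;;
    .emit

/-- Compute in register `41` the maximal key of the cells in the topmost frame. The key of a cell is
the successor of its edge, and the cell `M 6`, which ends the lists, has the key `0`. -/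
def scan : Prog :=
  .set 41 0 ;; .add 42 23 2 ;;
    .loop (.lt 42 20)
      (.load 43 42 0 ;; .load 44 43 0 ;; .ite (.lt 41 44) (.add 41 44 0) .nop ;; .add 42 42 1)

/-- Append the list of the record in register `45` to the frame that is being built and ends at the
address in register `49`, unless the record carries the current time stamp. -/
def enter : Prog :=
  .load 46 45 4 ;; .ite (.eq 46 24) .nop
    (.store 45 4 24 ;; .load 47 45 3 ;; .store 49 0 47 ;; .add 49 49 1)

/-- Advance the list in register `43` beyond the cells with the key in register `41`, and enter
their records into the frame that is being built. -/
def advance : Prog :=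
  .loop (.eq 44 41) (.load 45 43 1 ;; enter ;; .load 43 43 2 ;; .load 44 43 0)

/-- Prefix the walk by the edge with the key in register `41`: put the frame of the predecessors
along this edge on the stack. -/
def push : Prog :=
  .sub 48 41 1 ;; .store 20 0 23 ;; .store 20 1 48 ;; .add 49 20 2 ;; .add 24 24 1 ;;
    .add 42 23 2 ;;
    .loop (.lt 42 20)
      (.load 43 42 0 ;; .load 44 43 0 ;; advance ;; .store 42 0 43 ;; .add 42 42 1) ;;
    .add 23 20 0 ;; .add 20 49 0 ;; .sub 22 22 1

/-- One step of the depth-first search. -/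
def searchStep : Prog :=
  .ite (.eq 22 0) (output ;; pop) (scan ;; .ite (.eq 41 0) pop push)

/-- The whole program. -/
def enumerate : Prog :=
  setup ;; .ite (.eq 12 0) .nop
    (rows ;; bfs ;; linkAll ;; findLevel ;; .ite (.eq 22 0) .nop
      (rootFrame ;; .loop (.lt 0 23) searchStep))

end RAM

namespace Layout

variable {k n m q : ℕ} {M : ℕ → ℕ} {D : Database (Fin k) (Fin n) (Fin m)}
  {A : NFA (Fin k) (Fin q)} {s t : Fin n} (Y : Layout M D A s t)

/-! ### The minimal level of an accepting node at the target -/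

open Classical in
/-- The ghost state of the computation of the minimal level: `0` stands for infinity. -/
noncomputable def minLevel (g : ℕ) (p : Fin q) : ℕ :=
  if Y.Disc (t, p) then
    if g = 0 then Y.lev (t, p) + 1 else if Y.lev (t, p) + 1 < g then Y.lev (t, p) + 1 else g
  else g

/-- The fold computes the successor of the minimal level, or `0` if no node has been reached. -/
theorem foldl_minLevel (l : List (Fin q)) :
    (l.foldl Y.minLevel 0 = 0 ∧ ∀ p ∈ l, ¬ Y.Disc (t, p)) ∨
      ∃ p ∈ l, Y.Disc (t, p) ∧ l.foldl Y.minLevel 0 = Y.lev (t, p) + 1 ∧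
        ∀ p' ∈ l, Y.Disc (t, p') → Y.lev (t, p) ≤ Y.lev (t, p') := by
  induction l using List.reverseRecOn with
  | nil => simp
  | append_singleton l a ih =>
    rw [List.foldl_append, List.foldl_cons, List.foldl_nil]
    generalize l.foldl Y.minLevel 0 = g at ih
    by_cases ha : Y.Disc (t, a)
    · right
      rcases ih with ⟨rfl, h⟩ | ⟨p, hp, hd, rfl, hmin⟩
      · refine ⟨a, by simp, ha, by simp [minLevel, ha], fun p' hp' hd' => ?_⟩
        rcases List.mem_append.1 hp' with hp' | hp'
        · exact absurd hd' (h p' hp')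
        · rw [List.mem_singleton.1 hp']
      · by_cases hlt : Y.lev (t, a) < Y.lev (t, p)
        · refine ⟨a, by simp, ha, by simp [minLevel, ha, hlt], fun p' hp' hd' => ?_⟩
          rcases List.mem_append.1 hp' with hp' | hp'
          · exact hlt.le.trans (hmin p' hp' hd')
          · rw [List.mem_singleton.1 hp']
        · refine ⟨p, by simp [hp], hd, by simp [minLevel, ha, hlt], fun p' hp' hd' => ?_⟩
          rcases List.mem_append.1 hp' with hp' | hp'
          · exact hmin p' hp' hd'
          · rw [List.mem_singleton.1 hp']; omega
    · have hg : Y.minLevel g a = g := if_neg ha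
      rw [hg]
      refine ih.imp (fun ⟨h0, h⟩ => ⟨h0, fun p hp => ?_⟩)
        fun ⟨p, hp, hd, h0, hmin⟩ => ⟨p, by simp [hp], hd, h0, fun p' hp' hd' => ?_⟩
      · rcases List.mem_append.1 hp with hp | hp
        · exact h p hp
        · rwa [List.mem_singleton.1 hp]
      · rcases List.mem_append.1 hp' with hp' | hp'
        · exact hmin p' hp' hd'
        · rw [List.mem_singleton.1 hp'] at hd'
          exact absurd hd' ha

variable {Y}

theorem runs_findLevel {ns : List ((Fin n × Fin q) × ℕ)} {σ : State}
    (hB : BfsInv Y.start Y.succ ns.length ns) (hM : Y.Tables ns σ.mem) (hg : Y.Glob σ) :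
    Runs findLevel σ fun τ => τ.reg 22 = Y.acceptL.foldl Y.minLevel 0 ∧ τ.mem = σ.mem ∧
      τ.reg 20 = σ.reg 20 ∧ Below 21 σ τ ∧
      τ.clock ≤ σ.clock + 10 * Y.acceptL.length + 9 := by
  unfold findLevel
  simp only [runs_seq, runs_load, runs_add, runs_set]
  simp only [ne_eq, Nat.reduceEqDiff, not_false_eq_true, OfNat.ofNat_ne_zero,
    OfNat.zero_ne_ofNat, OfNat.one_ne_ofNat, Function.update_of_ne, Function.update_self,
    hg.r6, hg.r8, hg.r14, hM.row, Nat.add_zero]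
  refine (runs_forList (free := M 6) (M := M) (fun g mem b => mem = σ.mem ∧ b = g)
    Y.minLevel (fun _ => 7) Y.acceptL 0 _ (by norm_num) (fun _ _ _ h => by rw [h.1]; exact hM.low)
    (by simp [hg.r0]) (by simpa using Y.accept_stored) (by simp) ?_).mono ?_
  · rintro p - g τ ⟨h1, h2⟩ hB' h40
    have hg' : Y.Glob τ := by
      refine Glob.of_below (hg.of_reg ?_) hB' (by norm_num)
      intro x hx
      simp [show x ≠ 20 by omega, show x ≠ 21 by omega, show x ≠ 32 by omega,
        show x ≠ 37 by omega]
    have k32 : τ.reg 32 = M 6 + 1 + n + t * q := by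
      rw [hB'.reg 32 (by norm_num) (by norm_num)]; simp
    have htab : σ.mem (M 6 + 1 + n + t * q + p) = _ := hM.tab (t, p)
    have hpos := Y.adr_pos ns (t, p)
    unfold minStep
    simp only [runs_seq, runs_load, runs_ite, runs_add, runs_nop, Test.Holds, State.tick]
    simp only [ne_eq, Nat.reduceEqDiff, not_false_eq_true, OfNat.ofNat_ne_zero,
      OfNat.zero_ne_ofNat, OfNat.one_ne_ofNat, Function.update_of_ne, Function.update_self,
      hg'.r0, hg'.r2, k32, h40, h1, h2, htab, Nat.add_zero]
    unfold minLevel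
    by_cases hx : (t, p) ∈ ns.map Prod.fst
    · have hd : Y.Disc (t, p) := hB.mem_iff.1 hx
      simp only [if_pos hx, if_pos hd, hM.level_adr hB hx]
      refine ⟨fun h => absurd h hpos.ne', fun _ => ⟨fun h => ?_, fun h => ⟨fun h' => ?_,
        fun h' => ?_⟩⟩⟩
      · rw [if_pos h]
        refine ⟨by simp, ?_, by omega⟩
        simp only [below_update, Nat.reduceLeDiff, Nat.reduceAdd, true_or, or_true, le_refl]
        exact ⟨fun _ _ _ => rfl, rfl, rfl⟩
      · rw [if_neg h, if_pos h']
        refine ⟨by simp, ?_, by omega⟩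
        simp only [below_update, Nat.reduceLeDiff, Nat.reduceAdd, true_or, or_true, le_refl]
        exact ⟨fun _ _ _ => rfl, rfl, rfl⟩
      · rw [if_neg h, if_neg h']
        refine ⟨by simp, ?_, by omega⟩
        simp only [below_update, Nat.reduceLeDiff, Nat.reduceAdd, true_or, or_true, le_refl]
        exact ⟨fun _ _ _ => rfl, rfl, rfl⟩
    · have hd : ¬ Y.Disc (t, p) := fun h => hx (hB.mem_iff.2 h)
      simp only [if_neg hx, if_neg hd]
      refine ⟨fun _ => ⟨by simp, ?_, by omega⟩, fun h => absurd trivial h⟩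
      simp only [below_update, Nat.reduceLeDiff, Nat.reduceAdd, true_or, or_true, le_refl]
      exact ⟨fun _ _ _ => rfl, rfl, rfl⟩
  · rintro τ ⟨⟨h1, h2⟩, hB', hc⟩
    have k21 : τ.reg 21 = σ.reg 20 := by
      rw [hB'.reg 21 (by norm_num) (by norm_num)]; simp
    refine ⟨by simpa using h2, h1, by simp [k21], ?_, ?_⟩
    · simp only [below_update, Nat.reduceLeDiff, true_or, or_true, le_refl]
      refine Below.trans (r' := 21) ?_ (r'' := 38) ⟨hB'.reg, hB'.buf, hB'.log⟩ le_rfl (by norm_num)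
      simp only [below_update, Nat.reduceLeDiff, true_or, or_true, le_refl, below_self]
    · simp only [List.map_const', List.sum_replicate, smul_eq_mul] at hc ⊢
      omega

/-! ### The stack of frames -/

variable (Y)

/-- The address of the first cell of a list. -/
def cellBase (ns : List ((Fin n × Fin q) × ℕ)) : ℕ := Y.recs + 5 * ns.length

/-- The address of the stack. -/
noncomputable def stackBase (ns : List ((Fin n × Fin q) × ℕ)) : ℕ :=
  Y.recs + 5 * ns.length + 3 * Y.allLinks.length

/-- The linked list of the last steps `l` at the address `c`. -/
def Cells (ns : List ((Fin n × Fin q) × ℕ)) (mem : ℕ → ℕ) (c : ℕ) (l : List (Fin m × Fin q)) :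
    Prop := Y.CellList ns mem (Y.cellBase ns) (Y.stackBase ns) c l

/-- The part of the memory below the stack during the enumeration. No time stamp is larger
than `stamp`. -/
structure EnumMem (ns : List ((Fin n × Fin q) × ℕ)) (stamp : ℕ) (mem : ℕ → ℕ) : Prop where
  low : ∀ a < M 6, mem a = M a
  nul : mem (M 6) = 0
  mark : ∀ x ∈ ns.map Prod.fst, mem (Y.adr ns x + 4) ≤ stamp
  head : ∀ x ∈ ns.map Prod.fst, Y.Cells ns mem (mem (Y.adr ns x + 3)) (Y.cells x)

/-- The frame at the address `f` holds the lists `rems`. -/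
def Frame (ns : List ((Fin n × Fin q) × ℕ)) (mem : ℕ → ℕ) (f : ℕ)
    (rems : List (List (Fin m × Fin q))) : Prop :=
  ∀ i (h : i < rems.length), Y.Cells ns mem (mem (f + 2 + i)) rems[i]

variable {Y}

theorem Cells.congr {ns : List ((Fin n × Fin q) × ℕ)} {mem mem' : ℕ → ℕ} {c : ℕ}
    {l : List (Fin m × Fin q)} (h : Y.Cells ns mem c l)
    (hm : ∀ a, Y.cellBase ns ≤ a → a < Y.stackBase ns → mem' a = mem a) : Y.Cells ns mem' c l :=
  CellList.congr h le_rfl hm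

theorem recs_lt : M 6 < Y.recs := by unfold recs; omega

theorem adr_lt {ns : List ((Fin n × Fin q) × ℕ)} {x : Fin n × Fin q} (h : x ∈ ns.map Prod.fst) :
    M 6 < Y.adr ns x ∧ Y.adr ns x + 4 < Y.cellBase ns := by
  obtain ⟨i, hi, -, hadr⟩ := Y.adr_bounds h
  have := Y.recs_lt
  unfold cellBase
  omega

theorem cellBase_le (ns : List ((Fin n × Fin q) × ℕ)) : Y.cellBase ns ≤ Y.stackBase ns := by
  unfold cellBase stackBase
  omega

theorem EnumMem.congr {ns : List ((Fin n × Fin q) × ℕ)} {stamp : ℕ} {mem mem' : ℕ → ℕ}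
    (h : Y.EnumMem ns stamp mem) (hm : ∀ a < Y.stackBase ns, mem' a = mem a) :
    Y.EnumMem ns stamp mem' := by
  have h1 := Y.recs_lt
  have h2 := Y.cellBase_le ns
  refine ⟨fun a ha => ?_, ?_, fun x hx => ?_, fun x hx => ?_⟩
  · rw [hm a (by unfold stackBase; omega), h.low a ha]
  · rw [hm _ (by unfold stackBase; omega), h.nul]
  · have := Y.adr_lt hx
    rw [hm _ (by omega)]
    exact h.mark x hx
  · have := Y.adr_lt hx
    rw [hm _ (by omega)]
    exact (h.head x hx).congr fun a _ => hm a

theorem LinkState.enumMem {ns : List ((Fin n × Fin q) × ℕ)} {mem : ℕ → ℕ} {b : ℕ}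
    (h : Y.LinkState ns Y.allLinks mem b) : Y.EnumMem ns 0 mem := by
  refine ⟨h.1.low, h.1.nul, fun x hx => ?_, h.1.head⟩
  obtain ⟨i, hi, -, hadr⟩ := Y.adr_bounds hx
  rw [hadr, h.1.mark i hi]

open Classical in
theorem runs_rootFrame {ns : List ((Fin n × Fin q) × ℕ)} {σ : State} {lam : ℕ}
    (hB : BfsInv Y.start Y.succ ns.length ns) (hI : Y.LinkState ns Y.allLinks σ.mem (σ.reg 20))
    (hg : Y.Glob σ) (h22 : σ.reg 22 = lam + 1) :
    Runs rootFrame σ fun τ => ∃ ps : List (Fin q),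
      ps = Y.acceptL.filter (fun p => Y.Disc (t, p) ∧ Y.lev (t, p) = lam) ∧ Y.Glob τ ∧
      Y.EnumMem ns 0 τ.mem ∧ τ.mem (Y.stackBase ns) = 0 ∧
      Y.Frame ns τ.mem (Y.stackBase ns) (ps.map fun p => Y.cells (t, p)) ∧
      τ.reg 20 = Y.stackBase ns + 2 + ps.length ∧ τ.reg 22 = lam ∧ τ.reg 23 = Y.stackBase ns ∧
      τ.reg 24 = 0 ∧ τ.buf = σ.buf ∧ τ.log = σ.log ∧
      τ.clock ≤ σ.clock + 10 * Y.acceptL.length + 10 := by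
  have hM := hI.1.toTables
  have hE := hI.enumMem
  have hbase : σ.reg 20 = Y.stackBase ns := hI.2
  have hlt : M 6 + 1 + n ≤ Y.stackBase ns := by unfold stackBase recs; omega
  have hrow := hM.row t
  have ht := t.2
  have hrow' : Function.update σ.mem (Y.stackBase ns) 0 (M 6 + 1 + t) = M 6 + 1 + n + t * q := by
    rw [Function.update_of_ne (by omega), hrow]
  unfold rootFrame
  simp only [runs_seq, runs_load, runs_add, runs_set, runs_sub, runs_store]
  simp only [ne_eq, Nat.reduceEqDiff, not_false_eq_true, OfNat.ofNat_ne_zero,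
    OfNat.zero_ne_ofNat, OfNat.one_ne_ofNat, Function.update_of_ne, Function.update_self,
    hg.r0, hg.r6, hg.r8, hg.r14, Nat.add_zero, hbase, hrow', h22, Nat.add_sub_cancel]
  -- the frame agrees with the original memory below the stack, which holds the table of the nodes
  refine (runs_forList (free := M 6) (M := M) (fun (ps : List (Fin q)) mem b =>
    (∀ a < Y.stackBase ns, mem a = σ.mem a) ∧ mem (Y.stackBase ns) = 0 ∧
      Y.Frame ns mem (Y.stackBase ns) (ps.map fun p => Y.cells (t, p)) ∧
      b = Y.stackBase ns + 2 + ps.length)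
    (fun ps p => if Y.Disc (t, p) ∧ Y.lev (t, p) = lam then ps ++ [p] else ps)
    (fun _ => 7) Y.acceptL [] _ (by norm_num)
    (fun _ _ _ h a ha => by rw [h.1 a (by omega), hM.low a ha])
    (by simp [hg.r0]) (by simpa using Y.accept_stored) ?_ ?_).mono ?_
  · refine ⟨fun a ha => Function.update_of_ne (by omega) _ _, by simp, ?_, by simp⟩
    intro i hi
    simp at hi
  · rintro p - ps τ ⟨h1, h2, h3, h4⟩ hB' h40
    have hg' : Y.Glob τ := by
      refine Glob.of_below (hg.of_reg ?_) hB' (by norm_num)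
      intro x hx
      simp [show x ≠ 20 by omega, show x ≠ 22 by omega, show x ≠ 32 by omega,
        show x ≠ 37 by omega, show x ≠ 23 by omega, show x ≠ 24 by omega]
    have k32 : τ.reg 32 = M 6 + 1 + n + t * q := by
      rw [hB'.reg 32 (by norm_num) (by norm_num)]; simp
    have k22 : τ.reg 22 = lam := by
      rw [hB'.reg 22 (by norm_num) (by norm_num)]; simp
    have htx := (Y.tab_lt (t, p)).2
    have hrb : Y.recs ≤ Y.stackBase ns := by unfold stackBase; omega
    have htab : τ.mem (M 6 + 1 + n + t * q + p) = _ :=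
      (h1 _ (show Y.tab (t, p) < _ by omega)).trans (hM.tab (t, p))
    have hpos := Y.adr_pos ns (t, p)
    unfold rootStep
    simp only [runs_seq, runs_load, runs_ite, runs_add, runs_nop, runs_store, Test.Holds,
      State.tick]
    simp only [ne_eq, Nat.reduceEqDiff, not_false_eq_true, OfNat.ofNat_ne_zero,
      OfNat.zero_ne_ofNat, OfNat.one_ne_ofNat, Function.update_of_ne, Function.update_self,
      hg'.r0, hg'.r2, hg'.r3, k32, k22, h40, htab, Nat.add_zero]
    by_cases hx : (t, p) ∈ ns.map Prod.fst
    · have hd : Y.Disc (t, p) := hB.mem_iff.1 hx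
      have hadr := Y.adr_lt hx
      have hcb := Y.cellBase_le ns
      have hlev : τ.mem (Y.adr ns (t, p) + 2) = Y.lev (t, p) := by
        rw [h1 _ (by omega), hM.level_adr hB hx]
      simp only [if_pos hx, hd, hlev, true_and]
      refine ⟨fun h => absurd h hpos.ne', fun _ => ⟨fun h => ?_, fun h => ?_⟩⟩
      · rw [if_pos h]
        refine ⟨⟨fun a ha => ?_, ?_, ?_, ?_⟩, ?_, by omega⟩
        · rw [Function.update_of_ne (by omega), h1 a ha]
        · rw [Function.update_of_ne (by omega), h2]
        · intro i hi
          simp only [List.map_append, List.length_append, List.length_map, List.map_cons,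
            List.map_nil, List.length_singleton] at hi
          rcases Nat.lt_succ_iff_lt_or_eq.1 hi with hi | rfl
          · rw [Function.update_of_ne (by omega)]
            have h5 := h3 i (by simpa using hi)
            simp only [List.getElem_map, List.map_append, List.getElem_append_left,
              List.length_map, hi] at h5 ⊢
            exact h5.congr fun a _ ha => Function.update_of_ne (by omega) _ _
          · rw [← h4, Function.update_self]
            simp only [List.map_append, List.map_cons, List.map_nil, List.getElem_append_right,
              List.length_map, le_refl, Nat.sub_self, List.getElem_cons_zero]
            rw [h1 _ (by omega)]
            refine (hE.head _ hx).congr fun a _ ha => ?_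
            rw [Function.update_of_ne (by omega), h1 a ha]
        · simp [h4]; omega
        · simp only [below_update, Nat.reduceLeDiff, Nat.reduceAdd, true_or, or_true, le_refl]
          exact ⟨fun _ _ _ => rfl, rfl, rfl⟩
      · rw [if_neg h]
        refine ⟨⟨h1, h2, h3, by simpa using h4⟩, ?_, by omega⟩
        simp only [below_update, Nat.reduceLeDiff, Nat.reduceAdd, true_or, or_true, le_refl]
        exact ⟨fun _ _ _ => rfl, rfl, rfl⟩
    · have hd : ¬ Y.Disc (t, p) := fun h => hx (hB.mem_iff.2 h)
      simp only [if_neg hx, hd, false_and, if_false]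
      refine ⟨fun _ => ⟨⟨h1, h2, h3, by simpa using h4⟩, ?_, by omega⟩, fun h => absurd trivial h⟩
      simp only [below_update, Nat.reduceLeDiff, Nat.reduceAdd, true_or, or_true, le_refl]
      exact ⟨fun _ _ _ => rfl, rfl, rfl⟩
  · have hfold : ∀ (l ps : List (Fin q)), l.foldl (fun ps p =>
        if Y.Disc (t, p) ∧ Y.lev (t, p) = lam then ps ++ [p] else ps) ps =
        ps ++ l.filter (fun p => Y.Disc (t, p) ∧ Y.lev (t, p) = lam) := by
      intro l
      induction l with
      | nil => simp
      | cons a l ih =>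
        intro ps
        rw [List.foldl_cons, ih]
        split_ifs with h <;> simp [h]
    rintro τ ⟨⟨h1, h2, h3, h4⟩, hB', hc⟩
    rw [hfold, List.nil_append] at h3 h4
    refine ⟨_, rfl, ?_, hE.congr h1, h2, h3, h4, ?_, ?_, ?_, ?_, ?_, ?_⟩
    · refine Glob.of_below (hg.of_reg ?_) hB' (by norm_num)
      intro x hx
      simp [show x ≠ 20 by omega, show x ≠ 22 by omega, show x ≠ 32 by omega,
        show x ≠ 37 by omega, show x ≠ 23 by omega, show x ≠ 24 by omega]
    · rw [hB'.reg 22 (by norm_num) (by norm_num)]; simp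
    · rw [hB'.reg 23 (by norm_num) (by norm_num)]; simp
    · rw [hB'.reg 24 (by norm_num) (by norm_num)]; simp
    · exact hB'.buf
    · exact hB'.log
    · simp only [List.map_const', List.sum_replicate, smul_eq_mul] at hc
      omega

end Layout

namespace RAM

/-- `τ` agrees with `σ` on the registers below `r` and on the output. -/
structure Keep (r : ℕ) (σ τ : State) : Prop where
  reg : ∀ x < r, τ.reg x = σ.reg x
  buf : τ.buf = σ.buf
  log : τ.log = σ.log

theorem Keep.trans {r : ℕ} {σ τ υ : State} (h : Keep r σ τ) (h' : Keep r τ υ) : Keep r σ υ :=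
  ⟨fun x hx => (h'.reg x hx).trans (h.reg x hx), h'.buf.trans h.buf, h'.log.trans h.log⟩

theorem keep_update {r y v c : ℕ} {σ : State} {reg mem : ℕ → ℕ} {bu : List ℕ}
    {lo : List (List ℕ × ℕ)} (h : r ≤ y) :
    Keep r σ ⟨Function.update reg y v, mem, c, bu, lo⟩ ↔ Keep r σ ⟨reg, mem, c, bu, lo⟩ := by
  constructor
  · rintro ⟨h₁, h₂, h₃⟩
    refine ⟨fun x hx => ?_, h₂, h₃⟩
    rw [← h₁ x hx]
    exact (Function.update_of_ne (by omega) _ _).symm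
  · rintro ⟨h₁, h₂, h₃⟩
    refine ⟨fun x hx => ?_, h₂, h₃⟩
    rw [← h₁ x hx]
    exact Function.update_of_ne (by omega) _ _

theorem keep_self {r c : ℕ} {σ : State} {mem : ℕ → ℕ} :
    Keep r σ ⟨σ.reg, mem, c, σ.buf, σ.log⟩ := ⟨fun _ _ => rfl, rfl, rfl⟩

end RAM

namespace Layout

variable {k n m q : ℕ} {M : ℕ → ℕ} {D : Database (Fin k) (Fin n) (Fin m)}
  {A : NFA (Fin k) (Fin q)} {s t : Fin n} {Y : Layout M D A s t}
  {ns : List ((Fin n × Fin q) × ℕ)}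

theorem Glob.of_keep {σ τ : State} (h : Y.Glob σ) {r : ℕ} (hr : Keep r σ τ) (h20 : 20 ≤ r) :
    Y.Glob τ := h.of_reg fun x hx => hr.reg x (by omega)

/-! ### The maximal key of a frame -/

/-- The key of the first cell of a list, or `0` if the list is empty. -/
def firstKey : List (Fin m × Fin q) → ℕ
  | [] => 0
  | z :: _ => z.1 + 1

/-- The maximal key of the first cells of some lists. -/
def maxKey (rems : List (List (Fin m × Fin q))) : ℕ :=
  rems.foldl (fun b r => max b (firstKey r)) 0

theorem Cells.firstKey_eq {mem : ℕ → ℕ} {c : ℕ} {l : List (Fin m × Fin q)}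
    (h : Y.Cells ns mem c l) (hnul : mem (M 6) = 0) : mem c = firstKey l := by
  cases l with
  | nil => rw [show c = M 6 from h, hnul]; rfl
  | cons z l => exact h.2.2.1

theorem runs_scan {σ : State} {f : ℕ} {rems : List (List (Fin m × Fin q))} (hg : Y.Glob σ)
    (hnul : σ.mem (M 6) = 0) (h23 : σ.reg 23 = f) (h20 : σ.reg 20 = f + 2 + rems.length)
    (hF : Y.Frame ns σ.mem f rems) :
    Runs scan σ fun τ => τ.reg 41 = maxKey rems ∧ τ.mem = σ.mem ∧ Keep 41 σ τ ∧
      τ.clock ≤ σ.clock + 6 * rems.length + 3 := by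
  have key : ∀ (d j b : ℕ) (τ : State), j + d = rems.length → τ.mem = σ.mem → Keep 41 σ τ →
      τ.reg 42 = f + 2 + j → τ.reg 41 = b →
      Runs (.loop (.lt 42 20) (.seq (.load 43 42 0) <| .seq (.load 44 43 0) <|
        .seq (.ite (.lt 41 44) (.add 41 44 0) .nop) (.add 42 42 1))) τ fun τ' =>
        τ'.reg 41 = (rems.drop j).foldl (fun b r => max b (firstKey r)) b ∧ τ'.mem = σ.mem ∧
          Keep 41 σ τ' ∧ τ'.clock ≤ τ.clock + 6 * d + 1 := by
    intro d
    induction d with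
    | zero =>
      intro j b τ hj hm hk h42 h41
      rw [List.drop_eq_nil_of_le (by omega)]
      refine runs_loop_false ?_ ⟨h41, hm, ⟨hk.reg, hk.buf, hk.log⟩, by simp [State.tick]⟩
      simp only [Test.Holds, h42, hk.reg 20 (by norm_num), h20]
      omega
    | succ d ih =>
      intro j b τ hj hm hk h42 h41
      have hjl : j < rems.length := by omega
      rw [List.drop_eq_getElem_cons hjl, List.foldl_cons]
      have hg' := hg.of_keep hk (by norm_num)
      have e1 := (hF j hjl).firstKey_eq hnul
      refine runs_loop_true ?_ ?_
      · simp only [Test.Holds, h42, hk.reg 20 (by norm_num), h20]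
        omega
      simp only [runs_seq, runs_load, runs_ite, runs_add, runs_nop, Test.Holds, State.tick]
      simp only [ne_eq, Nat.reduceEqDiff, not_false_eq_true, OfNat.ofNat_ne_zero,
        OfNat.zero_ne_ofNat, OfNat.one_ne_ofNat, Function.update_of_ne, Function.update_self,
        hg'.r0, h42, h41, hm, e1, Nat.add_zero]
      refine ⟨fun hlt =>
          (ih (j + 1) (max b (firstKey rems[j])) _ (by omega) (by rfl) ?_ ?_ ?_).mono ?_,
        fun hlt => (ih (j + 1) (max b (firstKey rems[j])) _ (by omega) (by rfl) ?_ ?_ ?_).mono ?_⟩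
      · simp only [keep_update, Nat.reduceLeDiff, le_refl]
        exact ⟨hk.reg, hk.buf, hk.log⟩
      · simp; omega
      · simp; omega
      · rintro τ' ⟨k1, k2, k3, k4⟩
        exact ⟨k1, k2, k3, by dsimp only at k4; omega⟩
      · simp only [keep_update, Nat.reduceLeDiff, le_refl]
        exact ⟨hk.reg, hk.buf, hk.log⟩
      · simp; omega
      · simp [h41]; omega
      · rintro τ' ⟨k1, k2, k3, k4⟩
        exact ⟨k1, k2, k3, by dsimp only at k4; omega⟩
  unfold scan
  simp only [runs_seq, runs_set, runs_add]
  refine (key rems.length 0 0 _ (by omega) (by rfl) ?_ (by simp [h23]) (by simp)).mono ?_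
  · simp only [keep_update, Nat.reduceLeDiff, le_refl, keep_self]
  · rintro τ ⟨k1, k2, k3, k4⟩
    exact ⟨k1, k2, k3, by dsimp only at k4; omega⟩

/-! ### Building the frame of the predecessors along an edge -/

/-- Append `p` unless it is present. -/
def insertNew (ch : List (Fin q)) (p : Fin q) : List (Fin q) := if p ∈ ch then ch else ch ++ [p]

variable (Y ns) in
/-- The frame at the address `g` is under construction, ends at the address `e`, and contains the
lists of the nodes `(u, p)` for the states `p` in `ch`, which are exactly those with the current
time stamp. -/
structure Child (u : Fin n) (stamp g : ℕ) (ch : List (Fin q)) (mem : ℕ → ℕ) (e : ℕ) : Prop where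
  enum : Y.EnumMem ns stamp mem
  nodup : ch.Nodup
  disc : ∀ p ∈ ch, (u, p) ∈ ns.map Prod.fst
  mark : ∀ p, (u, p) ∈ ns.map Prod.fst → (mem (Y.adr ns (u, p) + 4) = stamp ↔ p ∈ ch)
  frame : Y.Frame ns mem g (ch.map fun p => Y.cells (u, p))
  top : e = g + 2 + ch.length
  base : Y.stackBase ns ≤ g

theorem EnumMem.update_mark {stamp : ℕ} {mem : ℕ → ℕ} (h : Y.EnumMem ns stamp mem)
    {x : Fin n × Fin q} (hx : x ∈ ns.map Prod.fst) :
    Y.EnumMem ns stamp (Function.update mem (Y.adr ns x + 4) stamp) := by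
  have hb := Y.adr_lt hx
  refine ⟨fun a ha => ?_, ?_, fun y hy => ?_, fun y hy => ?_⟩
  · rw [Function.update_of_ne (by omega), h.low a ha]
  · rw [Function.update_of_ne (by omega), h.nul]
  · rw [Function.update_apply]
    split_ifs
    · exact le_rfl
    · exact h.mark y hy
  · obtain ⟨i, -, -, hi⟩ := Y.adr_bounds hx
    obtain ⟨j, -, -, hj⟩ := Y.adr_bounds hy
    rw [Function.update_of_ne (by omega)]
    exact (h.head y hy).congr fun a ha _ => Function.update_of_ne (by omega) _ _

theorem runs_enter {u : Fin n} {p : Fin q} {stamp g : ℕ} {ch : List (Fin q)} {σ : State}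
    (hg : Y.Glob σ) (h24 : σ.reg 24 = stamp) (h45 : σ.reg 45 = Y.adr ns (u, p))
    (hp : (u, p) ∈ ns.map Prod.fst) (hC : Y.Child ns u stamp g ch σ.mem (σ.reg 49)) :
    Runs enter σ fun τ => Y.Child ns u stamp g (insertNew ch p) τ.mem (τ.reg 49) ∧ Keep 45 σ τ ∧
      (∀ a, Y.cellBase ns ≤ a → a < g + 2 → τ.mem a = σ.mem a) ∧ τ.clock ≤ σ.clock + 6 := by
  have hb := Y.adr_lt hp
  have hcb := Y.cellBase_le ns
  have hbase := hC.base
  have hmark := hC.mark p hp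
  unfold enter
  simp only [runs_seq, runs_load, runs_ite, runs_add, runs_nop, runs_store, Test.Holds,
    State.tick]
  simp only [ne_eq, Nat.reduceEqDiff, not_false_eq_true, OfNat.ofNat_ne_zero,
    OfNat.zero_ne_ofNat, OfNat.one_ne_ofNat, Function.update_of_ne, Function.update_self,
    hg.r0, hg.r1, hg.r3, hg.r4, h24, h45, Nat.add_zero, keep_update, Nat.reduceLeDiff, le_refl,
    keep_self, true_and]
  unfold insertNew
  refine ⟨fun h => ⟨?_, fun _ _ _ => trivial, by omega⟩, fun h => ⟨?_, fun a ha ha' => ?_, ?_⟩⟩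
  · rw [if_pos (hmark.1 h)]
    exact hC
  · have hnot : p ∉ ch := fun h' => h (hmark.2 h')
    rw [if_neg hnot]
    have hE := hC.enum.update_mark hp
    have htop := hC.top
    have hhead : Function.update σ.mem (Y.adr ns (u, p) + 4) stamp (Y.adr ns (u, p) + 3) =
        σ.mem (Y.adr ns (u, p) + 3) := Function.update_of_ne (by omega) _ _
    refine ⟨hE.congr fun a ha => Function.update_of_ne (by omega) _ _, ?_, ?_, ?_, ?_, ?_, hbase⟩
    · rw [List.nodup_append]
      refine ⟨hC.nodup, by simp, fun a ha b hb hab => ?_⟩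
      rw [List.mem_singleton] at hb
      exact hnot (hb ▸ hab ▸ ha)
    · intro p' hp'
      rcases List.mem_append.1 hp' with hp' | hp'
      · exact hC.disc p' hp'
      · rw [List.mem_singleton.1 hp']; exact hp
    · intro p' hp'
      have hb' := Y.adr_lt hp'
      rw [Function.update_of_ne (by omega), Function.update_apply, List.mem_append,
        List.mem_singleton]
      by_cases hpp : p' = p
      · subst hpp
        simp
      · rw [if_neg, hC.mark p' hp']
        · simp [hpp]
        · intro h'
          have h'' : Y.adr ns (u, p') = Y.adr ns (u, p) := by omega
          exact hpp (congrArg Prod.snd (Y.adr_inj hp' h''))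
    · intro i hi
      simp only [List.map_append, List.length_append, List.length_map, List.map_cons,
        List.map_nil, List.length_singleton] at hi
      rcases Nat.lt_succ_iff_lt_or_eq.1 hi with hi | rfl
      · rw [hhead, Function.update_of_ne (by omega), Function.update_of_ne (by omega)]
        have h5 := hC.frame i (by simpa using hi)
        simp only [List.getElem_map, List.map_append, List.getElem_append_left,
          List.length_map, hi] at h5 ⊢
        refine h5.congr fun a ha ha' => ?_
        rw [Function.update_of_ne (by omega), Function.update_of_ne (by omega)]
      · rw [← htop, Function.update_self]
        simp only [List.map_append, List.map_cons, List.map_nil, List.getElem_append_right,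
          List.length_map, le_refl, Nat.sub_self, List.getElem_cons_zero]
        rw [hhead]
        refine (hC.enum.head _ hp).congr fun a ha ha' => ?_
        rw [Function.update_of_ne (by omega), Function.update_of_ne (by omega)]
    · rw [List.length_append, List.length_singleton, htop]; omega
  · have htop := hC.top
    rw [Function.update_of_ne (by omega), Function.update_of_ne (by omega)]
  · trivial

/-- The condition that the first component is `e`. -/
def onEdge (e : Fin m) (z : Fin m × Fin q) : Bool := decide (z.1 = e)

/-- The time is proportional to the number of the cells that are removed, which is what the bound on
the delay needs: the length of the whole list would be too much. -/
theorem runs_advance {e : Fin m} {stamp g : ℕ} (l : List (Fin m × Fin q)) (ch : List (Fin q))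
    (σ : State) (hg : Y.Glob σ) (h24 : σ.reg 24 = stamp) (h41 : σ.reg 41 = e + 1)
    (h44 : σ.reg 44 = σ.mem (σ.reg 43)) (hl : ∀ z ∈ l, (D.src z.1, z.2) ∈ ns.map Prod.fst)
    (hc : Y.Cells ns σ.mem (σ.reg 43) l)
    (hC : Y.Child ns (D.src e) stamp g ch σ.mem (σ.reg 49)) :
    Runs advance σ fun τ => Y.Cells ns τ.mem (τ.reg 43) (l.dropWhile (onEdge e)) ∧
      Y.Child ns (D.src e) stamp g
        (((l.takeWhile (onEdge e)).map Prod.snd).foldl insertNew ch) τ.mem (τ.reg 49) ∧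
      Keep 43 σ τ ∧ (∀ a, Y.cellBase ns ≤ a → a < g + 2 → τ.mem a = σ.mem a) ∧
      τ.clock ≤ σ.clock + 10 * (l.takeWhile (onEdge e)).length + 1 := by
  have hdone : firstKey l ≠ e + 1 → l.dropWhile (onEdge e) = l → l.takeWhile (onEdge e) = [] →
      Runs advance σ fun τ => Y.Cells ns τ.mem (τ.reg 43) (l.dropWhile (onEdge e)) ∧
      Y.Child ns (D.src e) stamp g
        (((l.takeWhile (onEdge e)).map Prod.snd).foldl insertNew ch) τ.mem (τ.reg 49) ∧
      Keep 43 σ τ ∧ (∀ a, Y.cellBase ns ≤ a → a < g + 2 → τ.mem a = σ.mem a) ∧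
      τ.clock ≤ σ.clock + 10 * (l.takeWhile (onEdge e)).length + 1 := by
    intro h1 h2 h3
    rw [h2, h3]
    refine runs_loop_false ?_ ⟨hc, hC, keep_self, fun _ _ _ => rfl, le_rfl⟩
    rw [Test.Holds, h44, h41, hc.firstKey_eq hC.enum.nul]
    exact h1
  induction l generalizing ch σ with
  | nil => exact hdone (by simp [firstKey]) rfl rfl
  | cons z l ih =>
    by_cases hz : z.1 = e
    · clear hdone
      have hz' : onEdge e z = true := by simp [onEdge, hz]
      rw [List.dropWhile_cons_of_pos hz', List.takeWhile_cons_of_pos hz']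
      obtain ⟨h1, h2, h3, h4, h5⟩ := hc
      refine runs_loop_true ?_ ?_
      · rw [Test.Holds, h44, h41, h3, hz]
      have hmem := hl z (List.mem_cons_self)
      rw [hz] at h4 hmem
      simp only [runs_seq, runs_load, State.tick, hg.r1, h4]
      refine (runs_enter (p := z.2) (hg.of_reg ?_) (by simpa using h24) (by simp) hmem
        (by simpa using hC)).mono ?_
      · intro x hx
        simp [show x ≠ 45 by omega]
      · rintro τ ⟨hC', hk, hm, hck⟩
        have hk' : Keep 45 σ τ := by
          refine Keep.trans ?_ hk
          simp only [keep_update, le_refl, keep_self]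
        have hg' := hg.of_keep hk' (by norm_num)
        have hbase := hC.base
        have hsb := Y.cellBase_le ns
        have e2 : τ.mem (σ.reg 43 + 2) = σ.mem (σ.reg 43 + 2) := hm _ (by omega) (by omega)
        simp only [ne_eq, Nat.reduceEqDiff, not_false_eq_true, OfNat.ofNat_ne_zero,
          OfNat.zero_ne_ofNat, Function.update_of_ne, Function.update_self, hg'.r0, hg'.r2,
          hk'.reg 43 (by norm_num), e2, Nat.add_zero]
        have hrest : Y.Cells ns τ.mem (σ.mem (σ.reg 43 + 2)) l :=
          Cells.congr h5 fun a ha ha' => hm a ha (by omega)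
        refine (ih _ _ (hg'.of_reg ?_) (by simp [hk'.reg 24 (by norm_num), h24])
          (by simp [hk'.reg 41 (by norm_num), h41]) (by simp)
          (fun z hz => hl z (List.mem_cons_of_mem _ hz)) (by simpa using hrest)
          (by simpa using hC') ?_).mono ?_
        · intro x hx
          simp [show x ≠ 43 by omega, show x ≠ 44 by omega]
        · intro h1 h2 h3
          rw [h2, h3]
          refine runs_loop_false ?_ ⟨by simpa [State.tick] using hrest,
            by simpa [State.tick] using hC', ?_,
            fun _ _ _ => rfl, le_rfl⟩
          · simp only [Test.Holds]
            simp only [ne_eq, Nat.reduceEqDiff, not_false_eq_true, Function.update_of_ne,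
              Function.update_self, hk'.reg 41 (by norm_num), h41,
              hrest.firstKey_eq hC'.enum.nul]
            exact h1
          · exact keep_self
        · rintro τ' ⟨k1, k2, k3, k4, k5⟩
          refine ⟨k1, k2, ?_, fun a ha ha' => (k4 a ha ha').trans (hm a ha ha'), ?_⟩
          · refine Keep.trans ?_ k3
            simp only [keep_update, Nat.reduceLeDiff, le_refl]
            exact ⟨fun x hx => hk'.reg x (by omega), hk'.buf, hk'.log⟩
          · dsimp only at k5 hck
            rw [List.length_cons]
            omega
    · have hz' : ¬ onEdge e z = true := by simp [onEdge, hz]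
      refine hdone ?_ (List.dropWhile_cons_of_neg hz') (List.takeWhile_cons_of_neg hz')
      simp only [firstKey]
      intro h
      exact hz (Fin.ext (by omega))

/-- The states of the predecessors along the edge `e` in the lists `rems`. -/
def children (e : Fin m) (rems : List (List (Fin m × Fin q))) (ch : List (Fin q)) :
    List (Fin q) :=
  rems.foldl (fun ch r => ((r.takeWhile (onEdge e)).map Prod.snd).foldl insertNew ch) ch

/-- The step along the edge `e` removes the steps along `e` from the topmost frame and creates the
frame of their source nodes. The increased time stamp invalidates all earlier marks at once. -/
theorem runs_push {σ : State} {f stamp : ℕ} {e : Fin m} {rems : List (List (Fin m × Fin q))}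
    (hg : Y.Glob σ) (hE : Y.EnumMem ns stamp σ.mem) (h41 : σ.reg 41 = e + 1)
    (h23 : σ.reg 23 = f) (h20 : σ.reg 20 = f + 2 + rems.length) (h24 : σ.reg 24 = stamp)
    (hf : Y.stackBase ns ≤ f) (hF : Y.Frame ns σ.mem f rems)
    (hl : ∀ r ∈ rems, ∀ z ∈ r, (D.src z.1, z.2) ∈ ns.map Prod.fst) :
    Runs push σ fun τ => Y.Glob τ ∧ τ.reg 23 = f + 2 + rems.length ∧
      τ.mem (f + 2 + rems.length) = f ∧ τ.mem (f + 2 + rems.length + 1) = e ∧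
      Y.Child ns (D.src e) (stamp + 1) (f + 2 + rems.length) (children e rems []) τ.mem
        (τ.reg 20) ∧ τ.reg 24 = stamp + 1 ∧ τ.reg 22 = σ.reg 22 - 1 ∧
      Y.Frame ns τ.mem f (rems.map (List.dropWhile (onEdge e))) ∧
      (∀ a, Y.cellBase ns ≤ a → a < f + 2 → τ.mem a = σ.mem a) ∧ τ.buf = σ.buf ∧
      τ.log = σ.log ∧ τ.clock ≤ σ.clock +
        (rems.map fun r => 10 * (r.takeWhile (onEdge e)).length + 6).sum + 10 := by
  set g := f + 2 + rems.length with hgdef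
  have key : ∀ (d j : ℕ) (ch : List (Fin q)) (τ : State), j + d = rems.length → Y.Glob τ →
      τ.reg 20 = g → τ.reg 24 = stamp + 1 → τ.reg 41 = e + 1 → τ.reg 42 = f + 2 + j →
      Y.Child ns (D.src e) (stamp + 1) g ch τ.mem (τ.reg 49) →
      (∀ i (h : i < rems.length), Y.Cells ns τ.mem (τ.mem (f + 2 + i))
        (if i < j then rems[i].dropWhile (onEdge e) else rems[i])) →
      Runs (.loop (.lt 42 20) (.seq (.load 43 42 0) <| .seq (.load 44 43 0) <|
        .seq advance <| .seq (.store 42 0 43) (.add 42 42 1))) τ fun τ' =>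
        Y.Child ns (D.src e) (stamp + 1) g (children e (rems.drop j) ch) τ'.mem (τ'.reg 49) ∧
        (∀ i (h : i < rems.length), Y.Cells ns τ'.mem (τ'.mem (f + 2 + i))
          (rems[i].dropWhile (onEdge e))) ∧ Keep 41 τ τ' ∧
        (∀ a, Y.cellBase ns ≤ a → a < f + 2 ∨ a = g ∨ a = g + 1 → τ'.mem a = τ.mem a) ∧
        τ'.clock ≤ τ.clock +
          ((rems.drop j).map fun r => 10 * (r.takeWhile (onEdge e)).length + 6).sum + 1 := by
    intro d
    induction d with
    | zero =>
      intro j ch τ hj hgτ k20 k24 k41 k42 hC hI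
      rw [List.drop_eq_nil_of_le (by omega)]
      refine runs_loop_false ?_ ⟨hC, fun i hi => ?_, keep_self, fun _ _ _ => rfl, le_rfl⟩
      · simp only [Test.Holds, k42, k20]
        omega
      · have := hI i hi
        rwa [if_pos (by omega)] at this
    | succ d ih =>
      intro j ch τ hj hgτ k20 k24 k41 k42 hC hI
      have hjl : j < rems.length := by omega
      rw [List.drop_eq_getElem_cons hjl, List.map_cons, List.sum_cons]
      have hcj := hI j hjl
      rw [if_neg (lt_irrefl j)] at hcj
      refine runs_loop_true ?_ ?_
      · simp only [Test.Holds, k42, k20]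
        omega
      simp only [runs_seq, runs_load, State.tick]
      simp only [ne_eq, Nat.reduceEqDiff, not_false_eq_true, OfNat.ofNat_ne_zero,
        OfNat.zero_ne_ofNat, Function.update_of_ne, Function.update_self, hgτ.r0, k42, Nat.add_zero]
      refine (runs_advance rems[j] ch _ (hgτ.of_reg ?_) (by simpa using k24) (by simpa using k41)
        (by simp) (hl _ (List.getElem_mem hjl)) (by simpa using hcj) (by simpa using hC)).mono ?_
      · intro x hx
        simp [show x ≠ 43 by omega, show x ≠ 44 by omega]
      · rintro τ₁ ⟨l1, l2, l3, l4, l5⟩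
        have hk : Keep 43 τ τ₁ := by
          refine Keep.trans ?_ l3
          simp only [keep_update, Nat.reduceLeDiff, le_refl, keep_self]
        have hg₁ := hgτ.of_keep hk (by norm_num)
        have hsb := Y.cellBase_le ns
        simp only [runs_store, runs_add]
        simp only [ne_eq, Nat.reduceEqDiff, not_false_eq_true, OfNat.ofNat_ne_zero,
          OfNat.zero_ne_ofNat, Function.update_of_ne, Function.update_self, hg₁.r0,
          hk.reg 42 (by norm_num), k42, Nat.add_zero]
        have hup : ∀ a, a ≠ f + 2 + j →
            Function.update τ₁.mem (f + 2 + j) (τ₁.reg 43) a = τ₁.mem a := fun a ha =>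
          Function.update_of_ne ha _ _
        -- the advanced cursor lies in the frame `f`, below the frame under construction
        have hC' : Y.Child ns (D.src e) (stamp + 1) g
            (((rems[j].takeWhile (onEdge e)).map Prod.snd).foldl insertNew ch)
            (Function.update τ₁.mem (f + 2 + j) (τ₁.reg 43)) (τ₁.reg 49) := by
          refine ⟨l2.enum.congr fun a ha => hup a (by omega), l2.nodup, l2.disc, fun p hp => ?_,
            fun i hi => ?_, l2.top, l2.base⟩
          · have := Y.adr_lt hp
            rw [hup _ (by omega)]
            exact l2.mark p hp
          · rw [hup _ (by omega)]
            exact (l2.frame i hi).congr fun a _ ha => hup a (by omega)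
        refine (ih (j + 1) _ _ (by omega) (hg₁.of_reg ?_) ?_ ?_ ?_ ?_ (by simpa using hC')
          ?_).mono ?_
        · intro x hx
          simp [show x ≠ 42 by omega]
        · simp [hk.reg 20 (by norm_num), k20]
        · simp [hk.reg 24 (by norm_num), k24]
        · simp [hk.reg 41 (by norm_num), k41]
        · simp; omega
        · intro i hi
          dsimp only
          by_cases hij : i = j
          · subst hij
            rw [if_pos (by omega), Function.update_self]
            exact l1.congr fun a _ ha => hup a (by omega)
          · have h6 := hI i hi
            rw [hup _ (by omega), l4 _ (by omega) (by omega)]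
            have h7 : (i < j + 1) = (i < j) := by
              rw [eq_iff_iff]; omega
            simp only [h7]
            refine h6.congr fun a ha ha' => ?_
            rw [hup a (by omega), l4 a ha (by omega)]
        · rintro τ₂ ⟨p1, p2, p3, p4, p5⟩
          refine ⟨p1, p2, ?_, fun a ha ha' => ?_, ?_⟩
          · refine Keep.trans ?_ p3
            simp only [keep_update, Nat.reduceLeDiff, le_refl]
            exact ⟨fun x hx => hk.reg x (by omega), hk.buf, hk.log⟩
          · rw [p4 a ha ha']
            dsimp only
            rw [hup a (by omega), l4 a (by omega) (by omega)]
          · dsimp only at p5 l5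
            omega
  have hcb := Y.cellBase_le ns
  have hup : ∀ a, a ≠ g → a ≠ g + 1 →
      Function.update (Function.update σ.mem g f) (g + 1) e a = σ.mem a := fun a h1 h2 => by
    rw [Function.update_of_ne h2, Function.update_of_ne h1]
  have hE' : Y.EnumMem ns stamp (Function.update (Function.update σ.mem g f) (g + 1) e) :=
    hE.congr fun a ha => hup a (by omega) (by omega)
  unfold push
  simp only [runs_seq, runs_load, runs_sub, runs_store, runs_add]
  simp only [ne_eq, Nat.reduceEqDiff, not_false_eq_true, OfNat.ofNat_ne_zero,
    OfNat.zero_ne_ofNat, OfNat.one_ne_ofNat, Function.update_of_ne, Function.update_self, hg.r0,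
    hg.r1, h23, h20, h41, h24, Nat.add_zero, Nat.add_sub_cancel]
  refine (key rems.length 0 [] _ (by omega) (hg.of_reg ?_) (by simp [h20]) (by simp)
    (by simp [h41]) (by simp) ?_ ?_).mono ?_
  · intro x hx
    simp [show x ≠ 42 by omega, show x ≠ 49 by omega, show x ≠ 48 by omega, show x ≠ 24 by omega]
  · refine ⟨⟨hE'.low, hE'.nul, fun x hx => (hE'.mark x hx).trans (Nat.le_succ _), hE'.head⟩,
      List.nodup_nil, by simp, fun p hp => ?_, fun i hi => by simp at hi, by simp, by omega⟩
    have := hE'.mark _ hp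
    simp only [List.not_mem_nil, iff_false]
    omega
  · intro i hi
    rw [if_neg (by omega)]
    dsimp only
    rw [hup _ (by omega) (by omega)]
    exact (hF i hi).congr fun a _ ha => hup a (by omega) (by omega)
  · rintro τ ⟨p1, p2, p3, p4, p5⟩
    have hgτ : Y.Glob τ := by
      refine hg.of_reg fun x hx => ?_
      rw [p3.reg x (by omega)]
      simp [show x ≠ 42 by omega, show x ≠ 49 by omega, show x ≠ 48 by omega,
        show x ≠ 24 by omega]
    have q20 : τ.reg 20 = g := by
      rw [p3.reg 20 (by norm_num)]; simp [h20]
    refine ⟨hgτ.of_reg ?_, ?_, ?_, ?_, ?_, ?_, ?_, ?_, ?_, p3.buf, p3.log, ?_⟩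
    · intro x hx
      simp [show x ≠ 22 by omega, show x ≠ 20 by omega, show x ≠ 23 by omega]
    · simp [q20]
    · rw [p4 g (by omega) (by omega)]; simp
    · rw [p4 (g + 1) (by omega) (by omega)]; simp
    · simpa using p1
    · simp [p3.reg 24 (by norm_num)]
    · simp [p3.reg 22 (by norm_num)]
    · intro i hi
      simpa using p2 i (by simpa using hi)
    · intro a ha ha'
      rw [p4 a ha (by omega)]
      exact hup a (by omega) (by omega)
    · dsimp only at p5
      rw [List.drop_zero] at p5
      omega

/-! ### Delivering the walk on the stack -/

variable (Y ns) in
/-- The frames from the one at the address `f` downwards contain the edges `suf`. -/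
def StackAt (mem : ℕ → ℕ) : ℕ → List (Fin m) → Prop
  | f, [] => Y.stackBase ns ≤ f ∧ mem f = 0
  | f, e :: suf => Y.stackBase ns ≤ f ∧ mem (f + 1) = e ∧ mem f + 2 ≤ f ∧ StackAt mem (mem f) suf

theorem StackAt.base {mem : ℕ → ℕ} {f : ℕ} {suf : List (Fin m)} (h : Y.StackAt ns mem f suf) :
    Y.stackBase ns ≤ f := by
  cases suf <;> exact h.1

theorem StackAt.congr {mem mem' : ℕ → ℕ} {f : ℕ} {suf : List (Fin m)}
    (h : Y.StackAt ns mem f suf)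
    (hm : ∀ a, Y.stackBase ns ≤ a → a < f + 2 → mem' a = mem a) : Y.StackAt ns mem' f suf := by
  induction suf generalizing f with
  | nil => exact ⟨h.1, by rw [hm f h.1 (by omega), h.2]⟩
  | cons e suf ih =>
    obtain ⟨h1, h2, h3, h4⟩ := h
    refine ⟨h1, by rw [hm _ (by omega) (by omega), h2], ?_, ?_⟩
    · rw [hm f h1 (by omega)]; exact h3
    · rw [hm f h1 (by omega)]
      exact ih h4 fun a ha ha' => hm a ha (by omega)

theorem runs_output {σ : State} {f : ℕ} {suf : List (Fin m)} (hg : Y.Glob σ)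
    (hlow : ∀ a < M 6, σ.mem a = M a) (h23 : σ.reg 23 = f) (hS : Y.StackAt ns σ.mem f suf)
    (hbuf : σ.buf = []) :
    Runs output σ fun τ => τ.mem = σ.mem ∧ (∀ x < 41, τ.reg x = σ.reg x) ∧ τ.buf = [] ∧
      τ.log = σ.log ++ [((s : ℕ) :: spellEdges D suf, τ.clock)] ∧
      τ.clock ≤ σ.clock + 7 * suf.length + 5 := by
  have key : ∀ (suf : List (Fin m)) (f : ℕ) (τ : State), τ.mem = σ.mem →
      (∀ x < 41, τ.reg x = σ.reg x) → Y.StackAt ns σ.mem f suf → τ.reg 42 = f →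
      τ.reg 43 = σ.mem f →
      Runs (.loop (.lt 0 43) (.seq (.load 44 42 1) <| .seq (.write 44) <| .seq (.load 45 17 44) <|
        .seq (.write 45) <| .seq (.add 42 43 0) (.load 43 42 0))) τ fun τ' =>
        τ'.mem = σ.mem ∧ (∀ x < 41, τ'.reg x = σ.reg x) ∧ τ'.log = τ.log ∧
        τ'.buf = τ.buf ++ spellEdges D suf ∧ τ'.clock ≤ τ.clock + 7 * suf.length + 1 := by
    intro suf
    induction suf with
    | nil =>
      intro f τ hm hr hS h42 h43
      refine runs_loop_false ?_ ⟨hm, hr, rfl, by simp [spellEdges, State.tick], le_rfl⟩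
      simp only [Test.Holds, h43, hS.2]
      omega
    | cons e suf ih =>
      intro f τ hm hr hS h42 h43
      obtain ⟨h1, h2, h3, h4⟩ := hS
      have hgτ := hg.of_reg fun x hx => hr x (by omega)
      have hb := h4.base
      have hrec := Y.recs_lt
      have hpos : 0 < Y.stackBase ns := by unfold stackBase; omega
      have e1 : σ.mem (M 10 + e) = D.tgt e := by
        rw [hlow _ (Y.rep.edge_tgt e).1, (Y.rep.edge_tgt e).2]
      refine runs_loop_true ?_ ?_
      · simp only [Test.Holds, h43, hgτ.r0]
        omega
      simp only [runs_seq, runs_load, runs_write, runs_add, State.tick]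
      simp only [ne_eq, Nat.reduceEqDiff, not_false_eq_true, OfNat.ofNat_ne_zero,
        OfNat.zero_ne_ofNat, OfNat.one_ne_ofNat, Function.update_of_ne, Function.update_self,
        hgτ.r0, hgτ.r1, hgτ.r17, h42, h43, hm, h2, e1, Nat.add_zero]
      refine (ih (σ.mem f) _ (by rfl) ?_ h4 (by simp) (by simp)).mono ?_
      · intro x hx
        simp [show x ≠ 42 by omega, show x ≠ 43 by omega, show x ≠ 44 by omega,
          show x ≠ 45 by omega, hr x hx]
      · rintro τ' ⟨k1, k2, k3, k4, k5⟩
        refine ⟨k1, k2, k3, ?_, ?_⟩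
        · rw [k4]
          simp [spellEdges]
        · dsimp only at k5
          rw [List.length_cons]
          omega
  unfold output
  simp only [runs_seq, runs_load, runs_write, runs_add]
  refine (key suf f _ (by rfl) ?_ hS (by simp [h23]) (by simp [h23, hg.r0])).mono ?_
  · intro x hx
    simp [show x ≠ 42 by omega, show x ≠ 43 by omega]
  · rintro τ ⟨k1, k2, k3, k4, k5⟩
    rw [runs_emit]
    refine ⟨k1, k2, rfl, ?_, ?_⟩
    · simp only [k3, k4, hbuf, hg.r13]
      simp
    · dsimp only at k5 ⊢
      omega

end Layout

namespace Layout

variable {k n m q : ℕ} {M : ℕ → ℕ} {D : Database (Fin k) (Fin n) (Fin m)}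
  {A : NFA (Fin k) (Fin q)} {s t : Fin n} {Y : Layout M D A s t}
  {ns : List ((Fin n × Fin q) × ℕ)}

/-! ### The nodes of the search tree -/

theorem firstKey_le_maxKey {rems : List (List (Fin m × Fin q))} :
    (∀ r ∈ rems, firstKey r ≤ maxKey rems) ∧
      (maxKey rems = 0 ∨ ∃ r ∈ rems, maxKey rems = firstKey r) := by
  have key : ∀ b, b ≤ rems.foldl (fun b r => max b (firstKey r)) b ∧
      (∀ r ∈ rems, firstKey r ≤ rems.foldl (fun b r => max b (firstKey r)) b) ∧
      (rems.foldl (fun b r => max b (firstKey r)) b = b ∨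
        ∃ r ∈ rems, rems.foldl (fun b r => max b (firstKey r)) b = firstKey r) := by
    induction rems with
    | nil => simp
    | cons r rems ih =>
      intro b
      rw [List.foldl_cons]
      obtain ⟨h1, h2, h3⟩ := ih (max b (firstKey r))
      refine ⟨(le_max_left _ _).trans h1, fun r' hr' => ?_, ?_⟩
      · rcases List.mem_cons.1 hr' with rfl | hr'
        · exact (le_max_right _ _).trans h1
        · exact h2 r' hr'
      · rcases h3 with h3 | ⟨r', hr', h3⟩
        · rw [h3]
          rcases max_choice b (firstKey r) with h | h
          · exact .inl h
          · exact .inr ⟨r, List.mem_cons_self, h⟩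
        · exact .inr ⟨r', List.mem_cons_of_mem _ hr', h3⟩
  exact ⟨(key 0).2.1, (key 0).2.2⟩

/-- In a sorted list without entries above `e`, the entries for `e` form an initial segment. -/
theorem takeWhile_onEdge {e : Fin m} {r : List (Fin m × Fin q)}
    (hs : r.Pairwise fun a b => b.1 ≤ a.1) (hle : ∀ z ∈ r, z.1 ≤ e) :
    r.takeWhile (onEdge e) = r.filter (onEdge e) ∧
      r.dropWhile (onEdge e) = r.filter fun z => !onEdge e z := by
  induction r with
  | nil => simp
  | cons z r ih =>
    obtain ⟨h1, h2⟩ := List.pairwise_cons.1 hs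
    obtain ⟨ih1, ih2⟩ := ih h2 fun z hz => hle z (List.mem_cons_of_mem _ hz)
    by_cases hz : onEdge e z = true
    · rw [List.takeWhile_cons_of_pos hz, List.dropWhile_cons_of_pos hz, List.filter_cons_of_pos hz,
        List.filter_cons_of_neg (by simp [hz]), ih1, ih2]
      exact ⟨rfl, rfl⟩
    · rw [List.takeWhile_cons_of_neg hz, List.dropWhile_cons_of_neg hz, List.filter_cons_of_neg hz,
        List.filter_cons_of_pos (by simp [hz])]
      have hlt : z.1 < e := lt_of_le_of_ne (hle z List.mem_cons_self) (by simpa [onEdge] using hz)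
      have hne : ∀ z' ∈ r, onEdge e z' = false := fun z' hz' => by
        simpa [onEdge] using (lt_of_le_of_lt (h1 z' hz') hlt).ne
      refine ⟨(List.filter_eq_nil_iff.2 fun z' hz' => by simp [hne z' hz']).symm, ?_⟩
      rw [List.filter_eq_self.2 fun z' hz' => by simp [hne z' hz']]

theorem mem_foldl_insertNew {l ch : List (Fin q)} {p : Fin q} :
    p ∈ l.foldl insertNew ch ↔ p ∈ ch ∨ p ∈ l := by
  induction l generalizing ch with
  | nil => simp
  | cons a l ih =>
    rw [List.foldl_cons, ih, List.mem_cons]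
    unfold insertNew
    split_ifs with h
    · constructor
      · exact fun h' => h'.imp_right .inr
      · rintro (h' | rfl | h')
        · exact .inl h'
        · exact .inl h
        · exact .inr h'
    · rw [List.mem_append, List.mem_singleton, or_assoc]

theorem mem_children {e : Fin m} {rems : List (List (Fin m × Fin q))} {ch : List (Fin q)}
    {p : Fin q} : p ∈ children e rems ch ↔
      p ∈ ch ∨ ∃ r ∈ rems, (e, p) ∈ r.takeWhile (onEdge e) := by
  unfold children
  induction rems generalizing ch with
  | nil => simp
  | cons r rems ih =>
    rw [List.foldl_cons, ih, mem_foldl_insertNew, or_assoc]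
    refine or_congr_right ?_
    have : p ∈ (r.takeWhile (onEdge e)).map Prod.snd ↔ (e, p) ∈ r.takeWhile (onEdge e) := by
      constructor
      · intro h
        obtain ⟨z, hz, rfl⟩ := List.mem_map.1 h
        have he : z.1 = e := by simpa [onEdge] using List.mem_takeWhile_imp hz
        subst he
        exact hz
      · exact fun h => List.mem_map.2 ⟨_, h, rfl⟩
    simp [this]

theorem nodup_children (e : Fin m) (rems : List (List (Fin m × Fin q))) {ch : List (Fin q)}
    (h : ch.Nodup) : (children e rems ch).Nodup := by
  have key : ∀ (l ch : List (Fin q)), ch.Nodup → (l.foldl insertNew ch).Nodup := by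
    intro l
    induction l with
    | nil => exact fun _ h => h
    | cons a l ih =>
      intro ch h
      refine ih _ ?_
      unfold insertNew
      split_ifs with ha
      · exact h
      · exact List.nodup_append.2 ⟨h, by simp, fun x hx y hy hxy =>
          ha (List.mem_singleton.1 hy ▸ hxy ▸ hx)⟩
  unfold children
  induction rems generalizing ch with
  | nil => exact h
  | cons r rems ih => exact ih (key _ _ h)

variable (Y) in
/-- A node of the search tree: the lists `rems` are final segments of the lists of the last steps
of distinct nodes at the vertex `v` of level `l`. -/
def IsNode (v : Fin n) (l : ℕ) (rems : List (List (Fin m × Fin q))) : Prop :=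
  ∃ ps : List (Fin q), ps.Nodup ∧ List.Forall₂ (fun p r => Y.Disc (v, p) ∧ Y.lev (v, p) = l ∧
    r <:+ Y.cells (v, p)) ps rems

theorem IsNode.exists_isCell {v : Fin n} {l : ℕ} {rems : List (List (Fin m × Fin q))}
    (h : Y.IsNode v l rems) {r : List (Fin m × Fin q)} (hr : r ∈ rems) :
    ∃ p, Y.lev (v, p) = l ∧ r <:+ Y.cells (v, p) := by
  obtain ⟨ps, -, h⟩ := h
  obtain ⟨i, hi, rfl⟩ := List.getElem_of_mem hr
  have := (List.forall₂_iff_get.1 h).2 i (by rw [h.length_eq]; exact hi) hi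
  exact ⟨_, this.2⟩

theorem IsNode.cell {v : Fin n} {l : ℕ} {rems : List (List (Fin m × Fin q))}
    (h : Y.IsNode v l rems) {r : List (Fin m × Fin q)} (hr : r ∈ rems) {z : Fin m × Fin q}
    (hz : z ∈ r) : Y.Disc (D.src z.1, z.2) ∧ l = Y.lev (D.src z.1, z.2) + 1 := by
  obtain ⟨p, hl, hs⟩ := h.exists_isCell hr
  obtain ⟨h1, -, -, h4⟩ := Y.mem_cells.1 (hs.subset hz)
  exact ⟨h1, hl ▸ h4⟩

theorem IsNode.length_le {v : Fin n} {l : ℕ} {rems : List (List (Fin m × Fin q))}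
    (h : Y.IsNode v l rems) : rems.length ≤ q := by
  obtain ⟨ps, hn, h⟩ := h
  rw [← h.length_eq]
  simpa using hn.length_le_card

/-- The states of a node of the search tree are distinct, so the steps along `e` correspond to
distinct transitions. -/
theorem IsNode.sum_takeWhile_le {v : Fin n} {l : ℕ} {rems : List (List (Fin m × Fin q))}
    (h : Y.IsNode v l rems) (e : Fin m) :
    (rems.map fun r => (r.takeWhile (onEdge e)).length).sum ≤ numTrans A := by
  obtain ⟨ps, hn, h⟩ := h
  refine le_trans ?_ ((hn.sum_map_le fun p => (Y.cells (v, p)).countP (onEdge e)).trans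
    (Y.sum_countP_cells_le v e))
  clear hn
  induction h with
  | nil => simp
  | @cons p r ps rems hpr _ ih =>
    simp only [List.map_cons, List.sum_cons]
    refine Nat.add_le_add ?_ ih
    have h1 : (r.takeWhile (onEdge e)).length = (r.takeWhile (onEdge e)).countP (onEdge e) :=
      (List.countP_eq_length.2 fun z hz => List.mem_takeWhile_imp hz).symm
    rw [h1]
    exact ((List.takeWhile_prefix _).sublist.trans hpr.2.2.sublist).countP_le

theorem IsNode.dropWhile {v : Fin n} {l : ℕ} {rems : List (List (Fin m × Fin q))}
    (h : Y.IsNode v l rems) (e : Fin m) :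
    Y.IsNode v l (rems.map (List.dropWhile (onEdge e))) := by
  obtain ⟨ps, hn, h⟩ := h
  refine ⟨ps, hn, ?_⟩
  rw [List.forall₂_map_right_iff]
  exact h.imp fun p r hpr => ⟨hpr.1, hpr.2.1, (List.dropWhile_suffix _).trans hpr.2.2⟩

theorem isNode_map_cells {v : Fin n} {l : ℕ} {ps : List (Fin q)} (hn : ps.Nodup)
    (h : ∀ p ∈ ps, Y.Disc (v, p) ∧ Y.lev (v, p) = l) :
    Y.IsNode v l (ps.map fun p => Y.cells (v, p)) := by
  refine ⟨ps, hn, ?_⟩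
  rw [List.forall₂_map_right_iff, List.forall₂_same]
  exact fun p hp => ⟨(h p hp).1, (h p hp).2, List.suffix_rfl⟩

/-- There are no dead ends: every node of positive level has a last step. -/
theorem cells_ne_nil {x : Fin n × Fin q} (h : Y.Disc x) (hpos : 0 < Y.lev x) :
    Y.cells x ≠ [] := by
  obtain ⟨d, h⟩ := h
  obtain ⟨y, d', hy, hs, hl⟩ := h.exists_pred hpos
  obtain ⟨e, he, he', hp⟩ := Y.mem_succ.1 hs
  obtain ⟨v, p⟩ := y
  subst he
  exact List.ne_nil_of_mem (Y.mem_cells.2 (⟨⟨d', hy⟩, he', hp, hl⟩ : Y.IsCell x (e, p)))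

variable (Y) in
/-- The walks that are delivered below a node of the search tree, without the edges that are
already on the stack. -/
def PathSet (l : ℕ) (rems : List (List (Fin m × Fin q))) (es : List (Fin m)) : Prop :=
  (l = 0 ∧ es = []) ∨
    ∃ r ∈ rems, ∃ z ∈ r, ∃ es', Y.CellPath es' (D.src z.1, z.2) ∧ es = es' ++ [z.1]

theorem pathSet_map_cells {v : Fin n} {l : ℕ} {ps : List (Fin q)} (hne : ps ≠ [])
    (h : ∀ p ∈ ps, Y.Disc (v, p) ∧ Y.lev (v, p) = l) (es : List (Fin m)) :
    Y.PathSet l (ps.map fun p => Y.cells (v, p)) es ↔ ∃ p ∈ ps, Y.CellPath es (v, p) := by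
  constructor
  · rintro (⟨rfl, rfl⟩ | ⟨r, hr, z, hz, es', hes', rfl⟩)
    · obtain ⟨p, hp⟩ := List.exists_mem_of_ne_nil _ hne
      exact ⟨p, hp, .nil (h p hp).1 (h p hp).2⟩
    · obtain ⟨p, hp, rfl⟩ := List.mem_map.1 hr
      exact ⟨p, hp, .snoc hes' (Y.mem_cells.1 hz)⟩
  · rintro ⟨p, hp, hes⟩
    generalize hx : (v, p) = x at hes
    cases hes with
    | nil hd h0 =>
      subst hx
      exact .inl ⟨(h p hp).2.symm.trans h0, rfl⟩
    | @snoc es' z _ hes' hz =>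
      subst hx
      exact .inr ⟨_, List.mem_map.2 ⟨p, hp, rfl⟩, z, Y.mem_cells.2 hz, es', hes', rfl⟩

/-- The walks below a node of the search tree are those below its child for the edge `e` and those
that remain after the lists have been advanced. -/
theorem pathSet_split {l : ℕ} {rems : List (List (Fin m × Fin q))} {e : Fin m}
    (es : List (Fin m)) :
    Y.PathSet (l + 1) rems es ↔
      (∃ p ∈ children e rems [], ∃ es', Y.CellPath es' (D.src e, p) ∧ es = es' ++ [e]) ∨
        Y.PathSet (l + 1) (rems.map (List.dropWhile (onEdge e))) es := by
  have hsplit : ∀ r ∈ rems, ∀ z, z ∈ r ↔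
      z ∈ r.takeWhile (onEdge e) ∨ z ∈ r.dropWhile (onEdge e) := fun r _ z => by
    rw [← List.mem_append, List.takeWhile_append_dropWhile]
  constructor
  · rintro (⟨h0, -⟩ | ⟨r, hr, z, hz, es', hes', rfl⟩)
    · omega
    · rcases (hsplit r hr z).1 hz with hz | hz
      · have he : z.1 = e := by simpa [onEdge] using List.mem_takeWhile_imp hz
        subst he
        exact .inl ⟨z.2, mem_children.2 (.inr ⟨r, hr, hz⟩), es', hes', rfl⟩
      · exact .inr (.inr ⟨_, List.mem_map.2 ⟨r, hr, rfl⟩, z, hz, es', hes', rfl⟩)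
  · rintro (⟨p, hp, es', hes', rfl⟩ | ⟨h0, -⟩ | ⟨r', hr', z, hz, es', hes', rfl⟩)
    · rcases mem_children.1 hp with hp | ⟨r, hr, hp⟩
      · simp at hp
      · exact .inr ⟨r, hr, (e, p), (hsplit r hr _).2 (.inl hp), es', hes', rfl⟩
    · omega
    · obtain ⟨r, hr, rfl⟩ := List.mem_map.1 hr'
      exact .inr ⟨r, hr, z, (hsplit r hr z).2 (.inr hz), es', hes', rfl⟩

/-- No walk below the child for `e` is delivered again after the lists have been advanced, because
no step along `e` remains in them. -/
theorem pathSet_dropWhile_ne {v : Fin n} {l : ℕ} {rems : List (List (Fin m × Fin q))} {e : Fin m}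
    (h : Y.IsNode v (l + 1) rems) (hle : ∀ r ∈ rems, ∀ z ∈ r, z.1 ≤ e) {es : List (Fin m)}
    (hes : Y.PathSet (l + 1) (rems.map (List.dropWhile (onEdge e))) es) (es' : List (Fin m)) :
    es ≠ es' ++ [e] := by
  rcases hes with ⟨h0, -⟩ | ⟨r', hr', z, hz, es'', -, rfl⟩
  · omega
  · obtain ⟨r, hr, rfl⟩ := List.mem_map.1 hr'
    obtain ⟨p, -, hs⟩ := h.exists_isCell hr
    have hsort := (Y.cells_sorted (v, p)).sublist hs.sublist
    rw [(takeWhile_onEdge hsort (hle r hr)).2, List.mem_filter] at hz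
    intro heq
    have := List.append_inj_right' heq rfl
    simp only [List.cons.injEq, and_true] at this
    simp [onEdge, this] at hz

/-! ### Amortized time -/

/-- The weight of the lists in a frame, which bounds the time of a step at this frame. -/
def weight (rems : List (List (Fin m × Fin q))) : ℕ := (rems.map fun r => r.length + 1).sum

variable (Y) in
/-- The total weight of all nodes of level less than `l`. It bounds the time for the descent from a
frame of level `l` to the first walk, because the frames of a descent have distinct levels. -/
noncomputable def potential (l : ℕ) : ℕ :=
  ∑ x, if Y.lev x < l then (Y.cells x).length + 1 else 0

/-- The frame of nodes of level `l` at a vertex uses up the part of the potential for this level. -/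
theorem weight_add_potential_le {v : Fin n} {l : ℕ} {ps : List (Fin q)} (hn : ps.Nodup)
    (h : ∀ p ∈ ps, Y.lev (v, p) = l) :
    weight (ps.map fun p => Y.cells (v, p)) + Y.potential l ≤ Y.potential (l + 1) := by
  have h1 : weight (ps.map fun p => Y.cells (v, p)) ≤
      ∑ x, if Y.lev x = l then (Y.cells x).length + 1 else 0 := by
    have h2 : weight (ps.map fun p => Y.cells (v, p)) =
        (ps.map fun p => if Y.lev (v, p) = l then (Y.cells (v, p)).length + 1 else 0).sum := by
      unfold weight
      rw [List.map_map]
      congr 1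
      refine List.map_congr_left fun p hp => ?_
      rw [if_pos (h p hp)]
      rfl
    rw [h2]
    refine (hn.sum_map_le _).trans ?_
    rw [Fintype.sum_prod_type]
    exact Finset.single_le_sum (f := fun v => ∑ p, if Y.lev (v, p) = l then
      (Y.cells (v, p)).length + 1 else 0) (fun _ _ => Nat.zero_le _) (Finset.mem_univ v)
  refine (Nat.add_le_add_right h1 _).trans ?_
  unfold potential
  rw [← Finset.sum_add_distrib]
  refine Finset.sum_le_sum fun x _ => ?_
  split_ifs <;> omega

theorem potential_le (l : ℕ) : Y.potential l ≤ n * q + m * numTrans A := by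
  have h : Y.potential l ≤ ∑ x, ((Y.cells x).length + 1) := by
    refine Finset.sum_le_sum fun x _ => ?_
    split_ifs <;> omega
  refine h.trans ?_
  rw [Finset.sum_add_distrib]
  have := Y.sum_length_cells_le
  simp only [Finset.sum_const, Finset.card_univ, Fintype.card_prod, Fintype.card_fin, smul_eq_mul,
    Nat.mul_one]
  omega

/-- A shortest path visits distinct nodes, one of every level. -/
theorem lev_lt {x : Fin n × Fin q} (h : Y.Disc x) : Y.lev x < n * q := by
  -- the levels below that of `x` are all attained
  have key : ∀ (l : ℕ) (x : Fin n × Fin q), Y.Disc x → Y.lev x = l →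
      ∀ i ≤ l, ∃ y, Y.lev y = i := by
    intro l
    induction l with
    | zero => intro x _ h0 i hi; exact ⟨x, by omega⟩
    | succ l ih =>
      intro x ⟨d, hx⟩ hl i hi
      rcases hi.lt_or_eq with hi | rfl
      · obtain ⟨y, d', hy, -, hxy⟩ := hx.exists_pred (show 0 < Y.lev x by omega)
        have hxy' : Y.lev x = Y.lev y + 1 := hxy
        exact ih y ⟨d', hy⟩ (by omega) i (by omega)
      · exact ⟨x, hl⟩
  have : Nonempty (Fin n × Fin q) := ⟨x⟩
  choose! f hf using key _ x h rfl
  have hinj : Function.Injective fun i : Fin (Y.lev x + 1) => f i := fun i j hij => by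
    have hi := hf i (by omega)
    have hj := hf j (by omega)
    simp only at hij
    rw [hij] at hi
    exact Fin.ext (hi.symm.trans hj)
  have := Fintype.card_le_of_injective _ hinj
  simpa using this

end Layout

/-! ### The time between the answers -/

/-- The timing of the part `seg` of the log that is delivered between the times `c₀` and `c₁`,
while the search visits the descendants of a frame of level `l` whose weight and potential add up
to `pot`. The number `K` bounds the time of a step of the search, and `lam` is the length of the
walks. -/
structure Timed (K lam l pot c₀ c₁ : ℕ) (seg : List (List ℕ × ℕ)) : Prop where
  chain : seg.IsChain fun x y => y.2 ≤ x.2 + lam * (2 * K + 22)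
  last : ∀ x ∈ seg.getLast?, c₁ ≤ x.2 + (l * K + 5)
  first : ∀ x ∈ seg.head?, x.2 ≤ c₀ + (l * K + 7 * lam + 10)
  first_pot : ∀ x ∈ seg.head?, x.2 ≤ c₀ + (30 * pot + 7 * lam + 10)
  empty : seg = [] → c₁ ≤ c₀ + K

/-- Every child frame delivers an answer, so at most `l` frames are pushed before the first answer,
and at most `l` are popped after the last one. -/
theorem Timed.append {K lam l pot pot' c c₀ c₁ c₂ : ℕ} {seg₁ seg₂ : List (List ℕ × ℕ)} {pot₂ : ℕ}
    (h₁ : Timed K lam l pot' c₀ c₁ seg₁) (hne : seg₁ ≠ [])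
    (h₂ : Timed K lam (l + 1) pot₂ c₁ c₂ seg₂) (hK : c₀ ≤ c + K)
    (hpot : c₀ + 30 * pot' ≤ c + 30 * pot) (hl : l < lam) :
    Timed K lam (l + 1) pot c c₂ (seg₁ ++ seg₂) := by
  have e : (l + 1) * K = l * K + K := by ring
  refine ⟨h₁.chain.append h₂.chain fun x hx y hy => ?_, fun x hx => ?_, fun x hx => ?_,
    fun x hx => ?_, fun h => absurd (List.append_eq_nil_iff.1 h).1 hne⟩
  · have h3 := h₁.last x hx
    have h4 := h₂.first y hy
    have h5 : (l + 1) * K ≤ lam * K := Nat.mul_le_mul_right _ hl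
    have h6 : lam * (2 * K + 22) = 2 * (lam * K) + 22 * lam := by ring
    omega
  · by_cases h : seg₂ = []
    · subst h
      rw [List.append_nil] at hx
      have h3 := h₁.last x hx
      have h4 := h₂.empty rfl
      omega
    · rw [List.getLast?_append_of_ne_nil _ h] at hx
      exact h₂.last x hx
  · rw [List.head?_append_of_ne_nil _ hne] at hx
    have h3 := h₁.first x hx
    omega
  · rw [List.head?_append_of_ne_nil _ hne] at hx
    have h3 := h₁.first_pot x hx
    omega

namespace RAM

/-- The loop `while b do p`, started in the state `σ`, gets to the state `τ` in front of one of its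
tests. -/
def Reaches (b : Test) (p : Prog) (σ τ : State) : Prop :=
  ∀ Q : State → Prop, Runs (.loop b p) τ Q → Runs (.loop b p) σ Q

theorem Reaches.trans {b : Test} {p : Prog} {σ τ υ : State} (h : Reaches b p σ τ)
    (h' : Reaches b p τ υ) : Reaches b p σ υ := fun Q hQ => h Q (h' Q hQ)

theorem Runs.reaches {b : Test} {p : Prog} {σ : State} {R : State → Prop} (hb : b.Holds σ)
    (h : Runs p σ.tick R) : ∃ τ, R τ ∧ Reaches b p σ τ :=
  let ⟨τ, hx, hR⟩ := h
  ⟨τ, hR, fun _ hQ => runs_loop_true hb ⟨τ, hx, hQ⟩⟩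

end RAM

namespace Layout

variable {k n m q : ℕ} {M : ℕ → ℕ} {D : Database (Fin k) (Fin n) (Fin m)}
  {A : NFA (Fin k) (Fin q)} {s t : Fin n} {Y : Layout M D A s t}
  {ns : List ((Fin n × Fin q) × ℕ)}

/-! ### The depth-first search -/

theorem Frame.congr {mem mem' : ℕ → ℕ} {f : ℕ} {rems : List (List (Fin m × Fin q))}
    (h : Y.Frame ns mem f rems) (hf : Y.stackBase ns ≤ f)
    (hm : ∀ a, Y.cellBase ns ≤ a → a < f + 2 + rems.length → mem' a = mem a) :
    Y.Frame ns mem' f rems := by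
  intro i hi
  have hb := Y.cellBase_le ns
  rw [hm _ (by omega) (by omega)]
  exact (h i hi).congr fun a ha ha' => hm a ha (by omega)

theorem IsNode.maxKey_cases {v : Fin n} {l : ℕ} {rems : List (List (Fin m × Fin q))}
    (h : Y.IsNode v l rems) :
    (maxKey rems = 0 ∧ ∀ r ∈ rems, r = []) ∨ ∃ e : Fin m, maxKey rems = e + 1 ∧
      (∀ r ∈ rems, ∀ z ∈ r, z.1 ≤ e) ∧ ∃ r ∈ rems, ∃ p, (e, p) ∈ r.takeWhile (onEdge e) := by
  obtain ⟨h1, h2⟩ := firstKey_le_maxKey (rems := rems)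
  have hnil : maxKey rems = 0 → ∀ r ∈ rems, r = [] := fun h0 r hr => by
    have h3 := h1 r hr
    rw [h0] at h3
    cases r with
    | nil => rfl
    | cons z r => simp [firstKey] at h3
  rcases h2 with h2 | ⟨r, hr, h2⟩
  · exact .inl ⟨h2, hnil h2⟩
  · cases r with
    | nil => exact .inl ⟨h2, hnil h2⟩
    | cons z r =>
      refine .inr ⟨z.1, h2, fun r' hr' z' hz' => ?_, _, hr, z.2, ?_⟩
      · have h3 := h1 r' hr'
        obtain ⟨p, -, hs⟩ := h.exists_isCell hr'
        have hsort := (Y.cells_sorted (v, p)).sublist hs.sublist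
        rw [h2] at h3
        cases r' with
        | nil => simp at hz'
        | cons y r' =>
          have h4 : y.1 ≤ z.1 := by
            simp only [firstKey] at h3
            exact Fin.le_def.2 (by omega)
          rcases List.mem_cons.1 hz' with rfl | hz'
          · exact h4
          · exact ((List.pairwise_cons.1 hsort).1 z' hz').trans h4
      · rw [List.takeWhile_cons_of_pos (by simp [onEdge])]
        exact List.mem_cons_self

theorem runs_pop {σ : State} {Q : State → Prop} (hg : Y.Glob σ) :
    Runs pop σ Q ↔ Q ⟨Function.update (Function.update (Function.update σ.reg 20 (σ.reg 23)) 23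
      (σ.mem (σ.reg 23))) 22 (σ.reg 22 + 1), σ.mem, σ.clock + 3, σ.buf, σ.log⟩ := by
  unfold pop
  simp only [runs_seq, runs_add, runs_load]
  simp only [ne_eq, Nat.reduceEqDiff, not_false_eq_true, OfNat.ofNat_ne_zero,
    OfNat.zero_ne_ofNat, Function.update_of_ne, Function.update_self, hg.r0, Nat.add_zero]

variable (Y ns) in
/-- The machine is in front of a step of the search. The topmost frame of the stack is at the
address `f`, belongs to a node of the search tree, and holds the lists `rems`; the stack gives the
edges `suf`, to which `l` edges have to be prefixed. -/
structure AtNode (v : Fin n) (l : ℕ) (rems : List (List (Fin m × Fin q))) (suf : List (Fin m))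
    (f : ℕ) (σ : State) : Prop where
  glob : Y.Glob σ
  r20 : σ.reg 20 = f + 2 + rems.length
  r22 : σ.reg 22 = l
  r23 : σ.reg 23 = f
  enum : Y.EnumMem ns (σ.reg 24) σ.mem
  frame : Y.Frame ns σ.mem f rems
  stack : Y.StackAt ns σ.mem f suf
  node : Y.IsNode v l rems
  buf : σ.buf = []

variable (Y ns) in
/-- Between the states `σ` and `τ`, the frame at the address `f` has been removed from the stack,
and the answers `seg` have been delivered. -/
structure Popped (l f : ℕ) (σ τ : State) (seg : List (List ℕ × ℕ)) : Prop where
  glob : Y.Glob τ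
  r20 : τ.reg 20 = f
  r22 : τ.reg 22 = l + 1
  r23 : τ.reg 23 = σ.mem f
  enum : Y.EnumMem ns (τ.reg 24) τ.mem
  mem : ∀ a, Y.cellBase ns ≤ a → a < f → τ.mem a = σ.mem a
  buf : τ.buf = []
  log : τ.log = σ.log ++ seg

/-- The bound on the time of a step of the search. -/
noncomputable def stepTime (A : NFA (Fin k) (Fin q)) : ℕ := 30 * (q + numTrans A)

variable (Y) in
/-- The answers `seg` are the walks below a node of the search tree, each once. -/
def Delivers (l : ℕ) (rems : List (List (Fin m × Fin q))) (suf : List (Fin m))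
    (seg : List (List ℕ × ℕ)) : Prop :=
  ∃ ws : List (List (Fin m)),
    seg.map Prod.fst = ws.map (fun es => (s : ℕ) :: spellEdges D (es ++ suf)) ∧
    ws.Nodup ∧ ∀ es, es ∈ ws ↔ Y.PathSet l rems es

variable (Y ns) in
/-- Starting from the state `σ`, the search visits all descendants of the frame at the address
`f`, and removes it. -/
def Explores (lam : ℕ) (l : ℕ) (rems : List (List (Fin m × Fin q))) (suf : List (Fin m)) (f : ℕ)
    (σ : State) : Prop :=
  ∃ τ seg, Reaches (.lt 0 23) searchStep σ τ ∧ Y.Popped ns l f σ τ seg ∧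
    Timed (stepTime A) lam l (weight rems + Y.potential l) σ.clock τ.clock seg ∧
    Y.Delivers l rems suf seg ∧ (l = 0 ∨ (∃ r ∈ rems, r ≠ []) → seg ≠ [])

theorem AtNode.holds {v : Fin n} {l : ℕ} {rems : List (List (Fin m × Fin q))}
    {suf : List (Fin m)} {f : ℕ} {σ : State} (h : Y.AtNode ns v l rems suf f σ) :
    (Test.lt 0 23).Holds σ := by
  have h1 := h.stack.base
  have h2 := Y.cellBase_le ns
  have h3 := Y.recs_lt
  have h4 := h.glob.r0
  have h5 := h.r23
  unfold cellBase at h2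
  simp only [Test.Holds]
  omega

/-- At level `0` the walk on the stack is complete. -/
theorem AtNode.explores_leaf {lam : ℕ} {v : Fin n} {rems : List (List (Fin m × Fin q))}
    {suf : List (Fin m)} {f : ℕ} {σ : State} (h : Y.AtNode ns v 0 rems suf f σ)
    (hlam : suf.length = lam) : Y.Explores ns lam 0 rems suf f σ := by
  obtain ⟨τ, ⟨seg, h1, h2, h3, h4⟩, h5⟩ := Runs.reaches (p := searchStep) h.holds
    (R := fun τ => ∃ seg, Y.Popped ns 0 f σ τ seg ∧
      Timed (stepTime A) lam 0 (weight rems + Y.potential 0) σ.clock τ.clock seg ∧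
      Y.Delivers 0 rems suf seg ∧ seg ≠ []) (by
    unfold searchStep
    rw [runs_ite]
    refine ⟨fun _ => ?_, fun hn => absurd ?_ hn⟩
    · rw [runs_seq]
      refine (runs_output (σ := σ.tick.tick) (f := f) (suf := suf) (h.glob.of_reg fun _ _ => rfl)
        h.enum.low h.r23 h.stack h.buf).mono ?_
      rintro τ ⟨k1, k2, k3, k4, k5⟩
      simp only [State.tick] at k1 k2 k4 k5
      have hg : Y.Glob τ := h.glob.of_reg fun x hx => k2 x (by omega)
      rw [runs_pop hg]
      refine ⟨[((s : ℕ) :: spellEdges D suf, τ.clock)], ?_, ?_, ?_, by simp⟩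
      · constructor
        · refine hg.of_reg fun x hx => ?_
          simp [show x ≠ 20 by omega, show x ≠ 22 by omega, show x ≠ 23 by omega]
        · simp [k2, h.r23]
        · simp [k2, h.r22]
        · simp [k2, h.r23, k1]
        · simpa [k2, k1] using h.enum
        · exact fun a _ _ => by rw [k1]
        · exact k3
        · exact k4
      · refine ⟨by simp, ?_, ?_, ?_, by simp⟩ <;> simp <;> omega
      · refine ⟨[[]], by simp, by simp, fun es => ?_⟩
        rw [List.mem_singleton]
        refine ⟨fun hes => .inl ⟨rfl, hes⟩, ?_⟩
        rintro (⟨-, hes⟩ | ⟨r, hr, z, hz, -⟩)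
        · exact hes
        · exact absurd (h.node.cell hr hz).2 (by omega)
    · simp [Test.Holds, State.tick, h.r22, h.glob.r0])
  exact ⟨τ, seg, h5, h1, h2, h3, fun _ => h4⟩

/-- A frame whose lists are used up is removed. -/
theorem AtNode.explores_nil {lam l : ℕ} {v : Fin n} {rems : List (List (Fin m × Fin q))}
    {suf : List (Fin m)} {f : ℕ} {σ : State} (h : Y.AtNode ns v (l + 1) rems suf f σ)
    (hq : 0 < q) (h0 : maxKey rems = 0) (hnil : ∀ r ∈ rems, r = []) :
    Y.Explores ns lam (l + 1) rems suf f σ := by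
  obtain ⟨τ, ⟨h1, h2⟩, h3⟩ := Runs.reaches (p := searchStep) h.holds
    (R := fun τ => Y.Popped ns (l + 1) f σ τ [] ∧ τ.clock ≤ σ.clock + stepTime A) (by
    unfold searchStep
    rw [runs_ite]
    refine ⟨fun hn => ?_, fun _ => ?_⟩
    · simp [Test.Holds, State.tick, h.r22, h.glob.r0] at hn
    · rw [runs_seq]
      refine (runs_scan (σ := σ.tick.tick) (f := f) (rems := rems) (h.glob.of_reg fun _ _ => rfl)
        h.enum.nul h.r23 h.r20 h.frame).mono ?_
      rintro τ ⟨k1, k2, k3, k4⟩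
      simp only [State.tick] at k2 k4
      have k5 : ∀ x < 41, τ.reg x = σ.reg x := k3.reg
      have hg : Y.Glob τ := h.glob.of_reg fun x hx => k5 x (by omega)
      rw [runs_ite]
      refine ⟨fun _ => ?_, fun hn => ?_⟩
      · rw [runs_pop (σ := τ.tick) (hg.of_reg fun _ _ => rfl)]
        refine ⟨?_, ?_⟩
        · constructor
          · refine hg.of_reg fun x hx => ?_
            simp [State.tick, show x ≠ 20 by omega, show x ≠ 22 by omega, show x ≠ 23 by omega]
          · simp [State.tick, k5, h.r23]
          · simp [State.tick, k5, h.r22]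
          · simp [State.tick, k5, h.r23, k2]
          · simpa [State.tick, k5, k2] using h.enum
          · exact fun a _ _ => by simp [State.tick, k2]
          · exact k3.buf.trans h.buf
          · rw [List.append_nil]; exact k3.log
        · have := h.node.length_le
          simp only [State.tick, stepTime]
          omega
      · simp [Test.Holds, State.tick, k1, h0, hg.r0] at hn)
  refine ⟨τ, [], h3, h1, ⟨by simp, by simp, by simp, by simp, fun _ => h2⟩,
    ⟨[], rfl, by simp, fun es => ?_⟩, ?_⟩
  · simp only [List.not_mem_nil, false_iff]
    rintro (⟨h, -⟩ | ⟨r, hr, z, hz, -⟩)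
    · omega
    · rw [hnil r hr] at hz
      simp at hz
  · rintro (h | ⟨r, hr, hne⟩)
    · omega
    · exact absurd (hnil r hr) hne

/-- A push takes time proportional to the number of lists in the frame and of the steps that are
removed from them, which is bounded in terms of the automaton alone, and by the weight of the
frame. -/
theorem IsNode.push_time {v : Fin n} {l : ℕ} {rems : List (List (Fin m × Fin q))}
    (h : Y.IsNode v l rems) (hne : rems ≠ []) (e : Fin m) :
    6 * rems.length + (rems.map fun r => 10 * (r.takeWhile (onEdge e)).length + 6).sum + 16 ≤
      stepTime A ∧
    6 * rems.length + (rems.map fun r => 10 * (r.takeWhile (onEdge e)).length + 6).sum + 16 ≤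
      30 * weight rems := by
  have h1 := h.length_le
  have h2 := h.sum_takeWhile_le e
  have h3 := List.length_pos_iff.2 hne
  have h4 : (rems.map fun r => 10 * (r.takeWhile (onEdge e)).length + 6).sum =
      10 * (rems.map fun r => (r.takeWhile (onEdge e)).length).sum + 6 * rems.length := by
    clear h h1 h2 h3 hne
    induction rems with
    | nil => rfl
    | cons r rems ih => simp only [List.map_cons, List.sum_cons, List.length_cons, ih]; omega
  have h5 : (rems.map fun r => (r.takeWhile (onEdge e)).length).sum + rems.length ≤
      weight rems := by
    clear h h1 h2 h3 hne h4
    unfold weight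
    induction rems with
    | nil => rfl
    | cons r rems ih =>
      have := (List.takeWhile_prefix (l := r) (onEdge e)).length_le
      simp only [List.map_cons, List.sum_cons, List.length_cons]
      omega
  rw [h4, stepTime]
  omega

theorem AtNode.exists_push {l : ℕ} {v : Fin n} {rems : List (List (Fin m × Fin q))}
    {suf : List (Fin m)} {f : ℕ} {σ : State} {e : Fin m}
    (hB : BfsInv Y.start Y.succ ns.length ns) (h : Y.AtNode ns v (l + 1) rems suf f σ)
    (he : maxKey rems = e + 1) (hne : rems ≠ []) :
    ∃ τ, Reaches (.lt 0 23) searchStep σ τ ∧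
      Y.AtNode ns (D.src e) l ((children e rems []).map fun p => Y.cells (D.src e, p)) (e :: suf)
        (f + 2 + rems.length) τ ∧
      Y.Frame ns τ.mem f (rems.map (List.dropWhile (onEdge e))) ∧
      (∀ a, Y.cellBase ns ≤ a → a < f + 2 → τ.mem a = σ.mem a) ∧
      τ.mem (f + 2 + rems.length) = f ∧ τ.log = σ.log ∧ τ.clock ≤ σ.clock + stepTime A ∧
      τ.clock ≤ σ.clock + 30 * weight rems := by
  obtain ⟨τ, h1, h2⟩ := Runs.reaches (p := searchStep) h.holds
    (R := fun τ => Y.AtNode ns (D.src e) l ((children e rems []).map fun p => Y.cells (D.src e, p))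
        (e :: suf) (f + 2 + rems.length) τ ∧
      Y.Frame ns τ.mem f (rems.map (List.dropWhile (onEdge e))) ∧
      (∀ a, Y.cellBase ns ≤ a → a < f + 2 → τ.mem a = σ.mem a) ∧
      τ.mem (f + 2 + rems.length) = f ∧ τ.log = σ.log ∧ τ.clock ≤ σ.clock + stepTime A ∧
      τ.clock ≤ σ.clock + 30 * weight rems) (by
    unfold searchStep
    rw [runs_ite]
    refine ⟨fun hn => ?_, fun _ => ?_⟩
    · simp [Test.Holds, State.tick, h.r22, h.glob.r0] at hn
    · rw [runs_seq]
      refine (runs_scan (σ := σ.tick.tick) (f := f) (rems := rems) (h.glob.of_reg fun _ _ => rfl)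
        h.enum.nul h.r23 h.r20 h.frame).mono ?_
      rintro τ ⟨k1, k2, k3, k4⟩
      simp only [State.tick] at k2 k4
      have k5 : ∀ x < 41, τ.reg x = σ.reg x := k3.reg
      have hg : Y.Glob τ := h.glob.of_reg fun x hx => k5 x (by omega)
      rw [runs_ite]
      refine ⟨fun hn => ?_, fun _ => ?_⟩
      · simp [Test.Holds, k1, he, hg.r0] at hn
      · refine (runs_push (σ := τ.tick) (f := f) (stamp := σ.reg 24) (e := e) (rems := rems)
          (hg.of_reg fun _ _ => rfl) (by simpa [State.tick, k2] using h.enum)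
          (by simp [State.tick, k1, he]) (by simp [State.tick, k5, h.r23])
          (by simp [State.tick, k5, h.r20]) (by simp [State.tick, k5]) h.stack.base
          (by simpa [State.tick, k2] using h.frame)
          (fun r hr z hz => hB.mem_iff.2 (h.node.cell hr hz).1)).mono ?_
        rintro υ ⟨p1, p2, p3, p4, p5, p6, p7, p8, p9, p10, p11, p12⟩
        simp only [State.tick, k2] at p7 p9 p10 p11 p12
        have hcb := Y.cellBase_le ns
        have hpt := h.node.push_time hne e
        refine ⟨?_, p8, p9, p3, p11.trans k3.log, by omega, by omega⟩
        constructor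
        · exact p1
        · simpa using p5.top
        · rw [p7, k5 22 (by norm_num), h.r22]; rfl
        · exact p2
        · rw [p6]; exact p5.enum
        · exact p5.frame
        · refine ⟨p5.base, p4, by omega, ?_⟩
          rw [p3]
          exact h.stack.congr fun a ha ha' => p9 a (by omega) ha'
        · refine isNode_map_cells p5.nodup fun p hp => ?_
          rcases mem_children.1 hp with hp | ⟨r, hr, hp⟩
          · simp at hp
          · have h6 := h.node.cell hr ((List.takeWhile_prefix _).subset hp)
            exact ⟨h6.1, by have := h6.2; dsimp only at this; omega⟩
        · exact p10.trans (k3.buf.trans h.buf))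
  exact ⟨τ, h2, h1⟩

/-- The walks below a frame are delivered in the order of their last missing edges, from the largest
to the smallest. -/
theorem Delivers.append {l : ℕ} {rems : List (List (Fin m × Fin q))} {suf : List (Fin m)}
    {v : Fin n} {e : Fin m} {seg₁ seg₂ : List (List ℕ × ℕ)} (h : Y.IsNode v (l + 1) rems)
    (hle : ∀ r ∈ rems, ∀ z ∈ r, z.1 ≤ e) (hne : children e rems [] ≠ [])
    (hch : ∀ p ∈ children e rems [], Y.Disc (D.src e, p) ∧ Y.lev (D.src e, p) = l)
    (h₁ : Y.Delivers l ((children e rems []).map fun p => Y.cells (D.src e, p)) (e :: suf) seg₁)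
    (h₂ : Y.Delivers (l + 1) (rems.map (List.dropWhile (onEdge e))) suf seg₂) :
    Y.Delivers (l + 1) rems suf (seg₁ ++ seg₂) := by
  obtain ⟨ws₁, e₁, n₁, m₁⟩ := h₁
  obtain ⟨ws₂, e₂, n₂, m₂⟩ := h₂
  refine ⟨ws₁.map (· ++ [e]) ++ ws₂, ?_, ?_, fun es => ?_⟩
  · rw [List.map_append, List.map_append, e₁, e₂, List.map_map]
    congr 1
    refine List.map_congr_left fun es _ => ?_
    simp
  · refine List.Nodup.append (n₁.map fun a b hab => List.append_cancel_right hab) n₂ ?_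
    intro es h3 h4
    obtain ⟨es', -, rfl⟩ := List.mem_map.1 h3
    exact pathSet_dropWhile_ne h hle ((m₂ _).1 h4) es' rfl
  · rw [List.mem_append, List.mem_map, m₂, pathSet_split (rems := rems) (e := e)]
    refine or_congr_left ?_
    simp only [m₁, pathSet_map_cells hne hch]
    constructor
    · rintro ⟨es', ⟨p, hp, hes⟩, rfl⟩
      exact ⟨p, hp, es', hes, rfl⟩
    · rintro ⟨p, hp, es', hes, rfl⟩
      exact ⟨es', ⟨p, hp, hes⟩, rfl⟩

/-- The induction is on the level of the frame, and, within a level, on the number of the remaining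
steps in its lists. -/
theorem AtNode.explores {lam l : ℕ} {v : Fin n} {rems : List (List (Fin m × Fin q))}
    {suf : List (Fin m)} {f : ℕ} {σ : State} (hB : BfsInv Y.start Y.succ ns.length ns)
    (hq : 0 < q) (h : Y.AtNode ns v l rems suf f σ) (hlam : suf.length + l = lam) :
    Y.Explores ns lam l rems suf f σ := by
  induction l generalizing v rems suf f σ with
  | zero => exact h.explores_leaf hlam
  | succ l ihl =>
    -- within a level, the lists of the frame get shorter
    generalize hN : (rems.map List.length).sum = N
    induction N using Nat.strong_induction_on generalizing rems σ with
    | _ N ihN =>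
      rcases h.node.maxKey_cases with ⟨h0, hnil⟩ | ⟨e, he, hle, r₀, hr₀, p₀, hp₀⟩
      · exact h.explores_nil hq h0 hnil
      have hne : rems ≠ [] := List.ne_nil_of_mem hr₀
      have hch : children e rems [] ≠ [] :=
        List.ne_nil_of_mem (mem_children.2 (.inr ⟨r₀, hr₀, hp₀⟩))
      have hlev : ∀ p ∈ children e rems [], Y.Disc (D.src e, p) ∧ Y.lev (D.src e, p) = l := by
        intro p hp
        rcases mem_children.1 hp with hp | ⟨r, hr, hp⟩
        · simp at hp
        · have h6 := h.node.cell hr ((List.takeWhile_prefix _).subset hp)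
          exact ⟨h6.1, by have := h6.2; dsimp only at this; omega⟩
      obtain ⟨σ₁, hσ₁, hA, hF, hm, hg, hlog, hK, hw⟩ := h.exists_push hB he hne
      obtain ⟨σ₂, seg₁, hσ₂, hP, hT, hD, hseg⟩ := ihl hA (by simp only [List.length_cons]; omega)
      have hseg₁ : seg₁ ≠ [] := by
        refine hseg ?_
        obtain ⟨p, hp⟩ := List.exists_mem_of_ne_nil _ hch
        rcases Nat.eq_zero_or_pos l with hl | hl
        · exact .inl hl
        · exact .inr ⟨_, List.mem_map.2 ⟨p, hp, rfl⟩,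
            cells_ne_nil (hlev p hp).1 (by rw [(hlev p hp).2]; exact hl)⟩
      have hbase := h.stack.base
      have hcb := Y.cellBase_le ns
      have hA₂ : Y.AtNode ns v (l + 1) (rems.map (List.dropWhile (onEdge e))) suf f σ₂ := by
        constructor
        · exact hP.glob
        · rw [hP.r20, List.length_map]
        · exact hP.r22
        · rw [hP.r23, hg]
        · exact hP.enum
        · refine hF.congr hbase fun a ha ha' => hP.mem a ha ?_
          rwa [List.length_map] at ha'
        · exact (h.stack.congr fun a ha ha' => hm a (by omega) ha').congr
            fun a ha ha' => hP.mem a (by omega) (by omega)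
        · exact h.node.dropWhile e
        · exact hP.buf
      have hlt : ((rems.map (List.dropWhile (onEdge e))).map List.length).sum < N := by
        rw [← hN, List.map_map]
        refine List.sum_lt_sum _ _ (fun r _ => (List.dropWhile_suffix _).length_le) ⟨r₀, hr₀, ?_⟩
        have h7 := congrArg List.length (List.takeWhile_append_dropWhile (p := onEdge e) (l := r₀))
        have h8 := List.length_pos_of_mem hp₀
        rw [List.length_append] at h7
        dsimp only [Function.comp]
        omega
      obtain ⟨σ₃, seg₂, hσ₃, hP', hT', hD', -⟩ := ihN _ hlt hA₂ rfl
      refine ⟨σ₃, seg₁ ++ seg₂, (hσ₁.trans hσ₂).trans hσ₃, ?_, ?_,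
        hD.append h.node hle hch hlev hD', fun _ => by simp [hseg₁]⟩
      · constructor
        · exact hP'.glob
        · exact hP'.r20
        · exact hP'.r22
        · rw [hP'.r23, hP.mem f (by omega) (by omega), hm f (by omega) (by omega)]
        · exact hP'.enum
        · intro a ha ha'
          rw [hP'.mem a ha ha', hP.mem a ha (by omega), hm a ha (by omega)]
        · exact hP'.buf
        · rw [hP'.log, hP.log, hlog, List.append_assoc]
      · have h10 := weight_add_potential_le (nodup_children e rems List.nodup_nil)
          fun p hp => (hlev p hp).2
        exact hT.append hseg₁ hT' hK (by omega) (by omega)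

end Layout

namespace Layout

variable {k n m q : ℕ} {M : ℕ → ℕ} {D : Database (Fin k) (Fin n) (Fin m)}
  {A : NFA (Fin k) (Fin q)} {s t : Fin n} {Y : Layout M D A s t}
  {ns : List ((Fin n × Fin q) × ℕ)}

/-! ### The whole program -/

theorem CellPath.disc {es : List (Fin m)} {x : Fin n × Fin q} (h : Y.CellPath es x) : Y.Disc x :=
  ⟨_, Y.reach_iff.2 ⟨es, rfl, h.runTo⟩⟩

/-- The enumeration proper, in a state with `lam + 1` in register `22`. -/
theorem runs_search {σ : State} {lam : ℕ} {p₀ : Fin q} (hq : 0 < q)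
    (hB : BfsInv Y.start Y.succ ns.length ns) (hI : Y.LinkState ns Y.allLinks σ.mem (σ.reg 20))
    (hg : Y.Glob σ) (h22 : σ.reg 22 = lam + 1) (hbuf : σ.buf = []) (hlog : σ.log = [])
    (hp₀ : p₀ ∈ Y.acceptL) (hd₀ : Y.Disc (t, p₀)) (hl₀ : Y.lev (t, p₀) = lam) :
    Runs (.seq rootFrame (.loop (.lt 0 23) searchStep)) σ fun τ => τ.buf = [] ∧ τ.log ≠ [] ∧
      (∃ ws : List (List (Fin m)),
        τ.log.map Prod.fst = ws.map (fun es => (s : ℕ) :: spellEdges D es) ∧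
        ws.Nodup ∧ ∀ es, es ∈ ws ↔ ∃ p ∈ A.accept, Y.lev (t, p) = lam ∧ Y.CellPath es (t, p)) ∧
      (τ.log.IsChain fun x y => y.2 ≤ x.2 + lam * (2 * stepTime A + 22)) ∧
      (∀ x ∈ τ.log.head?, x.2 ≤ σ.clock + 10 * Y.acceptL.length + 30 * Y.potential (lam + 1) +
        7 * lam + 20) ∧
      ∀ x ∈ τ.log.getLast?, τ.clock ≤ x.2 + (lam * stepTime A + 6) := by
  rw [runs_seq]
  refine (runs_rootFrame hB hI hg h22).mono ?_
  rintro σ₁ ⟨ps, hps, hg₁, hE, h0, hF, r20, r22, r23, r24, b₁, l₁, c₁⟩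
  have hmem : ∀ p, p ∈ ps ↔ p ∈ A.accept ∧ Y.Disc (t, p) ∧ Y.lev (t, p) = lam := fun p => by
    simp only [hps, List.mem_filter, decide_eq_true_eq, Y.accept_lists.2 p]
  have hp : p₀ ∈ ps := (hmem p₀).2 ⟨(Y.accept_lists.2 p₀).1 hp₀, hd₀, hl₀⟩
  have hnd : ps.Nodup := hps ▸ Y.accept_lists.1.filter _
  have hdl : ∀ p ∈ ps, Y.Disc (t, p) ∧ Y.lev (t, p) = lam := fun p hp => ((hmem p).1 hp).2
  have hA : Y.AtNode ns t lam (ps.map fun p => Y.cells (t, p)) [] (Y.stackBase ns) σ₁ :=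
    ⟨hg₁, by simpa using r20, r22, r23, by rwa [r24], hF, ⟨le_rfl, h0⟩, isNode_map_cells hnd hdl,
      b₁.trans hbuf⟩
  obtain ⟨τ, seg, hτ, hP, hT, ⟨ws, e₁, n₁, m₁⟩, hne⟩ := hA.explores hB hq (lam := lam) (by simp)
  refine hτ _ (runs_loop_false ?_ ?_)
  · simp [Test.Holds, hP.r23, h0, hP.glob.r0]
  have hlogτ : τ.tick.log = seg := by
    change τ.log = seg
    rw [hP.log, l₁, hlog, List.nil_append]
  rw [hlogτ]
  refine ⟨hP.buf, hne ?_, ⟨ws, by simpa using e₁, n₁, fun es => ?_⟩, hT.chain, fun x hx => ?_,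
    fun x hx => ?_⟩
  · rcases Nat.eq_zero_or_pos lam with h | h
    · exact .inl h
    · exact .inr ⟨_, List.mem_map.2 ⟨p₀, hp, rfl⟩, cells_ne_nil hd₀ (by omega)⟩
  · rw [m₁, pathSet_map_cells (List.ne_nil_of_mem hp) hdl]
    constructor
    · rintro ⟨p, hp, hes⟩
      exact ⟨p, ((hmem p).1 hp).1, (hdl p hp).2, hes⟩
    · rintro ⟨p, hp, hl, hes⟩
      exact ⟨p, (hmem p).2 ⟨hp, hes.disc, hl⟩, hes⟩
  · have h1 := hT.first_pot x hx
    have h2 := weight_add_potential_le hnd fun p hp => (hdl p hp).2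
    omega
  · have h1 := hT.last x hx
    simp only [State.tick]
    omega

variable (Y) in
/-- The size of the input bounds the terms that occur in the time of the preprocessing. -/
theorem le_size_mul_automatonSize (hq : 0 < q) :
    n ≤ D.size * automatonSize A ∧ n * q + m * numTrans A ≤ D.size * automatonSize A ∧
      Y.startL.length ≤ D.size * automatonSize A ∧
      Y.acceptL.length ≤ D.size * automatonSize A := by
  have hn : 0 < n := Fin.pos s
  have hA := Y.automatonSize_eq
  have hD : n + m ≤ D.size := by simp [Database.size]
  have h1 : automatonSize A ≤ D.size * automatonSize A := Nat.le_mul_of_pos_left _ (by omega)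
  refine ⟨?_, ?_, by omega, by omega⟩
  · calc n = n * 1 := (Nat.mul_one n).symm
      _ ≤ D.size * automatonSize A := Nat.mul_le_mul (by omega) (by omega)
  · calc n * q + m * numTrans A ≤ n * automatonSize A + m * automatonSize A :=
        Nat.add_le_add (Nat.mul_le_mul_left _ (by omega)) (Nat.mul_le_mul_left _ (by omega))
      _ = (n + m) * automatonSize A := (Nat.add_mul _ _ _).symm
      _ ≤ D.size * automatonSize A := Nat.mul_le_mul_right _ hD

variable (D A s t) in
/-- The final state of a correct run of the program, within the time bounds for the constant
`c`. -/
structure Enumerates (c : ℕ) (σ : State) : Prop where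
  nodup : (σ.log.map Prod.fst).Nodup
  mem : ∀ o : List ℕ, o ∈ σ.log.map Prod.fst ↔ ∃ w ∈ D.shortestWalks A s t, w.spell = o
  buf : σ.buf = []
  head : ∀ x ∈ σ.log.head?, x.2 ≤ c * (D.size * automatonSize A + 1)
  chain : σ.log.IsChain fun x y => y.2 ≤ x.2 + c * (D.minLen A s t * automatonSize A)
  nil : σ.log = [] → σ.clock ≤ c * (D.size * automatonSize A + 1)
  last : ∀ x ∈ σ.log.getLast?, σ.clock ≤ x.2 + c * (D.minLen A s t * automatonSize A + 1)

theorem enumerates_of_log_eq_nil {σ : State} {c : ℕ} (h : ∀ p ∈ A.accept, ¬ Y.Disc (t, p))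
    (hbuf : σ.buf = []) (hlog : σ.log = [])
    (hc : σ.clock ≤ c * (D.size * automatonSize A + 1)) : Enumerates D A s t c σ := by
  constructor <;> simp [hlog, hbuf, Y.shortestWalks_eq_empty h, hc]

theorem runs_enumerate (Y : Layout M D A s t) :
    Runs enumerate (State.init M) (Enumerates D A s t 150) := by
  unfold enumerate
  rw [runs_seq]
  refine Y.runs_setup.mono ?_
  rintro σ₁ ⟨hg₁, m₁, b₁, l₁, c₁⟩
  rw [runs_ite]
  simp only [Test.Holds, hg₁.r0, hg₁.r12]
  refine ⟨fun hq => ?_, fun hq => ?_⟩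
  -- without states `|D| * |A|` may be `0`, so there is no time to visit all vertices
  · subst hq
    rw [runs_nop]
    refine enumerates_of_log_eq_nil (Y := Y) (fun p => p.elim0) b₁ l₁ ?_
    simp only [State.tick]
    omega
  have hq : 0 < q := Nat.pos_of_ne_zero hq
  obtain ⟨z₁, z₂, z₃, z₄⟩ := Y.le_size_mul_automatonSize hq
  have hA := Y.automatonSize_eq
  rw [runs_seq]
  refine (Y.runs_rows (σ := σ₁.tick) (hg₁.of_reg fun _ _ => rfl) m₁).mono ?_
  rintro σ₂ ⟨hI₂, B₂, c₂⟩
  have hg₂ : Y.Glob σ₂ := (hg₁.of_reg fun _ _ => rfl : Y.Glob σ₁.tick).of_below B₂ (by norm_num)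
  rw [runs_seq]
  refine (runs_bfs hI₂ hg₂).mono ?_
  rintro σ₃ ⟨ns, hB, hI₃, B₃, c₃⟩
  have hg₃ : Y.Glob σ₃ := hg₂.of_below B₃ (by norm_num)
  rw [runs_seq]
  refine (runs_linkAll hq hB hI₃.linkState hg₃).mono ?_
  rintro σ₄ ⟨hI₄, B₄, c₄⟩
  have hg₄ : Y.Glob σ₄ := hg₃.of_below B₄ (by norm_num)
  rw [runs_seq]
  refine (runs_findLevel hB hI₄.1.toTables hg₄).mono ?_
  rintro σ₅ ⟨h22, m₅, r20, B₅, c₅⟩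
  have hg₅ : Y.Glob σ₅ := hg₄.of_below B₅ (by norm_num)
  have hbuf : σ₅.buf = [] := by rw [B₅.buf, B₄.buf, B₃.buf, B₂.buf]; exact b₁
  have hlog : σ₅.log = [] := by rw [B₅.log, B₄.log, B₃.log, B₂.log]; exact l₁
  simp only [State.tick] at c₂
  have hc₅ : σ₅.clock ≤ 96 * (D.size * automatonSize A) + 54 := by
    have : n * q ≤ D.size * automatonSize A := by omega
    omega
  rw [runs_ite]
  simp only [Test.Holds, hg₅.r0, h22]
  rcases Y.foldl_minLevel Y.acceptL with ⟨h0, hno⟩ | ⟨p₀, hp₀, hd₀, h0, hmin⟩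
  · refine ⟨fun _ => ?_, fun hn => absurd h0 hn⟩
    rw [runs_nop]
    refine enumerates_of_log_eq_nil (Y := Y) (fun p hp => hno p ((Y.accept_lists.2 p).2 hp)) hbuf
      hlog ?_
    simp only [State.tick]
    omega
  · refine ⟨fun hn => by omega, fun _ => ?_⟩
    have hacc : p₀ ∈ A.accept := (Y.accept_lists.2 p₀).1 hp₀
    have hmin' : ∀ p' ∈ A.accept, Y.Disc (t, p') → Y.lev (t, p₀) ≤ Y.lev (t, p') :=
      fun p' hp' => hmin p' ((Y.accept_lists.2 p').2 hp')
    refine (runs_search (σ := σ₅.tick) hq hB (lam := Y.lev (t, p₀))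
      (by simpa only [State.tick, m₅, r20] using hI₄)
      (hg₅.of_reg fun _ _ => rfl) (h22.trans h0) hbuf hlog hp₀ hd₀ rfl).mono ?_
    rintro τ ⟨hb, hne, ⟨ws, e₁, n₁, m₁⟩, hch, hhd, hla⟩
    have hlam := Y.minLen_eq hacc hd₀ hmin'
    have hpot := Y.potential_le (Y.lev (t, p₀) + 1)
    have hlt := Y.lev_lt hd₀
    constructor
    · rw [e₁]
      exact n₁.map fun a b hab => spellEdges_injective D (List.cons.inj hab).2
    · intro o
      rw [e₁, List.mem_map, Y.shortest_iff hacc hd₀ hmin']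
      simp only [m₁]
    · exact hb
    · intro x hx
      have h1 := hhd x hx
      simp only [State.tick] at h1
      omega
    · refine hch.imp fun x y hxy => hxy.trans (Nat.add_le_add_left ?_ _)
      rw [hlam, Nat.mul_left_comm]
      refine Nat.mul_le_mul_left _ ?_
      unfold stepTime
      omega
    · exact fun h => absurd h hne
    · intro x hx
      refine (hla x hx).trans (Nat.add_le_add_left ?_ _)
      rw [hlam, Nat.mul_add, Nat.mul_left_comm]
      refine Nat.add_le_add (Nat.mul_le_mul_left _ ?_) (by norm_num)
      unfold stepTime
      omega

end Layout

/-- One machine program enumerates, on every input, the shortest matching walks, each exactly once.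
The conjuncts after the one on the answers bound the time before the first answer, the time
between two consecutive answers, and the time until the machine halts when there are no answers
or after the last one. -/
theorem mainTheorem1 :
    ∃ (P : RAM.Prog) (c : ℕ),
      ∀ (k n m q : ℕ) (D : Database (Fin k) (Fin n) (Fin m)) (A : NFA (Fin k) (Fin q))
        (s t : Fin n) (M : ℕ → ℕ), Represents M D A s t →
        ∃ σ : RAM.State, RAM.Exec P (RAM.State.init M) σ ∧
          (σ.log.map Prod.fst).Nodup ∧
          (∀ o : List ℕ, o ∈ σ.log.map Prod.fst ↔ ∃ w ∈ D.shortestWalks A s t, w.spell = o) ∧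
          σ.buf = [] ∧
          (∀ x ∈ σ.log.head?, x.2 ≤ c * (D.size * automatonSize A + 1)) ∧
          σ.log.IsChain (fun x y => y.2 ≤ x.2 + c * (D.minLen A s t * automatonSize A)) ∧
          (σ.log = [] → σ.clock ≤ c * (D.size * automatonSize A + 1)) ∧
          (∀ x ∈ σ.log.getLast?, σ.clock ≤ x.2 + c * (D.minLen A s t * automatonSize A + 1)) := by
  refine ⟨enumerate, 150, fun k n m q D A s t M h => ?_⟩
  obtain ⟨Y⟩ := h.nonempty_layout
  obtain ⟨σ, hσ, h⟩ := Y.runs_enumerate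
  exact ⟨σ, hσ, h.nodup, h.mem, h.buf, h.head, h.chain, h.nil, h.last⟩
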